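/- **Setting.** Let $\mathbf T^d=(\mathbf R/2\pi\mathbf Z)^d$. For a real vector field $v$ on $\mathbf T^d$ let $v_k=(2\pi)^{-d}\int_{\mathbf T^d} v(x)e^{-ik\cdot x}\,dx\in\mathbf C^d$, $k\in\mathbf Z^d$, be its Fourier coefficients. For real $n\ge 0$ let $\mathbb H^n$ be the space of the divergence free, zero mean fields $v\in L^2(\mathbf T^d,\mathbf R^d)$ (i.e. $k\cdot v_k=0$ for all $k$ and $v_0=0$) such that $\sum_{k\ne0}|k|^{2n}|v_k|^2<\infty$, with inner product $\langle v|w\rangle_n=(2\pi)^d\sum_{k\neq 0}|k|^{2n}\,\overline{v_k}\cdot w_k$ and norm $\|v\|_n=\sqrt{\langle v|v\rangle_n}$; let $\mathbb H^\infty=\cap_n\mathbb H^n$, with the Fréchet topology of all these norms ($\mathbb H^\infty$ consists of the $C^\infty$ divergence free, zero mean fields). Let $\mathcal P(v,w)=-\mathfrak L(v\cdot\partial w)$, where $(v\cdot\partial w)_r=\sum_s v_s\partial_sw_r$ and $\mathfrak L$ is the Leray projection. For $R\in(0,+\infty)$ and $u_*\in\mathbb H^\infty$ consider the Navier–Stokes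 (NS) Cauchy problem $$\frac{du}{dt}=\Delta u+R\,\mathcal P(u,u),\qquad u(0)=u_*,\qquad u\in C^\infty([0,T),\mathbb H^\infty),\quad T\in(0,+\infty].$$ A solution is called maximal if it is not extendable. For real $p\geq n>d/2+1$, let $K_n,G_n,K_p,G_p,G_{pn}$ denote any real constants such that, for $m=n$ and $m=p$, $$\|\mathcal P(v,w)\|_m\le K_m\|v\|_m\|w\|_{m+1},\qquad |\langle\mathcal P(v,w)|w\rangle_m|\le G_m\|v\|_m\|w\|_m^2\qquad(v\in\mathbb H^m,\ w\in\mathbb H^{m+1}),$$ $$|\langle\mathcal P(v,w)|w\rangle_p|\le\tfrac12G_{pn}\big(\|v\|_p\|w\|_n+\|v\|_n\|w\|_p\big)\|w\|_p\qquad(v\in\mathbb H^p,\ w\in\mathbb H^{p+1}).$$ For $N\in\{0,1,2,\dots\}$ let $u^N(t)=\sum_{j=0}^NR^ju_j(t)$ for $t\in[0,+\infty)$, where $$u_0(t)=e^{t\Delta}u_*,\qquad u_j(t)=\sum_{\ell=0}^{j-1}\int_0^te^{(t-s)\Delta}\,\mathcal P(u_\ell(s),u_{j-\ell-1}(s))\,ds\quad(j\ge1).$$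 Say that $\mathcal D_m,\epsilon_m\in C([0,+\infty),[0,+\infty))$ are a growth and an error estimator of order $m$ if, for all $t\ge0$, $$\|u^N(t)\|_m\le\mathcal D_m(t),\qquad\Big\|\Big(\frac{du^N}{dt}-\Delta u^N-R\,\mathcal P(u^N,u^N)\Big)(t)\Big\|_m\le\epsilon_m(t).$$ **Proposition.** The NS Cauchy problem has a maximal solution. Moreover: (i) Let $n>d/2+1$ be real, let $\mathcal D_n,\mathcal D_{n+1}$ be growth estimators of orders $n,n+1$ and let $\epsilon_n$ be an error estimator of order $n$. Assume that, for some $T_c\in(0,+\infty]$, a function $\mathcal R_n\in C^1([0,T_c),\mathbf R)$ solves $$\frac{d\mathcal R_n}{dt}=-\mathcal R_n+R\,(G_n\mathcal D_n+K_n\mathcal D_{n+1})\mathcal R_n+R\,G_n\mathcal R_n^2+\epsilon_n,\qquad\mathcal R_n(0)=0.$$ If $u\in C^\infty([0,T),\mathbb H^\infty)$ is the maximal solution of the NS Cauchy problem, then $T\ge T_c$ and $$\|u(t)-u^N(t)\|_n\le\mathcal R_n(t)\qquad\text{for }t\in[0,T_c).$$ In particular $u$ is global ($T=+\infty$) if $T_c=+\infty$.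 (ii) In addition let $p>n$ be real, let $\mathcal D_p,\mathcal D_{p+1}$ be growth estimators of orders $p,p+1$ and let $\epsilon_p$ be an error estimator of order $p$. The linear problem $$\frac{d\mathcal R_p}{dt}=-\mathcal R_p+R\,(G_p\mathcal D_p+K_p\mathcal D_{p+1}+G_{pn}\mathcal R_n)\mathcal R_p+\epsilon_p,\qquad\mathcal R_p(0)=0,$$ has on $[0,T_c)$ one and only one solution, given by $$\mathcal R_p(t)=e^{-t+R\mathcal A_p(t)}\int_0^te^{s-R\mathcal A_p(s)}\epsilon_p(s)\,ds,\qquad\mathcal A_p(t)=\int_0^t\big(G_p\mathcal D_p(s)+K_p\mathcal D_{p+1}(s)+G_{pn}\mathcal R_n(s)\big)ds,$$ and $$\|u(t)-u^N(t)\|_p\le\mathcal R_p(t)\qquad\text{for }t\in[0,T_c).$$ In particular $\mathcal R_n(t),\mathcal R_p(t)\ge0$ on $[0,T_c)$. -/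

import Mathlib

open MeasureTheory Set Filter Topology

noncomputable section

namespace NSReynolds

instance twoPiPos : Fact (0 < 2 * Real.pi) := ⟨Real.two_pi_pos⟩

/-- The torus `(ℝ / 2πℤ)^d`; its `volume` has total mass `(2π)^d`. -/
abbrev Torus (d : ℕ) : Type := Fin d → AddCircle (2 * Real.pi)

/-- Square integrable `ℝ^d`-valued fields on the torus, modulo equality a.e.  All the Sobolev
spaces below have order `≥ 0` and are sets of such fields. -/
abbrev L2Field (d : ℕ) : Type :=
  Lp (EuclideanSpace ℝ (Fin d)) 2 (volume : Measure (Torus d))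

variable {d : ℕ}

/-- The Fourier coefficient `v_k = (2π)^{-d} ∫ e^{-i k·x} v(x) dx ∈ ℂ^d`
(on `AddCircle (2π)`, `fourier m` is the character `x ↦ e^{i m x}`). -/
def fourierVec (v : Torus d → EuclideanSpace ℝ (Fin d)) (k : Fin d → ℤ) :
    EuclideanSpace ℂ (Fin d) :=
  WithLp.toLp 2 fun r =>
    (((2 * Real.pi : ℝ) : ℂ) ^ d)⁻¹ *
      ∫ x : Torus d, (∏ s, fourier (-(k s)) (x s)) * ((v x r : ℝ) : ℂ)

/-- The field of `L²` with prescribed Fourier coefficients (it is unique when it exists;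
the value is `0` if there is no such field). -/
def ofFourier (c : (Fin d → ℤ) → EuclideanSpace ℂ (Fin d)) : L2Field d :=
  open Classical in
  if h : ∃ v : L2Field d, ∀ k, fourierVec v k = c k then h.choose else 0

/-- `|k|²`. -/
def freqSq (k : Fin d → ℤ) : ℝ := ∑ s, (k s : ℝ) ^ 2

/-- The weight `|k|^{2n}` for `k ≠ 0`; the zero mode gets weight `0`. -/
def sobolevWeight (n : ℝ) (k : Fin d → ℤ) : ℝ :=
  if k = 0 then 0 else freqSq k ^ n

/-- The Sobolev space `ℍⁿ`, `n ≥ 0`, of divergence free, zero mean vector fields on the torus. -/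
def sobolevSpace (d : ℕ) (n : ℝ) : Set (L2Field d) :=
  {v | (∀ k : Fin d → ℤ, ∑ s, (k s : ℂ) * fourierVec v k s = 0) ∧
    fourierVec v 0 = 0 ∧
    Summable fun k : Fin d → ℤ => sobolevWeight n k * ‖fourierVec v k‖ ^ 2}

/-- `ℍ^∞`, the intersection of all the spaces `ℍⁿ`. -/
def sobolevInf (d : ℕ) : Set (L2Field d) := ⋂ n : ℕ, sobolevSpace d (n : ℝ)

/-- The inner product `⟨v | w⟩_n = (2π)^d ∑_{k ≠ 0} |k|^{2n} conj(v_k) · w_k`.  The sum is real,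
because `conj(v_k) = v_{-k}` for real fields, and it is written as the sum of the real parts. -/
def sobolevInner (n : ℝ) (v w : L2Field d) : ℝ :=
  (2 * Real.pi) ^ d *
    ∑' k : Fin d → ℤ, sobolevWeight n k * (inner ℂ (fourierVec v k) (fourierVec w k)).re

/-- The norm `‖v‖_n = √⟨v | v⟩_n`. -/
def sobolevNorm (n : ℝ) (v : L2Field d) : ℝ := Real.sqrt (sobolevInner n v v)

/-- The (distributional) partial derivative `∂_s w`. -/
def partialDeriv (s : Fin d) (w : L2Field d) : L2Field d :=
  ofFourier fun k => (Complex.I * (k s : ℂ)) • fourierVec w k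

/-- The (distributional) Laplacian. -/
def vecLaplacian (v : L2Field d) : L2Field d :=
  ofFourier fun k => ((-freqSq k : ℝ) : ℂ) • fourierVec v k

/-- The heat semigroup `e^{tΔ}`. -/
def heat (t : ℝ) (v : L2Field d) : L2Field d :=
  ofFourier fun k => ((Real.exp (-(t * freqSq k)) : ℝ) : ℂ) • fourierVec v k

/-- The orthogonal projection of `ℂ^d` onto the orthogonal complement of `k`
(the identity for `k = 0`, where the quotient is `0`). -/
def lerayMode (k : Fin d → ℤ) (c : EuclideanSpace ℂ (Fin d)) : EuclideanSpace ℂ (Fin d) :=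
  WithLp.toLp 2 fun r => c r - ((∑ s, (k s : ℂ) * c s) / (freqSq k : ℂ)) * (k r : ℂ)

/-- The Leray projection onto divergence free fields. -/
def leray (f : Torus d → EuclideanSpace ℝ (Fin d)) : L2Field d :=
  ofFourier fun k => lerayMode k (fourierVec f k)

/-- `(v · ∂ w)_r = ∑_s v_s ∂_s w_r`. -/
def convection (v w : L2Field d) : Torus d → EuclideanSpace ℝ (Fin d) :=
  fun x => WithLp.toLp 2 fun r => ∑ s, v x s * partialDeriv s w x r

/-- The Navier-Stokes bilinear map `𝒫(v, w) = -𝔏(v · ∂ w)`. -/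
def nsBilin (v w : L2Field d) : L2Field d := -leray (convection v w)

/-- `K` fulfils `‖𝒫(v,w)‖_n ≤ K ‖v‖_n ‖w‖_{n+1}` for all `v ∈ ℍⁿ`, `w ∈ ℍⁿ⁺¹`. -/
def IsBasicConst (d : ℕ) (n K : ℝ) : Prop :=
  ∀ v ∈ sobolevSpace d n, ∀ w ∈ sobolevSpace d (n + 1),
    sobolevNorm n (nsBilin v w) ≤ K * sobolevNorm n v * sobolevNorm (n + 1) w

/-- `G` fulfils the Kato inequality `|⟨𝒫(v,w) | w⟩_n| ≤ G ‖v‖_n ‖w‖_n²`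
for all `v ∈ ℍⁿ`, `w ∈ ℍⁿ⁺¹`. -/
def IsKatoConst (d : ℕ) (n G : ℝ) : Prop :=
  ∀ v ∈ sobolevSpace d n, ∀ w ∈ sobolevSpace d (n + 1),
    |sobolevInner n (nsBilin v w) w| ≤ G * sobolevNorm n v * sobolevNorm n w ^ 2

/-- `G` fulfils the tame Kato inequality
`|⟨𝒫(v,w) | w⟩_p| ≤ (1/2) G (‖v‖_p ‖w‖_n + ‖v‖_n ‖w‖_p) ‖w‖_p` for all `v ∈ ℍᵖ`, `w ∈ ℍᵖ⁺¹`. -/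
def IsTameKatoConst (d : ℕ) (p n G : ℝ) : Prop :=
  ∀ v ∈ sobolevSpace d p, ∀ w ∈ sobolevSpace d (p + 1),
    |sobolevInner p (nsBilin v w) w| ≤
      1 / 2 * G * (sobolevNorm p v * sobolevNorm n w + sobolevNorm n v * sobolevNorm p w) *
        sobolevNorm p w

/-- The time interval `[0, T)`, where `T` may be `+∞`. -/
def timeInterval (T : EReal) : Set ℝ := {t | 0 ≤ t ∧ (t : EReal) < T}

/-- `u ∈ C^∞([0, T), ℍ^∞)`: there are derivatives `U 0 = u, U 1, U 2, …` of all orders, with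
values in `ℍ^∞`, the difference quotients of `U j` converging to `U (j + 1)` in the Fréchet
topology of `ℍ^∞`, i.e., in all the norms `‖ ‖_m`. -/
def IsSmoothCurve (T : EReal) (u : ℝ → L2Field d) : Prop :=
  ∃ U : ℕ → ℝ → L2Field d,
    (∀ t ∈ timeInterval T, U 0 t = u t) ∧
    ∀ j : ℕ, ∀ t ∈ timeInterval T, U j t ∈ sobolevInf d ∧
      ∀ m : ℕ, Tendsto
        (fun s => sobolevNorm (m : ℝ) ((s - t)⁻¹ • (U j s - U j t) - U (j + 1) t))
        (𝓝[timeInterval T \ {t}] t) (𝓝 0)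

/-- `u` is a solution on `[0, T)`, of class `C^∞([0, T), ℍ^∞)`, of the Cauchy problem
`du/dt = Δu + R 𝒫(u, u)`, `u(0) = u₀`.  The derivative is taken in `L²`; it coincides with the
one in `ℍ^∞`, since `ℍ^∞` embeds continuously in `L²`. -/
structure IsNSSolution (R : ℝ) (u₀ : L2Field d) (T : EReal) (u : ℝ → L2Field d) : Prop where
  pos : 0 < T
  smooth : IsSmoothCurve T u
  init : u 0 = u₀
  eqn : ∀ t ∈ timeInterval T,
    HasDerivWithinAt u (vecLaplacian (u t) + R • nsBilin (u t) (u t)) (timeInterval T) t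

/-- A solution on `[0, T)` is maximal if it is not extendable. -/
def IsMaximalNSSolution (R : ℝ) (u₀ : L2Field d) (T : EReal) (u : ℝ → L2Field d) : Prop :=
  IsNSSolution R u₀ T u ∧
    ∀ (T' : EReal) (u' : ℝ → L2Field d), IsNSSolution R u₀ T' u' → T ≤ T' →
      EqOn u' u (timeInterval T) → T' = T

/-- The coefficients of the Reynolds expansion: `u_0(t) = e^{tΔ} u₀` and
`u_j(t) = ∑_{l=0}^{j-1} ∫_0^t e^{(t-s)Δ} 𝒫(u_l(s), u_{j-l-1}(s)) ds` for `j ≥ 1`. -/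
def reynoldsCoeff (u₀ : L2Field d) : ℕ → ℝ → L2Field d
  | 0 => fun t => heat t u₀
  | j + 1 => fun t => ∑ l : Fin (j + 1), ∫ s in (0 : ℝ)..t,
      heat (t - s) (nsBilin (reynoldsCoeff u₀ l s) (reynoldsCoeff u₀ (j - l) s))
termination_by j => j
decreasing_by all_goals omega

/-- The Reynolds expansion of order `N`: `u^N(t) = ∑_{j=0}^N R^j u_j(t)`. -/
def reynoldsExpansion (R : ℝ) (u₀ : L2Field d) (N : ℕ) (t : ℝ) : L2Field d :=
  ∑ j ∈ Finset.range (N + 1), R ^ j • reynoldsCoeff u₀ j t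

/-- The residual `dv/dt - Δv - R 𝒫(v, v)` at time `t` of a curve `v` on `[0, +∞)`. -/
def nsResidual (R : ℝ) (v : ℝ → L2Field d) (t : ℝ) : L2Field d :=
  derivWithin v (Ici 0) t - vecLaplacian (v t) - R • nsBilin (v t) (v t)

/-- `D ∈ C([0,+∞),[0,+∞))` is a growth estimator of order `m` for `v`. -/
def IsGrowthEstimator (m : ℝ) (v : ℝ → L2Field d) (D : ℝ → ℝ) : Prop :=
  ContinuousOn D (Ici 0) ∧ ∀ t, 0 ≤ t → 0 ≤ D t ∧ sobolevNorm m (v t) ≤ D t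

/-- `ε ∈ C([0,+∞),[0,+∞))` is an error estimator of order `m` for `v`. -/
def IsErrorEstimator (R m : ℝ) (v : ℝ → L2Field d) (ε : ℝ → ℝ) : Prop :=
  ContinuousOn ε (Ici 0) ∧ ∀ t, 0 ≤ t → 0 ≤ ε t ∧ sobolevNorm m (nsResidual R v t) ≤ ε t

/-- `ρ` solves on `[0, Tc)` the control Cauchy problem
`dρ/dt = -ρ + R (G D + K D') ρ + R G ρ² + ε`, `ρ(0) = 0`. -/
def SolvesControl (R G K : ℝ) (D D' ε : ℝ → ℝ) (Tc : EReal) (ρ : ℝ → ℝ) : Prop :=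
  ρ 0 = 0 ∧ ∀ t ∈ timeInterval Tc,
    HasDerivWithinAt ρ
      (-ρ t + R * (G * D t + K * D' t) * ρ t + R * G * ρ t ^ 2 + ε t) (timeInterval Tc) t

/-- `σ` solves on `[0, Tc)` the linear control problem
`dσ/dt = -σ + R (G D + K D' + G' ρ) σ + ε`, `σ(0) = 0`. -/
def SolvesLinearControl (R G K G' : ℝ) (D D' ρ ε : ℝ → ℝ) (Tc : EReal) (σ : ℝ → ℝ) : Prop :=
  σ 0 = 0 ∧ ∀ t ∈ timeInterval Tc,
    HasDerivWithinAt σ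
      (-σ t + R * (G * D t + K * D' t + G' * ρ t) * σ t + ε t) (timeInterval Tc) t

/-- `𝒜(t) = ∫_0^t (G D(s) + K D'(s) + G' ρ(s)) ds`. -/
def controlPrimitive (G K G' : ℝ) (D D' ρ : ℝ → ℝ) (t : ℝ) : ℝ :=
  ∫ s in (0 : ℝ)..t, (G * D s + K * D' s + G' * ρ s)

/-- `e^{-t + R 𝒜(t)} ∫_0^t e^{s - R 𝒜(s)} ε(s) ds`. -/
def linearControl (R G K G' : ℝ) (D D' ρ ε : ℝ → ℝ) (t : ℝ) : ℝ :=
  Real.exp (-t + R * controlPrimitive G K G' D D' ρ t) *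
    ∫ s in (0 : ℝ)..t, Real.exp (s - R * controlPrimitive G K G' D D' ρ s) * ε s

end NSReynolds

end

open NSReynolds Set

/-! Everything is read off Fourier coefficients. A field of `ℍ^∞` is a conjugation symmetric,
divergence free, mean zero family of modes decaying faster than any power, and `𝒫` becomes a
discrete convolution carrying one factor `|k|` (`fourierVec_nsBilin`). A smooth curve in `ℍ^∞`
solves the equations exactly when its modes solve the corresponding infinite ODE system with rapid
decay uniform on compact time intervals: the uniform majorants justify termwise differentiation, and
the equation itself supplies all higher time derivatives (`IsNSSolution.isModeSolution`,
`IsModeSolution.isNSSolution`).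

Local existence is a contraction argument in the Wiener algebra of absolutely summable modes. The
Duhamel integral gains `|k|²` and the nonlinearity loses `|k|`, so the existence time depends only
on `∑ |c_k|`, and the fixed point inherits rapid decay from its datum (`exists_local_solution`).

The estimates come from the energy method. With `v = u^N` and residual `r`, the error `w = u - v`
satisfies `dw/dt = Δw + R (𝒫(v,w) + 𝒫(w,v) + 𝒫(w,w)) - r`. Pair this with `w` in `ℍⁿ`: `|k| ≥ 1` off
the zero mode gives the damping term, the Kato inequality treats `𝒫(v,w)` and `𝒫(w,w)`, the basic
inequality treats `𝒫(w,v)`. Hence, wherever `‖w‖_n` is positive, it satisfies the control equation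
with `≤` in place of `=` (`exists_deriv_sobolevNorm_sub_le`), and a comparison argument bounds it by
`ℛ_n`. In order `p` the tame inequality turns the quadratic term into `G_pn ‖w‖_n ‖w‖_p²`, so a
linear equation suffices. Taking for `v` a second exact solution and zero as control gives
uniqueness, so that all solutions glue to a maximal one.

Finally, if `T < T_c`, then `‖u‖_n ≤ ℛ_n + 𝒟_n` stays bounded on `[0, T)`. As `n > d/2`, so does `∑
|u_k|`, and restarting the local solution shortly before `T` extends `u`, against maximality
(`IsMaximalNSSolution.false_of_bounded`). -/

noncomputable section

namespace NSReynolds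

/-! ### Characters and scalar Fourier series on the torus. -/

section

variable {d : ℕ}

/-- The character `x ↦ e^{i k·x}` of the torus. -/
def torusChar (k : Fin d → ℤ) : C(Torus d, ℂ) where
  toFun x := ∏ s, fourier (k s) (x s)
  continuous_toFun := by fun_prop

lemma torusChar_apply (k : Fin d → ℤ) (x : Torus d) :
    torusChar k x = ∏ s, fourier (k s) (x s) := rfl

lemma torusChar_neg (k : Fin d → ℤ) (x : Torus d) :
    torusChar (-k) x = starRingEnd ℂ (torusChar k x) := by
  simp only [torusChar_apply, Pi.neg_apply, fourier_neg, map_prod]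

lemma torusChar_add (k l : Fin d → ℤ) (x : Torus d) :
    torusChar (k + l) x = torusChar k x * torusChar l x := by
  simp only [torusChar_apply, Pi.add_apply, fourier_add, ← Finset.prod_mul_distrib]

lemma torusChar_zero (x : Torus d) : torusChar (0 : Fin d → ℤ) x = 1 := by
  simp [torusChar_apply]

lemma norm_torusChar_apply (k : Fin d → ℤ) (x : Torus d) : ‖torusChar k x‖ = 1 := by
  simp only [torusChar_apply, fourier_apply, norm_prod, Circle.norm_coe, Finset.prod_const_one]

lemma torusChar_single (x : Torus d) (i : Fin d) :
    torusChar (Pi.single i 1) x = fourier 1 (x i) := by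
  rw [torusChar_apply, Finset.prod_eq_single i]
  · simp
  · intro j _ hj
    simp [Pi.single_eq_of_ne hj]
  · simp

/-- The star subalgebra of `C(Torus d, ℂ)` generated by the characters. -/
def torusCharSubalgebra (d : ℕ) : StarSubalgebra ℂ C(Torus d, ℂ) where
  toSubalgebra := Algebra.adjoin ℂ (range torusChar)
  star_mem' := by
    change Algebra.adjoin ℂ (range torusChar) ≤ star (Algebra.adjoin ℂ (range torusChar))
    refine Algebra.adjoin_le ?_
    rintro _ ⟨n, rfl⟩
    refine Algebra.subset_adjoin ⟨-n, ?_⟩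
    ext1 x
    simp only [torusChar_neg, starRingEnd_apply, ContinuousMap.star_apply]

theorem torusCharSubalgebra_coe :
    (torusCharSubalgebra d).toSubalgebra.toSubmodule = Submodule.span ℂ (range torusChar) := by
  apply Algebra.adjoin_eq_span_of_subset
  refine .trans (fun x ↦ Submonoid.closure_induction (fun _ ↦ id) ⟨0, ?_⟩ ?_) Submodule.subset_span
  · ext z
    simp [torusChar_zero]
  · rintro _ _ _ _ ⟨m, rfl⟩ ⟨n, rfl⟩
    refine ⟨m + n, ?_⟩
    ext z
    simp [torusChar_add]

theorem torusCharSubalgebra_separatesPoints : (torusCharSubalgebra d).SeparatesPoints := by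
  intro x y hxy
  rw [Ne, funext_iff, not_forall] at hxy
  obtain ⟨i, hi⟩ := hxy
  refine ⟨_, ⟨torusChar (Pi.single i 1), Algebra.subset_adjoin ⟨Pi.single i 1, rfl⟩, rfl⟩, ?_⟩
  dsimp only
  rw [torusChar_single, torusChar_single, fourier_one, fourier_one]
  exact fun h => hi (AddCircle.injective_toCircle Real.two_pi_pos.ne' (Circle.coe_injective h))

/-- Stone–Weierstrass: the characters span a star subalgebra, and the coordinate characters already
separate points. -/
theorem span_torusChar_closure_eq_top :
    (Submodule.span ℂ (range (torusChar (d := d)))).topologicalClosure = ⊤ := by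
  rw [← torusCharSubalgebra_coe]
  exact congr_arg (Subalgebra.toSubmodule <| StarSubalgebra.toSubalgebra ·)
    (ContinuousMap.starSubalgebra_topologicalClosure_eq_top_of_separatesPoints _
      torusCharSubalgebra_separatesPoints)

theorem span_torusChar_toLp_closure_eq_top :
    (Submodule.span ℂ (range fun k : Fin d → ℤ =>
      ContinuousMap.toLp (E := ℂ) 2 (volume : Measure (Torus d)) ℂ
        (torusChar k))).topologicalClosure = ⊤ := by
  simpa only [Submodule.map_span, ContinuousLinearMap.coe_coe, ← range_comp, Function.comp_def]
    using (ContinuousMap.toLp_denseRange ℂ (volume : Measure (Torus d)) ℂ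
      (p := 2) (by simp)).topologicalClosure_map_submodule span_torusChar_closure_eq_top

/-- By Fubini the integral is a product over coordinates. Each factor is one-dimensional
orthonormality, rescaled from normalised Haar measure to total mass `2π`. -/
lemma integral_torusChar (k : Fin d → ℤ) :
    ∫ x : Torus d, torusChar k x = if k = 0 then ((2 * Real.pi : ℝ) : ℂ) ^ d else 0 := by
  have hone : ∀ m : ℤ, ∫ x : AddCircle (2 * Real.pi), fourier m x
      = if m = 0 then ((2 * Real.pi : ℝ) : ℂ) else 0 := by
    intro m
    have h := (orthonormal_iff_ite.mp (orthonormal_fourier (T := 2 * Real.pi))) 0 m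
    rw [ContinuousMap.inner_toLp] at h
    simp only [fourier_zero, map_one, mul_one] at h
    rw [AddCircle.integral_haarAddCircle] at h
    rw [inv_smul_eq_iff₀ Real.two_pi_pos.ne'] at h
    rw [h]
    by_cases hm : m = 0
    · simp [hm]
    · simp [hm, Ne.symm hm]
  simp only [torusChar_apply]
  rw [MeasureTheory.integral_fintype_prod_volume_eq_prod
    (f := fun s (y : AddCircle (2 * Real.pi)) => (fourier (k s) y : ℂ))]
  simp only [hone]
  split_ifs with h
  · simp [h]
  · obtain ⟨i, hi⟩ := Function.ne_iff.mp h
    exact Finset.prod_eq_zero (Finset.mem_univ i) (by simpa using hi)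

/-- The scalar Fourier coefficient on the torus. -/
def torusCoeff (f : Torus d → ℂ) (k : Fin d → ℤ) : ℂ :=
  (((2 * Real.pi : ℝ) : ℂ) ^ d)⁻¹ * ∫ x : Torus d, torusChar (-k) x * f x

lemma fourierVec_apply (v : Torus d → EuclideanSpace ℝ (Fin d)) (k : Fin d → ℤ) (r : Fin d) :
    fourierVec v k r = torusCoeff (fun x => ((v x r : ℝ) : ℂ)) k := rfl

lemma two_pi_pow_ne_zero : (((2 * Real.pi : ℝ) : ℂ) ^ d) ≠ 0 :=
  pow_ne_zero _ (Complex.ofReal_ne_zero.mpr Real.two_pi_pos.ne')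

/-- Vanishing coefficients mean orthogonality to all characters, whose span is dense in `L²`. This
completeness is what makes the Fourier description faithful. -/
lemma ae_eq_zero_of_torusCoeff {f : Torus d → ℂ} (hf : MemLp f 2 volume)
    (h : ∀ k, torusCoeff f k = 0) : f =ᵐ[volume] 0 := by
  have horth : hf.toLp f ∈ (Submodule.span ℂ (range fun k : Fin d → ℤ =>
      ContinuousMap.toLp (E := ℂ) 2 (volume : Measure (Torus d)) ℂ (torusChar k)))ᗮ := by
    rw [Submodule.mem_orthogonal]
    intro g hg
    induction hg using Submodule.span_induction with
    | mem g hg =>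
      obtain ⟨k, rfl⟩ := hg
      have hk := h k
      rw [torusCoeff, mul_eq_zero] at hk
      have hk := hk.resolve_left (inv_ne_zero two_pi_pow_ne_zero)
      rw [L2.inner_def, ← hk]
      refine integral_congr_ae ?_
      filter_upwards [hf.coeFn_toLp, ContinuousMap.coeFn_toLp (p := 2) (𝕜 := ℂ)
        (volume : Measure (Torus d)) (torusChar k)] with x h1 h2
      rw [h1, h2, torusChar_neg, RCLike.inner_apply, mul_comm]
    | zero => simp
    | add a b _ _ ha hb => rw [inner_add_left, ha, hb, add_zero]
    | smul c a _ ha => rw [inner_smul_left, ha, mul_zero]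
  rw [Submodule.topologicalClosure_eq_top_iff.mp span_torusChar_toLp_closure_eq_top,
    Submodule.mem_bot] at horth
  have := hf.coeFn_toLp
  rw [horth] at this
  exact this.symm.trans (Lp.coeFn_zero _ _ _)

lemma integrable_torusChar_mul {f : Torus d → ℂ} (hf : Integrable f volume) (k : Fin d → ℤ) :
    Integrable (fun x => torusChar k x * f x) volume := by
  refine hf.bdd_mul (c := 1) (torusChar k).continuous.aestronglyMeasurable ?_
  exact Eventually.of_forall fun x => (norm_torusChar_apply k x).le

lemma torusCoeff_congr {f g : Torus d → ℂ} (h : f =ᵐ[volume] g) (k : Fin d → ℤ) :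
    torusCoeff f k = torusCoeff g k := by
  unfold torusCoeff
  congr 1
  exact integral_congr_ae (h.mono fun x hx => by simp only [hx])

lemma torusCoeff_add {f g : Torus d → ℂ} (hf : Integrable f volume) (hg : Integrable g volume)
    (k : Fin d → ℤ) : torusCoeff (fun x => f x + g x) k = torusCoeff f k + torusCoeff g k := by
  unfold torusCoeff
  simp only [mul_add]
  rw [integral_add (integrable_torusChar_mul hf _) (integrable_torusChar_mul hg _), mul_add]

lemma torusCoeff_const_mul (f : Torus d → ℂ) (c : ℂ) (k : Fin d → ℤ) :
    torusCoeff (fun x => c * f x) k = c * torusCoeff f k := by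
  unfold torusCoeff
  have : ∀ x : Torus d, torusChar (-k) x * (c * f x) = c * (torusChar (-k) x * f x) :=
    fun x => by ring
  simp only [this]
  rw [integral_const_mul]
  ring

lemma torusCoeff_sum {ι : Type*} (s : Finset ι) {f : ι → Torus d → ℂ}
    (hf : ∀ i ∈ s, Integrable (f i) volume) (k : Fin d → ℤ) :
    torusCoeff (fun x => ∑ i ∈ s, f i x) k = ∑ i ∈ s, torusCoeff (f i) k := by
  unfold torusCoeff
  simp only [Finset.mul_sum]
  rw [integral_finsetSum _ fun i hi => integrable_torusChar_mul (hf i hi) _, Finset.mul_sum]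

lemma norm_torusCoeff_le (f : Torus d → ℂ) (k : Fin d → ℤ) :
    ‖torusCoeff f k‖ ≤ ((2 * Real.pi) ^ d)⁻¹ * ∫ x : Torus d, ‖f x‖ := by
  unfold torusCoeff
  rw [norm_mul, norm_inv, norm_pow, Complex.norm_real, Real.norm_of_nonneg Real.two_pi_pos.le]
  refine mul_le_mul_of_nonneg_left ?_ (by positivity)
  refine (norm_integral_le_integral_norm _).trans (le_of_eq ?_)
  congr 1
  funext x
  rw [norm_mul, norm_torusChar_apply, one_mul]

lemma torusCoeff_conj (f : Torus d → ℝ) (k : Fin d → ℤ) :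
    torusCoeff (fun x => (f x : ℂ)) (-k) = starRingEnd ℂ (torusCoeff (fun x => (f x : ℂ)) k) := by
  unfold torusCoeff
  rw [map_mul, ← integral_conj]
  congr 1
  · simp only [map_inv₀, map_pow, Complex.conj_ofReal]
  · congr 1
    funext x
    rw [map_mul, torusChar_neg k, torusChar_neg (-k), torusChar_neg k]
    simp

lemma torusCoeff_char_mul (f : Torus d → ℂ) (k l : Fin d → ℤ) :
    torusCoeff (fun x => torusChar l x * f x) k = torusCoeff f (k - l) := by
  unfold torusCoeff
  congr 2
  funext x
  rw [← mul_assoc, ← torusChar_add]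
  congr 2
  abel_nf

/-- The Fourier series with summable coefficients `α`. -/
def torusSeries (α : (Fin d → ℤ) → ℂ) (x : Torus d) : ℂ := ∑' l, α l * torusChar l x

lemma continuous_torusSeries {α : (Fin d → ℤ) → ℂ} (hα : Summable fun l => ‖α l‖) :
    Continuous (torusSeries α) := by
  refine continuous_tsum (fun l => continuous_const.mul (torusChar l).continuous) hα fun l x => ?_
  rw [norm_mul, norm_torusChar_apply, mul_one]

lemma norm_torusSeries_le {α : (Fin d → ℤ) → ℂ} (hα : Summable fun l => ‖α l‖) (x : Torus d) :
    ‖torusSeries α x‖ ≤ ∑' l, ‖α l‖ := by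
  refine tsum_of_norm_bounded hα.hasSum fun l => ?_
  rw [norm_mul, norm_torusChar_apply, mul_one]

/-- The Fourier coefficients of a Fourier series times a function are a convolution. -/
lemma torusCoeff_series_mul {α : (Fin d → ℤ) → ℂ} (hα : Summable fun l => ‖α l‖)
    {g : Torus d → ℂ} (hg : Integrable g volume) (k : Fin d → ℤ) :
    torusCoeff (fun x => torusSeries α x * g x) k = ∑' l, α l * torusCoeff g (k - l) := by
  have h1 : ∀ l, α l * torusCoeff g (k - l) = (((2 * Real.pi : ℝ) : ℂ) ^ d)⁻¹ *
      ∫ x : Torus d, torusChar (-k) x * (α l * torusChar l x * g x) := by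
    intro l
    rw [← torusCoeff_char_mul, ← torusCoeff_const_mul]
    simp only [torusCoeff, mul_assoc]
  simp only [h1]
  rw [tsum_mul_left, torusCoeff]
  congr 1
  have hint : ∀ l, Integrable (fun x => torusChar (-k) x * (α l * torusChar l x * g x)) volume := by
    intro l
    refine integrable_torusChar_mul ?_ _
    simp only [mul_assoc]
    exact (integrable_torusChar_mul hg l).const_mul _
  have hnorm : ∀ l, ∫ x : Torus d, ‖torusChar (-k) x * (α l * torusChar l x * g x)‖
      = ‖α l‖ * ∫ x : Torus d, ‖g x‖ := by
    intro l
    rw [← integral_const_mul]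
    congr 1
    funext x
    rw [norm_mul, norm_mul, norm_mul, norm_torusChar_apply, norm_torusChar_apply, one_mul, mul_one]
  rw [integral_tsum_of_summable_integral_norm hint]
  · congr 1
    funext x
    rw [tsum_mul_left, tsum_mul_right]
    rfl
  · simp only [hnorm]
    exact hα.mul_right _

lemma torusCoeff_one (k : Fin d → ℤ) :
    torusCoeff (fun _ : Torus d => 1) k = if k = 0 then 1 else 0 := by
  simp only [torusCoeff, mul_one, integral_torusChar, neg_eq_zero]
  split_ifs
  · exact inv_mul_cancel₀ two_pi_pow_ne_zero
  · simp

/-- The convolution formula with `g = 1`, whose only nonzero coefficient sits at frequency `0`. -/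
lemma torusCoeff_series {α : (Fin d → ℤ) → ℂ} (hα : Summable fun l => ‖α l‖) (k : Fin d → ℤ) :
    torusCoeff (torusSeries α) k = α k := by
  have h := torusCoeff_series_mul hα (integrable_const (1 : ℂ)) k
  simp only [mul_one, torusCoeff_one] at h
  rw [h, tsum_eq_single k]
  · simp
  · intro l hl
    rw [if_neg (sub_ne_zero.mpr hl.symm), mul_zero]

end

/-! ### Fourier coefficients of square integrable vector fields. -/

section

variable {d : ℕ}

lemma memLp_component (v : L2Field d) (r : Fin d) :
    MemLp (fun x => ((v x r : ℝ) : ℂ)) 2 (volume : Measure (Torus d)) :=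
  ((EuclideanSpace.proj (𝕜 := ℝ) r).comp_memLp' (Lp.memLp v)).ofReal

lemma integrable_component (v : L2Field d) (r : Fin d) :
    Integrable (fun x => ((v x r : ℝ) : ℂ)) (volume : Measure (Torus d)) :=
  (memLp_component v r).integrable one_le_two

lemma fourierVec_congr {f g : Torus d → EuclideanSpace ℝ (Fin d)} (h : f =ᵐ[volume] g)
    (k : Fin d → ℤ) : fourierVec f k = fourierVec g k := by
  ext r
  rw [fourierVec_apply, fourierVec_apply]
  exact torusCoeff_congr (h.mono fun x hx => by simp only [hx]) k

lemma fourierVec_add (v w : L2Field d) (k : Fin d → ℤ) :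
    fourierVec (v + w : L2Field d) k = fourierVec v k + fourierVec w k := by
  rw [fourierVec_congr (Lp.coeFn_add v w)]
  ext r
  rw [PiLp.add_apply]
  simp only [fourierVec_apply, Pi.add_apply, PiLp.add_apply, Complex.ofReal_add]
  exact torusCoeff_add (integrable_component v r) (integrable_component w r) k

lemma fourierVec_smul (c : ℝ) (v : L2Field d) (k : Fin d → ℤ) :
    fourierVec (c • v : L2Field d) k = c • fourierVec v k := by
  rw [fourierVec_congr (Lp.coeFn_smul c v)]
  ext r
  rw [PiLp.smul_apply]
  simp only [fourierVec_apply, Pi.smul_apply, PiLp.smul_apply, smul_eq_mul, Complex.ofReal_mul]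
  rw [torusCoeff_const_mul]
  simp

/-- Hölder on a space of finite measure. It makes each coefficient `v ↦ v_k` continuous on `L²`,
hence compatible with derivatives and Bochner integrals. -/
lemma integral_norm_le_L2 : ∃ C : ℝ, 0 ≤ C ∧ ∀ v : L2Field d, ∫ x, ‖v x‖ ≤ C * ‖v‖ := by
  refine ⟨((volume (univ : Set (Torus d))) ^ ((1 : ENNReal).toReal⁻¹ -
    (2 : ENNReal).toReal⁻¹ : ℝ)).toReal, ENNReal.toReal_nonneg, fun v => ?_⟩
  have h := eLpNorm_le_eLpNorm_mul_rpow_measure_univ (μ := (volume : Measure (Torus d)))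
    (p := 1) (q := 2) one_le_two (Lp.aestronglyMeasurable v)
  simp only [one_div] at h
  have hfin : (volume (univ : Set (Torus d))) ^ ((1 : ENNReal).toReal⁻¹ -
      (2 : ENNReal).toReal⁻¹ : ℝ) ≠ ⊤ := by
    refine ENNReal.rpow_ne_top_of_nonneg (by norm_num) (measure_ne_top _ _)
  have h2 := ENNReal.toReal_mono (ENNReal.mul_ne_top (Lp.eLpNorm_ne_top v) hfin) h
  rw [ENNReal.toReal_mul, ← Lp.norm_def] at h2
  refine le_trans (le_of_eq ?_) (h2.trans_eq (mul_comm _ _))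
  rw [eLpNorm_one_eq_lintegral_enorm,
    integral_norm_eq_lintegral_enorm (Lp.aestronglyMeasurable v)]

/-- The Fourier coefficient as a continuous linear map on `L²`. -/
def fourierCLM (k : Fin d → ℤ) : L2Field d →L[ℝ] EuclideanSpace ℂ (Fin d) :=
  LinearMap.mkContinuousOfExistsBound
    { toFun := fun v => fourierVec v k
      map_add' := fun v w => fourierVec_add v w k
      map_smul' := fun c v => fourierVec_smul c v k } (by
    obtain ⟨C, hC0, hC⟩ := integral_norm_le_L2 (d := d)
    refine ⟨∑ r : Fin d, ((2 * Real.pi) ^ d)⁻¹ * C, fun v => ?_⟩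
    have h1 : ‖fourierVec v k‖ ≤ ∑ r : Fin d, ‖fourierVec v k r‖ := by
      rw [EuclideanSpace.norm_eq]
      refine Real.sqrt_le_iff.mpr ⟨Finset.sum_nonneg fun _ _ => norm_nonneg _, ?_⟩
      exact Finset.sum_sq_le_sq_sum_of_nonneg fun _ _ => norm_nonneg _
    refine h1.trans ?_
    rw [Finset.sum_mul]
    refine Finset.sum_le_sum fun r _ => ?_
    rw [fourierVec_apply, mul_assoc]
    refine (norm_torusCoeff_le _ k).trans
      (mul_le_mul_of_nonneg_left (le_trans ?_ (hC v)) (by positivity))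
    refine integral_mono (integrable_component v r).norm
      ((Lp.memLp v).integrable one_le_two).norm fun x => ?_
    simp only [Complex.norm_real]
    exact PiLp.norm_apply_le (v x) r)

@[simp] lemma fourierCLM_apply (k : Fin d → ℤ) (v : L2Field d) :
    fourierCLM k v = fourierVec v k := rfl

lemma fourierVec_sub (v w : L2Field d) (k : Fin d → ℤ) :
    fourierVec (v - w : L2Field d) k = fourierVec v k - fourierVec w k := by
  simp only [← fourierCLM_apply, map_sub]

lemma fourierVec_neg (v : L2Field d) (k : Fin d → ℤ) :
    fourierVec (-v : L2Field d) k = -fourierVec v k := by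
  simp only [← fourierCLM_apply, map_neg]

lemma fourierVec_zero (k : Fin d → ℤ) : fourierVec (0 : L2Field d) k = 0 := by
  simp only [← fourierCLM_apply, map_zero]

/-- A field of `L²` is determined by its Fourier coefficients. -/
lemma ext_fourierVec {v w : L2Field d} (h : ∀ k, fourierVec v k = fourierVec w k) : v = w := by
  rw [← sub_eq_zero]
  have h0 : ∀ k, fourierVec (v - w : L2Field d) k = 0 := fun k => by
    rw [fourierVec_sub, h, sub_self]
  generalize v - w = z at h0
  have hz : ∀ r, (fun x => ((z x r : ℝ) : ℂ)) =ᵐ[volume] 0 := fun r =>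
    ae_eq_zero_of_torusCoeff (memLp_component z r) fun k => by
      rw [← fourierVec_apply, h0]; rfl
  rw [Lp.eq_zero_iff_ae_eq_zero]
  filter_upwards [ae_all_iff.mpr hz] with x hx
  ext r
  simpa using hx r

/-- Since `ofFourier` falls back to `0`, every operator defined through it (derivative, Laplacian,
heat flow, Leray projection) has the expected coefficients only after an existence proof. -/
lemma ofFourier_spec {c : (Fin d → ℤ) → EuclideanSpace ℂ (Fin d)}
    (h : ∃ v : L2Field d, ∀ k, fourierVec v k = c k) (k : Fin d → ℤ) :
    fourierVec (ofFourier c) k = c k := by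
  unfold ofFourier
  rw [dif_pos h]
  exact h.choose_spec k

/-- Coordinatewise complex conjugation. -/
def conjVec (a : EuclideanSpace ℂ (Fin d)) : EuclideanSpace ℂ (Fin d) :=
  WithLp.toLp 2 fun r => starRingEnd ℂ (a r)

@[simp] lemma conjVec_apply (a : EuclideanSpace ℂ (Fin d)) (r : Fin d) :
    conjVec a r = starRingEnd ℂ (a r) := rfl

lemma fourierVec_conj (v : Torus d → EuclideanSpace ℝ (Fin d)) (k : Fin d → ℤ) :
    fourierVec v (-k) = conjVec (fourierVec v k) := by
  ext r
  rw [conjVec_apply, fourierVec_apply, fourierVec_apply]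
  exact torusCoeff_conj (fun x => v x r) k

lemma summable_component {c : (Fin d → ℤ) → EuclideanSpace ℂ (Fin d)}
    (hc : Summable fun k => ‖c k‖) (r : Fin d) : Summable fun k => ‖c k r‖ :=
  hc.of_nonneg_of_le (fun _ => norm_nonneg _) fun k => PiLp.norm_apply_le (c k) r

/-- Reindexing by `k ↦ -k` shows that the sum equals its own conjugate. -/
lemma torusSeries_conj {α : (Fin d → ℤ) → ℂ} (hc : ∀ k, α (-k) = starRingEnd ℂ (α k))
    (x : Torus d) : ((torusSeries α x).re : ℂ) = torusSeries α x := by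
  refine Complex.conj_eq_iff_re.mp ?_
  unfold torusSeries
  rw [Complex.conj_tsum, ← (Equiv.neg (Fin d → ℤ)).tsum_eq]
  refine tsum_congr fun k => ?_
  rw [Equiv.neg_apply, map_mul, ← torusChar_neg, ← hc, neg_neg]

/-- The real field with summable, conjugation symmetric Fourier coefficients. -/
def fieldSeries (c : (Fin d → ℤ) → EuclideanSpace ℂ (Fin d)) (x : Torus d) :
    EuclideanSpace ℝ (Fin d) :=
  WithLp.toLp 2 fun r => (torusSeries (fun k => c k r) x).re

lemma continuous_fieldSeries {c : (Fin d → ℤ) → EuclideanSpace ℂ (Fin d)}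
    (hc : Summable fun k => ‖c k‖) : Continuous (fieldSeries c) := by
  refine (PiLp.continuous_toLp 2 _).comp (continuous_pi fun r => ?_)
  exact Complex.continuous_re.comp (continuous_torusSeries (summable_component hc r))

lemma memLp_fieldSeries {c : (Fin d → ℤ) → EuclideanSpace ℂ (Fin d)}
    (hc : Summable fun k => ‖c k‖) : MemLp (fieldSeries c) 2 (volume : Measure (Torus d)) :=
  MemLp.of_bound (continuous_fieldSeries hc).aestronglyMeasurable
    ‖BoundedContinuousFunction.mkOfCompact ⟨_, continuous_fieldSeries hc⟩‖
    (Eventually.of_forall (BoundedContinuousFunction.mkOfCompact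
      ⟨_, continuous_fieldSeries hc⟩).norm_coe_le_norm)

lemma fourierVec_fieldSeries {c : (Fin d → ℤ) → EuclideanSpace ℂ (Fin d)}
    (hc : Summable fun k => ‖c k‖) (hconj : ∀ k, c (-k) = conjVec (c k)) (k : Fin d → ℤ) :
    fourierVec (fieldSeries c) k = c k := by
  ext r
  rw [fourierVec_apply, ← torusCoeff_series (summable_component hc r) k]
  congr 1
  funext x
  exact torusSeries_conj (fun k => by rw [hconj, conjVec_apply]) x

/-- Existence of a field with summable, conjugation symmetric Fourier coefficients. -/
lemma exists_field {c : (Fin d → ℤ) → EuclideanSpace ℂ (Fin d)}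
    (hc : Summable fun k => ‖c k‖) (hconj : ∀ k, c (-k) = conjVec (c k)) :
    ∃ v : L2Field d, ∀ k, fourierVec v k = c k :=
  ⟨(memLp_fieldSeries hc).toLp _, fun k => by
    rw [fourierVec_congr (memLp_fieldSeries hc).coeFn_toLp, fourierVec_fieldSeries hc hconj]⟩

/-- Both sides have the same coefficients. The resulting bounded continuous representative gives
pointwise meaning to the products in `convection` and a sup bound for the `L²` norm. -/
lemma coeFn_eq_fieldSeries (v : L2Field d) (hc : Summable fun k => ‖fourierVec v k‖) :
    v =ᵐ[volume] fieldSeries (fourierVec v) := by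
  have h : v = (memLp_fieldSeries hc).toLp _ := ext_fourierVec fun k => by
    rw [fourierVec_congr (memLp_fieldSeries hc).coeFn_toLp,
      fourierVec_fieldSeries hc (fourierVec_conj v)]
  have h2 := (memLp_fieldSeries hc).coeFn_toLp
  rwa [← h] at h2

lemma ofReal_component_ae (v : L2Field d) (hc : Summable fun k => ‖fourierVec v k‖) (r : Fin d) :
    (fun x => ((v x r : ℝ) : ℂ)) =ᵐ[volume] torusSeries fun k => fourierVec v k r := by
  filter_upwards [coeFn_eq_fieldSeries v hc] with x hx
  rw [hx]
  exact torusSeries_conj (fun k => by rw [fourierVec_conj, conjVec_apply]) x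

/-- The `L²` norm is controlled by the sum of the Fourier coefficients. -/
lemma norm_le_tsum_fourierVec : ∃ C : ℝ, 0 ≤ C ∧ ∀ v : L2Field d,
    (Summable fun k => ‖fourierVec v k‖) → ‖v‖ ≤ C * ∑' k, ‖fourierVec v k‖ := by
  obtain ⟨V, hV⟩ : ∃ V : ℝ, V = ((measureUnivNNReal (volume : Measure (Torus d)) : ℝ) ^
    ((2 : ENNReal).toReal⁻¹ : ℝ)) := ⟨_, rfl⟩
  refine ⟨V * d, by rw [hV]; positivity, fun v hv => ?_⟩
  have hb : ∀ᵐ x : Torus d, ‖v x‖ ≤ d * ∑' k, ‖fourierVec v k‖ := by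
    filter_upwards [coeFn_eq_fieldSeries v hv] with x hx
    have h1 : ‖v x‖ ≤ ∑ r : Fin d, ‖v x r‖ := by
      rw [EuclideanSpace.norm_eq]
      refine Real.sqrt_le_iff.mpr ⟨Finset.sum_nonneg fun _ _ => norm_nonneg _, ?_⟩
      exact Finset.sum_sq_le_sq_sum_of_nonneg fun _ _ => norm_nonneg _
    refine h1.trans ?_
    have h2 : ∀ r ∈ (Finset.univ : Finset (Fin d)), ‖v x r‖ ≤ ∑' k, ‖fourierVec v k‖ := by
      intro r _
      rw [hx]
      refine (Complex.abs_re_le_norm _).trans ((norm_torusSeries_le (summable_component hv r)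
        x).trans ?_)
      exact (summable_component hv r).tsum_le_tsum (fun k => PiLp.norm_apply_le _ r) hv
    simpa using Finset.sum_le_sum h2
  have h := Lp.norm_le_of_ae_bound (f := v) (by positivity) hb
  rw [hV, mul_assoc]
  exact h

end

/-! ### Frequency weights, rapidly decaying families and their convolution. -/

section

variable {d : ℕ}

/-- A family of Fourier coefficients of a vector field. -/
abbrev Modes (d : ℕ) : Type := (Fin d → ℤ) → EuclideanSpace ℂ (Fin d)

/-- The weight `1 + |k|_∞`. -/
def modeWeight (k : Fin d → ℤ) : ℝ := 1 + ‖k‖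

lemma one_le_modeWeight (k : Fin d → ℤ) : 1 ≤ modeWeight k := by
  unfold modeWeight
  linarith [norm_nonneg k]

lemma modeWeight_pos (k : Fin d → ℤ) : 0 < modeWeight k :=
  zero_lt_one.trans_le (one_le_modeWeight k)

/-- Submultiplicativity along `k = l + (k - l)` is what makes every weighted `ℓ¹` space a
convolution algebra. -/
lemma modeWeight_le_mul (k l : Fin d → ℤ) :
    modeWeight k ≤ modeWeight l * modeWeight (k - l) := by
  unfold modeWeight
  have h : ‖k‖ ≤ ‖l‖ + ‖k - l‖ := by
    simpa using norm_add_le l (k - l)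
  nlinarith [norm_nonneg l, norm_nonneg (k - l)]

lemma freqSq_nonneg (k : Fin d → ℤ) : 0 ≤ freqSq k :=
  Finset.sum_nonneg fun _ _ => sq_nonneg _

lemma freqSq_neg (k : Fin d → ℤ) : freqSq (-k) = freqSq k := by
  simp [freqSq]

lemma norm_sq_le_freqSq (k : Fin d → ℤ) : ‖k‖ ^ 2 ≤ freqSq k := by
  refine (Real.le_sqrt (norm_nonneg _) (freqSq_nonneg k)).mp ?_
  refine (pi_norm_le_iff_of_nonneg (Real.sqrt_nonneg _)).mpr fun i => ?_
  refine Real.le_sqrt_of_sq_le ?_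
  rw [Int.norm_eq_abs, sq_abs]
  exact Finset.single_le_sum (f := fun s => ((k s : ℝ)) ^ 2) (fun _ _ => sq_nonneg _)
    (Finset.mem_univ i)

lemma freqSq_le (k : Fin d → ℤ) : freqSq k ≤ d * modeWeight k ^ 2 := by
  have h : ∀ s ∈ (Finset.univ : Finset (Fin d)), ((k s : ℝ)) ^ 2 ≤ modeWeight k ^ 2 := by
    intro s _
    rw [← sq_abs, ← Int.norm_eq_abs]
    refine pow_le_pow_left₀ (norm_nonneg _) ((norm_le_pi_norm k s).trans ?_) 2
    unfold modeWeight
    linarith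
  simpa [freqSq] using Finset.sum_le_sum h

lemma one_le_norm_of_ne_zero {k : Fin d → ℤ} (hk : k ≠ 0) : 1 ≤ ‖k‖ := by
  obtain ⟨i, hi⟩ := Function.ne_iff.mp hk
  refine le_trans ?_ (norm_le_pi_norm k i)
  rw [Int.norm_eq_abs]
  exact_mod_cast Int.one_le_abs hi

lemma one_le_freqSq {k : Fin d → ℤ} (hk : k ≠ 0) : 1 ≤ freqSq k :=
  (one_le_pow₀ (one_le_norm_of_ne_zero hk)).trans (norm_sq_le_freqSq k)

lemma modeWeight_sq_le {k : Fin d → ℤ} (hk : k ≠ 0) : modeWeight k ^ 2 ≤ 4 * freqSq k := by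
  have h1 := one_le_norm_of_ne_zero hk
  have h2 := norm_sq_le_freqSq k
  unfold modeWeight
  nlinarith

lemma summable_norm_rpow_int {r : ℝ} (hr : (d : ℝ) < r) :
    Summable fun k : Fin d → ℤ => ‖k‖ ^ (-r) := by
  let b := Pi.basisFun ℝ (Fin d)
  let L : Submodule ℤ (Fin d → ℝ) := Submodule.span ℤ (Set.range b)
  have hfin : Module.finrank ℤ L = d := by
    rw [Module.finrank_eq_card_basis (b.restrictScalars ℤ), Fintype.card_fin]
  have hmem : ∀ k : Fin d → ℤ, (fun i => (k i : ℝ)) ∈ L := by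
    intro k
    have : (fun i => (k i : ℝ)) = ∑ i, k i • b i := by
      ext j
      simp [b, Pi.basisFun_apply, Finset.sum_apply, Pi.single_apply]
    rw [this]
    exact Submodule.sum_mem _ fun i _ =>
      Submodule.smul_mem _ _ (Submodule.subset_span (mem_range_self i))
  -- `ℤ^d` is viewed as a lattice of rank `d` in `ℝ^d` with the sup norm, where powers below `-d`
  -- are summable.
  have hs := ZLattice.summable_norm_rpow L (-r) (by rw [hfin]; linarith)
  have hinj : Function.Injective fun k : Fin d → ℤ => (⟨_, hmem k⟩ : L) := by
    intro k l h
    ext i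
    have : (k i : ℝ) = l i := congrFun (congrArg Subtype.val h) i
    exact_mod_cast this
  refine (hs.comp_injective hinj).congr fun k => ?_
  simp only [Function.comp_apply]
  congr 1

lemma summable_modeWeight_inv : Summable fun k : Fin d → ℤ => (modeWeight k ^ (d + 1))⁻¹ := by
  have h := summable_norm_rpow_int (d := d) (r := d + 1) (by linarith)
  refine Summable.of_norm_bounded_eventually h ?_
  -- Only `k = 0` is exceptional: there the comparison function `‖k‖ ^ (-(d+1))` takes the value
  -- `0`.
  refine (Set.finite_singleton (0 : Fin d → ℤ)).subset fun k hk => ?_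
  by_contra hk0
  apply hk
  change ‖(modeWeight k ^ (d + 1))⁻¹‖ ≤ ‖k‖ ^ (-((d : ℝ) + 1))
  rw [Real.norm_of_nonneg (by have := modeWeight_pos k; positivity)]
  have h1 := one_le_norm_of_ne_zero hk0
  have : ‖k‖ ^ (-((d : ℝ) + 1)) = (‖k‖ ^ (d + 1))⁻¹ := by
    rw [Real.rpow_neg (norm_nonneg _)]
    congr 1
    exact_mod_cast Real.rpow_natCast ‖k‖ (d + 1)
  rw [this]
  refine inv_anti₀ (by positivity) (pow_le_pow_left₀ (norm_nonneg _) ?_ _)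
  unfold modeWeight
  linarith

/-- Nonnegative families decaying faster than any power. -/
def RapidMaj (M : (Fin d → ℤ) → ℝ) : Prop :=
  (∀ k, 0 ≤ M k) ∧ ∀ m : ℕ, Summable fun k => modeWeight k ^ m * M k

lemma RapidMaj.summable {M : (Fin d → ℤ) → ℝ} (hM : RapidMaj M) : Summable M := by
  simpa using hM.2 0

lemma RapidMaj.mono {M N : (Fin d → ℤ) → ℝ} (hM : RapidMaj M) (h0 : ∀ k, 0 ≤ N k)
    (h : ∀ k, N k ≤ M k) : RapidMaj N :=
  ⟨h0, fun m => (hM.2 m).of_nonneg_of_le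
    (fun k => mul_nonneg (pow_nonneg (modeWeight_pos k).le m) (h0 k))
    fun k => mul_le_mul_of_nonneg_left (h k) (pow_nonneg (modeWeight_pos k).le m)⟩

lemma rapidMaj_zero : RapidMaj (fun _ : Fin d → ℤ => (0 : ℝ)) :=
  ⟨fun _ => le_rfl, fun m => by simp⟩

lemma RapidMaj.add {M N : (Fin d → ℤ) → ℝ} (hM : RapidMaj M) (hN : RapidMaj N) :
    RapidMaj fun k => M k + N k :=
  ⟨fun k => add_nonneg (hM.1 k) (hN.1 k), fun m => by
    simp only [mul_add]
    exact (hM.2 m).add (hN.2 m)⟩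

lemma RapidMaj.const_mul {M : (Fin d → ℤ) → ℝ} (hM : RapidMaj M) {C : ℝ} (hC : 0 ≤ C) :
    RapidMaj fun k => C * M k :=
  ⟨fun k => mul_nonneg hC (hM.1 k), fun m => ((hM.2 m).mul_left C).congr fun k => by ring⟩

lemma RapidMaj.weight_mul {M : (Fin d → ℤ) → ℝ} (hM : RapidMaj M) (j : ℕ) :
    RapidMaj fun k => modeWeight k ^ j * M k :=
  ⟨fun k => mul_nonneg (pow_nonneg (modeWeight_pos k).le j) (hM.1 k),
    fun m => (hM.2 (m + j)).congr fun k => by ring⟩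

/-- Pointwise bounds suffice, because spending `d + 1` additional powers of the weight buys
summability. -/
lemma rapidMaj_of_forall_bound {M : (Fin d → ℤ) → ℝ} (h0 : ∀ k, 0 ≤ M k)
    (h : ∀ m : ℕ, ∃ C, ∀ k, modeWeight k ^ m * M k ≤ C) : RapidMaj M := by
  refine ⟨h0, fun m => ?_⟩
  obtain ⟨C, hC⟩ := h (m + (d + 1))
  refine (summable_modeWeight_inv.mul_left C).of_nonneg_of_le
    (fun k => mul_nonneg (pow_nonneg (modeWeight_pos k).le m) (h0 k)) fun k => ?_
  have hp := pow_pos (modeWeight_pos k) (d + 1)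
  rw [← div_eq_mul_inv, le_div_iff₀ hp]
  calc _ = modeWeight k ^ (m + (d + 1)) * M k := by ring
    _ ≤ C := hC k

lemma RapidMaj.exists_bound {M : (Fin d → ℤ) → ℝ} (hM : RapidMaj M) (m : ℕ) :
    ∃ C, ∀ k, modeWeight k ^ m * M k ≤ C :=
  ⟨_, fun k => (hM.2 m).le_tsum k fun l _ =>
    mul_nonneg (pow_nonneg (modeWeight_pos l).le m) (hM.1 l)⟩

/-- The convolution of two families of real numbers. -/
def modeConv (M N : (Fin d → ℤ) → ℝ) (k : Fin d → ℤ) : ℝ := ∑' l, M l * N (k - l)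

/-- The shear `(k, l) ↦ (l, k - l)` is a bijection which turns the convolution terms into a product
family. -/
lemma summable_modeConv_prod {M N : (Fin d → ℤ) → ℝ} (hM0 : ∀ k, 0 ≤ M k) (hN0 : ∀ k, 0 ≤ N k)
    (hM : Summable M) (hN : Summable N) :
    Summable fun p : (Fin d → ℤ) × (Fin d → ℤ) => M p.2 * N (p.1 - p.2) := by
  have h := hM.mul_of_nonneg hN hM0 hN0
  let e : (Fin d → ℤ) × (Fin d → ℤ) ≃ (Fin d → ℤ) × (Fin d → ℤ) :=
    { toFun := fun p => (p.2, p.1 - p.2)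
      invFun := fun q => (q.1 + q.2, q.1)
      left_inv := fun p => by simp
      right_inv := fun q => by simp }
  exact e.summable_iff.mpr h

lemma summable_modeConv_term {M N : (Fin d → ℤ) → ℝ} (hM0 : ∀ k, 0 ≤ M k) (hN0 : ∀ k, 0 ≤ N k)
    (hM : Summable M) (hN : Summable N) (k : Fin d → ℤ) :
    Summable fun l => M l * N (k - l) :=
  (summable_modeConv_prod hM0 hN0 hM hN).prod_factor k

lemma summable_modeConv {M N : (Fin d → ℤ) → ℝ} (hM0 : ∀ k, 0 ≤ M k) (hN0 : ∀ k, 0 ≤ N k)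
    (hM : Summable M) (hN : Summable N) : Summable (modeConv M N) :=
  (summable_modeConv_prod hM0 hN0 hM hN).prod

lemma tsum_modeConv {M N : (Fin d → ℤ) → ℝ} (hM0 : ∀ k, 0 ≤ M k) (hN0 : ∀ k, 0 ≤ N k)
    (hM : Summable M) (hN : Summable N) :
    ∑' k, modeConv M N k = (∑' k, M k) * ∑' k, N k := by
  have hs := summable_modeConv_prod hM0 hN0 hM hN
  unfold modeConv
  rw [← hs.tsum_prod (f := fun p : (Fin d → ℤ) × (Fin d → ℤ) => M p.2 * N (p.1 - p.2))]
  let e : (Fin d → ℤ) × (Fin d → ℤ) ≃ (Fin d → ℤ) × (Fin d → ℤ) :=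
    { toFun := fun p => (p.2, p.1 - p.2)
      invFun := fun q => (q.1 + q.2, q.1)
      left_inv := fun p => by simp
      right_inv := fun q => by simp }
  rw [hM.tsum_mul_tsum hN (hM.mul_of_nonneg hN hM0 hN0)]
  exact e.tsum_eq fun q : (Fin d → ℤ) × (Fin d → ℤ) => M q.1 * N q.2

lemma modeConv_nonneg {M N : (Fin d → ℤ) → ℝ} (hM0 : ∀ k, 0 ≤ M k) (hN0 : ∀ k, 0 ≤ N k)
    (k : Fin d → ℤ) : 0 ≤ modeConv M N k :=
  tsum_nonneg fun _ => mul_nonneg (hM0 _) (hN0 _)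

lemma weight_mul_modeConv_le {M N : (Fin d → ℤ) → ℝ} (hM0 : ∀ k, 0 ≤ M k) (hN0 : ∀ k, 0 ≤ N k)
    (m : ℕ) (hM : Summable fun k => modeWeight k ^ m * M k)
    (hN : Summable fun k => modeWeight k ^ m * N k) (k : Fin d → ℤ) :
    modeWeight k ^ m * modeConv M N k ≤
      modeConv (fun k => modeWeight k ^ m * M k) (fun k => modeWeight k ^ m * N k) k := by
  have hw : ∀ k : Fin d → ℤ, 0 ≤ modeWeight k ^ m := fun k => pow_nonneg (modeWeight_pos k).le m
  have hw1 : ∀ k : Fin d → ℤ, 1 ≤ modeWeight k ^ m := fun k => one_le_pow₀ (one_le_modeWeight k)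
  have hs := summable_modeConv_term (fun k => mul_nonneg (hw k) (hM0 k))
    (fun k => mul_nonneg (hw k) (hN0 k)) hM hN k
  have hle : ∀ l, modeWeight k ^ m * (M l * N (k - l)) ≤
      modeWeight l ^ m * M l * (modeWeight (k - l) ^ m * N (k - l)) := by
    intro l
    have h1 : modeWeight k ^ m ≤ modeWeight l ^ m * modeWeight (k - l) ^ m := by
      rw [← mul_pow]
      exact pow_le_pow_left₀ (modeWeight_pos k).le (modeWeight_le_mul k l) m
    calc _ ≤ modeWeight l ^ m * modeWeight (k - l) ^ m * (M l * N (k - l)) :=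
          mul_le_mul_of_nonneg_right h1 (mul_nonneg (hM0 _) (hN0 _))
      _ = _ := by ring
  unfold modeConv
  rw [← tsum_mul_left]
  exact (hs.of_nonneg_of_le (fun l => mul_nonneg (hw k) (mul_nonneg (hM0 _) (hN0 _))) hle).tsum_le_tsum
    hle hs

lemma summable_weight_modeConv {M N : (Fin d → ℤ) → ℝ} (hM0 : ∀ k, 0 ≤ M k)
    (hN0 : ∀ k, 0 ≤ N k) (m : ℕ) (hM : Summable fun k => modeWeight k ^ m * M k)
    (hN : Summable fun k => modeWeight k ^ m * N k) :
    Summable fun k => modeWeight k ^ m * modeConv M N k := by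
  have hw : ∀ k : Fin d → ℤ, 0 ≤ modeWeight k ^ m := fun k => pow_nonneg (modeWeight_pos k).le m
  exact (summable_modeConv (fun k => mul_nonneg (hw k) (hM0 k))
    (fun k => mul_nonneg (hw k) (hN0 k)) hM hN).of_nonneg_of_le
    (fun k => mul_nonneg (hw k) (modeConv_nonneg hM0 hN0 k))
    (weight_mul_modeConv_le hM0 hN0 m hM hN)

lemma RapidMaj.conv {M N : (Fin d → ℤ) → ℝ} (hM : RapidMaj M) (hN : RapidMaj N) :
    RapidMaj (modeConv M N) :=
  ⟨modeConv_nonneg hM.1 hN.1, fun m => summable_weight_modeConv hM.1 hN.1 m (hM.2 m) (hN.2 m)⟩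

end

/-! ### The Leray projection, the nonlinearity and `ℍ^∞` in Fourier variables. -/

section

variable {d : ℕ}

/-- `k · a`. -/
def freqDot (k : Fin d → ℤ) (a : EuclideanSpace ℂ (Fin d)) : ℂ := ∑ s, (k s : ℂ) * a s

/-- `|k|`. -/
def freqNorm (k : Fin d → ℤ) : ℝ := Real.sqrt (freqSq k)

/-- The vector `k` in `ℂ^d`. -/
def freqVec (k : Fin d → ℤ) : EuclideanSpace ℂ (Fin d) := WithLp.toLp 2 fun r => (k r : ℂ)

lemma freqNorm_nonneg (k : Fin d → ℤ) : 0 ≤ freqNorm k := Real.sqrt_nonneg _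

lemma freqNorm_sq (k : Fin d → ℤ) : freqNorm k ^ 2 = freqSq k := Real.sq_sqrt (freqSq_nonneg k)

lemma freqNorm_le (k : Fin d → ℤ) : freqNorm k ≤ (d + 1) * modeWeight k := by
  have h1 := one_le_modeWeight k
  refine Real.sqrt_le_iff.mpr ⟨by positivity, (freqSq_le k).trans ?_⟩
  rw [mul_pow]
  refine mul_le_mul_of_nonneg_right ?_ (by positivity)
  nlinarith [(Nat.cast_nonneg d : (0 : ℝ) ≤ d)]

lemma freqSq_le' (k : Fin d → ℤ) : freqSq k ≤ (d + 1) * modeWeight k ^ 2 := by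
  refine (freqSq_le k).trans (mul_le_mul_of_nonneg_right (by linarith) (by positivity))

lemma norm_freqVec (k : Fin d → ℤ) : ‖freqVec k‖ = freqNorm k := by
  rw [EuclideanSpace.norm_eq, freqNorm, freqSq]
  congr 1
  refine Finset.sum_congr rfl fun s _ => ?_
  rw [show freqVec k s = ((k s : ℝ) : ℂ) by simp [freqVec], Complex.norm_real, Real.norm_eq_abs,
    sq_abs]

lemma norm_freqDot_le (k : Fin d → ℤ) (a : EuclideanSpace ℂ (Fin d)) :
    ‖freqDot k a‖ ≤ freqNorm k * ‖a‖ := by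
  have h : freqDot k a = inner ℂ (freqVec k) a := by
    rw [PiLp.inner_apply, freqDot]
    refine Finset.sum_congr rfl fun s _ => ?_
    simp [freqVec, mul_comm]
  rw [h, ← norm_freqVec]
  exact norm_inner_le_norm _ _

@[simp] lemma freqDot_zero (k : Fin d → ℤ) : freqDot k 0 = 0 := by simp [freqDot]

lemma freqDot_zero_left (a : EuclideanSpace ℂ (Fin d)) : freqDot 0 a = 0 := by simp [freqDot]

lemma freqDot_add (k : Fin d → ℤ) (a b : EuclideanSpace ℂ (Fin d)) :
    freqDot k (a + b) = freqDot k a + freqDot k b := by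
  simp [freqDot, mul_add, Finset.sum_add_distrib]

lemma freqDot_sub (k : Fin d → ℤ) (a b : EuclideanSpace ℂ (Fin d)) :
    freqDot k (a - b) = freqDot k a - freqDot k b := by
  simp [freqDot, mul_sub, Finset.sum_sub_distrib]

lemma freqDot_neg (k : Fin d → ℤ) (a : EuclideanSpace ℂ (Fin d)) :
    freqDot k (-a) = -freqDot k a := by
  simp [freqDot]

lemma freqDot_smul (k : Fin d → ℤ) (z : ℂ) (a : EuclideanSpace ℂ (Fin d)) :
    freqDot k (z • a) = z * freqDot k a := by
  simp only [freqDot, Finset.mul_sum, PiLp.smul_apply, smul_eq_mul]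
  exact Finset.sum_congr rfl fun s _ => by ring

lemma freqDot_real_smul (k : Fin d → ℤ) (z : ℝ) (a : EuclideanSpace ℂ (Fin d)) :
    freqDot k (z • a) = z • freqDot k a := by
  rw [Complex.real_smul, ← freqDot_smul]
  congr 1

lemma freqDot_sub_left (k l : Fin d → ℤ) (a : EuclideanSpace ℂ (Fin d)) :
    freqDot (k - l) a = freqDot k a - freqDot l a := by
  simp [freqDot, sub_mul, Finset.sum_sub_distrib]

lemma freqDot_freqVec (k : Fin d → ℤ) : freqDot k (freqVec k) = (freqSq k : ℂ) := by
  simp only [freqDot, freqVec, freqSq, Complex.ofReal_sum]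
  refine Finset.sum_congr rfl fun s _ => ?_
  push_cast
  ring

lemma freqDot_conj (k : Fin d → ℤ) (a : EuclideanSpace ℂ (Fin d)) :
    freqDot k (conjVec a) = starRingEnd ℂ (freqDot k a) := by
  simp [freqDot, map_sum]

lemma freqDot_neg_left (k : Fin d → ℤ) (a : EuclideanSpace ℂ (Fin d)) :
    freqDot (-k) a = -freqDot k a := by
  simp [freqDot]

/-- Coordinatewise conjugation as a real linear map. -/
def conjCLM : EuclideanSpace ℂ (Fin d) →L[ℝ] EuclideanSpace ℂ (Fin d) :=
  LinearMap.toContinuousLinearMap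
    { toFun := conjVec
      map_add' := fun a b => by ext r; simp
      map_smul' := fun c a => by ext r; simp }

@[simp] lemma conjCLM_apply (a : EuclideanSpace ℂ (Fin d)) : conjCLM a = conjVec a := rfl

/-- Contraction with `k` as a continuous linear form. -/
def freqDotCLM (k : Fin d → ℤ) : EuclideanSpace ℂ (Fin d) →L[ℂ] ℂ :=
  LinearMap.toContinuousLinearMap
    { toFun := freqDot k
      map_add' := freqDot_add k
      map_smul' := fun c a => freqDot_smul k c a }

@[simp] lemma freqDotCLM_apply (k : Fin d → ℤ) (a : EuclideanSpace ℂ (Fin d)) :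
    freqDotCLM k a = freqDot k a := rfl

lemma lerayMode_eq (k : Fin d → ℤ) (c : EuclideanSpace ℂ (Fin d)) :
    lerayMode k c = c - (freqDot k c / (freqSq k : ℂ)) • freqVec k := by
  ext r
  simp [lerayMode, freqDot, freqVec]

/-- The projection `lerayMode k` as a continuous linear map. -/
def lerayCLM (k : Fin d → ℤ) : EuclideanSpace ℂ (Fin d) →L[ℂ] EuclideanSpace ℂ (Fin d) :=
  ContinuousLinearMap.id ℂ _ - ((freqSq k : ℂ)⁻¹ • freqDotCLM k).smulRight (freqVec k)

@[simp] lemma lerayCLM_apply (k : Fin d → ℤ) (c : EuclideanSpace ℂ (Fin d)) :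
    lerayCLM k c = lerayMode k c := by
  rw [lerayMode_eq]
  simp [lerayCLM, div_eq_inv_mul]

/-- The crude factor `2` comes from the triangle inequality and Cauchy–Schwarz for `k · c`; any
constant independent of `k` serves. -/
lemma norm_lerayMode_le (k : Fin d → ℤ) (c : EuclideanSpace ℂ (Fin d)) :
    ‖lerayMode k c‖ ≤ 2 * ‖c‖ := by
  rw [lerayMode_eq, two_mul]
  refine (norm_sub_le _ _).trans (add_le_add le_rfl ?_)
  rw [norm_smul, norm_div, Complex.norm_real, Real.norm_of_nonneg (freqSq_nonneg k), norm_freqVec]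
  rcases (freqSq_nonneg k).eq_or_lt with h | h
  · simp [← h]
  · rw [div_mul_eq_mul_div, div_le_iff₀ h]
    calc _ ≤ freqNorm k * ‖c‖ * freqNorm k :=
          mul_le_mul_of_nonneg_right (norm_freqDot_le k c) (freqNorm_nonneg k)
      _ = ‖c‖ * freqSq k := by rw [← freqNorm_sq]; ring

lemma freqSq_ne_zero {k : Fin d → ℤ} (hk : k ≠ 0) : freqSq k ≠ 0 :=
  (zero_lt_one.trans_le (one_le_freqSq hk)).ne'

lemma freqDot_lerayMode (k : Fin d → ℤ) (c : EuclideanSpace ℂ (Fin d)) :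
    freqDot k (lerayMode k c) = 0 := by
  by_cases hk : k = 0
  · rw [hk, freqDot_zero_left]
  · rw [lerayMode_eq, freqDot_sub, freqDot_smul, freqDot_freqVec,
      div_mul_cancel₀ _ (Complex.ofReal_ne_zero.mpr (freqSq_ne_zero hk)), sub_self]

lemma lerayMode_conj (k : Fin d → ℤ) (c : EuclideanSpace ℂ (Fin d)) :
    lerayMode (-k) (conjVec c) = conjVec (lerayMode k c) := by
  ext r
  simp only [lerayMode_eq, freqDot_neg_left, freqDot_conj, freqSq_neg, conjVec_apply,
    PiLp.sub_apply, PiLp.smul_apply, smul_eq_mul, map_sub, map_mul, map_div₀, Complex.conj_ofReal]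
  simp [freqVec]
  ring

/-- The Fourier coefficients of `-𝔏 (∂ · (v ⊗ w))`; they are those of `𝒫(v, w)` for divergence
free `v`. -/
def convMode (a b : Modes d) (k : Fin d → ℤ) : EuclideanSpace ℂ (Fin d) :=
  -lerayMode k (∑' l, (Complex.I * freqDot k (a l)) • b (k - l))

lemma norm_convTerm_le (a b : Modes d) (k l : Fin d → ℤ) :
    ‖(Complex.I * freqDot k (a l)) • b (k - l)‖ ≤ freqNorm k * (‖a l‖ * ‖b (k - l)‖) := by
  rw [norm_smul, norm_mul, Complex.norm_I, one_mul, ← mul_assoc]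
  exact mul_le_mul_of_nonneg_right (norm_freqDot_le k _) (norm_nonneg _)

lemma summable_convTerm {a b : Modes d} (ha : Summable fun k => ‖a k‖)
    (hb : Summable fun k => ‖b k‖) (k : Fin d → ℤ) :
    Summable fun l => (Complex.I * freqDot k (a l)) • b (k - l) :=
  Summable.of_norm_bounded ((summable_modeConv_term (fun _ => norm_nonneg _)
    (fun _ => norm_nonneg _) ha hb k).mul_left (freqNorm k)) fun l => norm_convTerm_le a b k l

/-- In divergence form the derivative falls on the product, so the loss is a single factor `|k|` of
the output frequency and neither input needs to be differentiated. -/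
lemma norm_convMode_le {a b : Modes d} {M N : (Fin d → ℤ) → ℝ} (hM : Summable M)
    (hN : Summable N) (ha : ∀ k, ‖a k‖ ≤ M k) (hb : ∀ k, ‖b k‖ ≤ N k) (k : Fin d → ℤ) :
    ‖convMode a b k‖ ≤ 2 * freqNorm k * modeConv M N k := by
  unfold convMode
  rw [norm_neg, mul_assoc]
  refine (norm_lerayMode_le _ _).trans (mul_le_mul_of_nonneg_left ?_ zero_le_two)
  have hs := summable_modeConv_term (fun k => (norm_nonneg _).trans (ha k))
    (fun k => (norm_nonneg _).trans (hb k)) hM hN k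
  unfold modeConv
  rw [← tsum_mul_left]
  refine tsum_of_norm_bounded (hs.mul_left _).hasSum fun l =>
    (norm_convTerm_le a b k l).trans (mul_le_mul_of_nonneg_left ?_ (freqNorm_nonneg k))
  exact mul_le_mul (ha l) (hb _) (norm_nonneg _) ((norm_nonneg _).trans (ha l))

lemma convMode_add_left {a a' b : Modes d} (ha : Summable fun k => ‖a k‖)
    (ha' : Summable fun k => ‖a' k‖) (hb : Summable fun k => ‖b k‖) (k : Fin d → ℤ) :
    convMode (fun k => a k + a' k) b k = convMode a b k + convMode a' b k := by
  unfold convMode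
  simp only [← lerayCLM_apply]
  rw [← neg_add, ← map_add, ← (summable_convTerm ha hb k).tsum_add (summable_convTerm ha' hb k)]
  simp only [freqDot_add, mul_add, add_smul]

lemma convMode_add_right {a b b' : Modes d} (ha : Summable fun k => ‖a k‖)
    (hb : Summable fun k => ‖b k‖) (hb' : Summable fun k => ‖b' k‖) (k : Fin d → ℤ) :
    convMode a (fun k => b k + b' k) k = convMode a b k + convMode a b' k := by
  unfold convMode
  simp only [← lerayCLM_apply]
  rw [← neg_add, ← map_add, ← (summable_convTerm ha hb k).tsum_add (summable_convTerm ha hb' k)]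
  simp only [smul_add]

lemma freqDot_convMode (a b : Modes d) (k : Fin d → ℤ) : freqDot k (convMode a b k) = 0 := by
  rw [convMode, freqDot_neg, freqDot_lerayMode, neg_zero]

lemma convMode_zero_freq (a b : Modes d) : convMode a b 0 = 0 := by
  rw [convMode]
  simp only [freqDot_zero_left, mul_zero, zero_smul, tsum_zero]
  rw [← lerayCLM_apply, map_zero, neg_zero]

lemma convMode_conj {a b : Modes d} (ha : Summable fun k => ‖a k‖)
    (hb : Summable fun k => ‖b k‖) (hac : ∀ k, a (-k) = conjVec (a k))
    (hbc : ∀ k, b (-k) = conjVec (b k)) (k : Fin d → ℤ) :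
    convMode a b (-k) = conjVec (convMode a b k) := by
  unfold convMode
  rw [← conjCLM_apply, map_neg, conjCLM_apply, ← lerayMode_conj, ← conjCLM_apply,
    conjCLM.map_tsum (summable_convTerm ha hb k), ← (Equiv.neg (Fin d → ℤ)).tsum_eq]
  congr 2
  refine tsum_congr fun l => ?_
  rw [Equiv.neg_apply, hac, freqDot_neg_left, freqDot_conj, conjCLM_apply,
    show -k - -l = -(k - l) by abel, hbc]
  ext r
  simp

/-- Smooth real divergence free zero mean fields, in terms of their Fourier coefficients. -/
structure IsSmoothModes (c : Modes d) : Prop where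
  rapid : RapidMaj fun k => ‖c k‖
  conj : ∀ k, c (-k) = conjVec (c k)
  div : ∀ k, freqDot k (c k) = 0
  zero : c 0 = 0

lemma IsSmoothModes.summable {c : Modes d} (hc : IsSmoothModes c) : Summable fun k => ‖c k‖ :=
  hc.rapid.summable

lemma IsSmoothModes.exists_field {c : Modes d} (hc : IsSmoothModes c) :
    ∃ v : L2Field d, ∀ k, fourierVec v k = c k :=
  NSReynolds.exists_field hc.summable hc.conj

lemma IsSmoothModes.fourierVec_ofFourier {c : Modes d} (hc : IsSmoothModes c) (k : Fin d → ℤ) :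
    fourierVec (ofFourier c) k = c k :=
  ofFourier_spec hc.exists_field k

lemma rapid_of_le {c : Modes d} {M : (Fin d → ℤ) → ℝ} (hM : RapidMaj M)
    (h : ∀ k, ‖c k‖ ≤ M k) : RapidMaj fun k => ‖c k‖ :=
  hM.mono (fun _ => norm_nonneg _) h

lemma IsSmoothModes.add {a b : Modes d} (ha : IsSmoothModes a) (hb : IsSmoothModes b) :
    IsSmoothModes fun k => a k + b k where
  rapid := rapid_of_le (ha.rapid.add hb.rapid) fun _ => norm_add_le _ _
  conj k := by rw [ha.conj, hb.conj]; simp only [← conjCLM_apply, map_add]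
  div k := by rw [freqDot_add, ha.div, hb.div, add_zero]
  zero := by rw [ha.zero, hb.zero, add_zero]

/-- Real, even, polynomially bounded Fourier multipliers preserve smooth fields. -/
lemma IsSmoothModes.multiplier {a : Modes d} (ha : IsSmoothModes a) {μ : (Fin d → ℤ) → ℝ}
    (heven : ∀ k, μ (-k) = μ k) {C : ℝ} (hC : 0 ≤ C) {j : ℕ}
    (hμ : ∀ k, |μ k| ≤ C * modeWeight k ^ j) : IsSmoothModes fun k => μ k • a k where
  rapid := rapid_of_le ((ha.rapid.weight_mul j).const_mul hC) fun k => by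
    rw [norm_smul, Real.norm_eq_abs, ← mul_assoc]
    exact mul_le_mul_of_nonneg_right (hμ k) (norm_nonneg _)
  conj k := by rw [ha.conj, heven, ← conjCLM_apply, ← conjCLM_apply, map_smul]
  div k := by rw [freqDot_real_smul, ha.div, smul_zero]
  zero := by rw [ha.zero, smul_zero]

lemma IsSmoothModes.smul {a : Modes d} (ha : IsSmoothModes a) (c : ℝ) :
    IsSmoothModes fun k => c • a k :=
  ha.multiplier (μ := fun _ => c) (fun _ => rfl) (C := |c|) (abs_nonneg c) (j := 0) (by simp)

lemma IsSmoothModes.sub {a b : Modes d} (ha : IsSmoothModes a) (hb : IsSmoothModes b) :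
    IsSmoothModes fun k => a k - b k := by
  simpa [sub_eq_add_neg] using ha.add (hb.smul (-1))

lemma IsSmoothModes.laplacian {a : Modes d} (ha : IsSmoothModes a) :
    IsSmoothModes fun k => (-freqSq k) • a k := by
  refine ha.multiplier (fun k => by rw [freqSq_neg]) (C := d + 1) (by positivity) (j := 2) fun k => ?_
  rw [abs_neg, abs_of_nonneg (freqSq_nonneg k)]
  exact freqSq_le' k

lemma IsSmoothModes.heat {a : Modes d} (ha : IsSmoothModes a) {t : ℝ} (ht : 0 ≤ t) :
    IsSmoothModes fun k => Real.exp (-(t * freqSq k)) • a k := by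
  refine ha.multiplier (fun k => by rw [freqSq_neg]) (C := 1) zero_le_one (j := 0) fun k => ?_
  rw [Real.abs_exp, pow_zero, mul_one, Real.exp_le_one_iff, neg_nonpos]
  exact mul_nonneg ht (freqSq_nonneg k)

lemma RapidMaj.convBound {M N : (Fin d → ℤ) → ℝ} (hM : RapidMaj M) (hN : RapidMaj N) :
    RapidMaj fun k => 2 * freqNorm k * modeConv M N k := by
  refine ((((hM.conv hN).weight_mul 1).const_mul (C := 2 * (d + 1)) (by positivity))).mono
    (fun k => mul_nonneg (mul_nonneg zero_le_two (freqNorm_nonneg k))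
      (modeConv_nonneg hM.1 hN.1 k)) fun k => ?_
  calc _ ≤ 2 * ((d + 1) * modeWeight k) * modeConv M N k :=
        mul_le_mul_of_nonneg_right (mul_le_mul_of_nonneg_left (freqNorm_le k) zero_le_two)
          (modeConv_nonneg hM.1 hN.1 k)
    _ = _ := by ring

lemma IsSmoothModes.conv {a b : Modes d} (ha : IsSmoothModes a) (hb : IsSmoothModes b) :
    IsSmoothModes (convMode a b) where
  rapid := rapid_of_le (ha.rapid.convBound hb.rapid) fun k =>
    norm_convMode_le ha.summable hb.summable (fun _ => le_rfl) (fun _ => le_rfl) k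
  conj := convMode_conj ha.summable hb.summable ha.conj hb.conj
  div := freqDot_convMode a b
  zero := convMode_zero_freq a b

lemma sobolevWeight_nonneg (n : ℝ) (k : Fin d → ℤ) : 0 ≤ sobolevWeight n k := by
  unfold sobolevWeight
  split_ifs
  · exact le_rfl
  · exact Real.rpow_nonneg (freqSq_nonneg k) n

lemma sobolevWeight_le (n : ℝ) : ∃ C : ℝ, ∃ j : ℕ, 0 ≤ C ∧ ∀ k : Fin d → ℤ,
    sobolevWeight n k ≤ C * modeWeight k ^ j := by
  obtain ⟨j, hj⟩ := exists_nat_ge n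
  refine ⟨(d + 1) ^ j, 2 * j, by positivity, fun k => ?_⟩
  unfold sobolevWeight
  have h1 := modeWeight_pos k
  split_ifs with hk
  · positivity
  · calc freqSq k ^ n ≤ freqSq k ^ (j : ℝ) := Real.rpow_le_rpow_of_exponent_le (one_le_freqSq hk) hj
      _ = freqSq k ^ j := Real.rpow_natCast _ _
      _ ≤ ((d + 1) * modeWeight k ^ 2) ^ j := pow_le_pow_left₀ (freqSq_nonneg k) (freqSq_le' k) j
      _ = _ := by rw [mul_pow, pow_mul]

lemma RapidMaj.summable_weight_mul {M N : (Fin d → ℤ) → ℝ} (hM : RapidMaj M) (hN : RapidMaj N)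
    (n : ℝ) : Summable fun k => sobolevWeight n k * (M k * N k) := by
  obtain ⟨C, j, hC, hw⟩ := sobolevWeight_le (d := d) n
  obtain ⟨B, hB⟩ := hM.exists_bound j
  have hB0 : 0 ≤ B := le_trans (mul_nonneg (pow_nonneg (modeWeight_pos 0).le j) (hM.1 0)) (hB 0)
  refine (hN.summable.mul_left (C * B)).of_nonneg_of_le
    (fun k => mul_nonneg (sobolevWeight_nonneg n k) (mul_nonneg (hM.1 k) (hN.1 k))) fun k => ?_
  calc _ ≤ C * modeWeight k ^ j * (M k * N k) :=
        mul_le_mul_of_nonneg_right (hw k) (mul_nonneg (hM.1 k) (hN.1 k))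
    _ = C * (modeWeight k ^ j * M k) * N k := by ring
    _ ≤ C * B * N k := mul_le_mul_of_nonneg_right (mul_le_mul_of_nonneg_left (hB k) hC) (hN.1 k)

lemma IsSmoothModes.mem_sobolevSpace {v : L2Field d} (h : IsSmoothModes (fourierVec v)) (n : ℝ) :
    v ∈ sobolevSpace d n :=
  ⟨h.div, h.zero, (h.rapid.summable_weight_mul h.rapid n).congr fun k => by ring⟩

/-- For one direction, a single summand of the `ℍᵐ` norm already bounds `(1 + |k|)^m |v_k|`, since
`1 + |k| ≤ 2|k|` for `k ≠ 0`; these bounds for all `m` give rapid decay. The reality condition is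
automatic, as fields are real. -/
lemma mem_sobolevInf_iff {v : L2Field d} : v ∈ sobolevInf d ↔ IsSmoothModes (fourierVec v) := by
  refine ⟨fun h => ?_, fun h => mem_iInter.mpr fun n => h.mem_sobolevSpace n⟩
  have h' : ∀ n : ℕ, v ∈ sobolevSpace d n := fun n => mem_iInter.mp h n
  have hz := (h' 0).2.1
  refine ⟨rapidMaj_of_forall_bound (fun _ => norm_nonneg _) fun m => ?_, fourierVec_conj v,
    (h' 0).1, hz⟩
  obtain ⟨-, -, hs⟩ := h' m
  set S := ∑' k : Fin d → ℤ, sobolevWeight (m : ℝ) k * ‖fourierVec v k‖ ^ 2 with hS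
  refine ⟨Real.sqrt (4 ^ m * S), fun k => ?_⟩
  refine Real.le_sqrt_of_sq_le ?_
  have hS0 : 0 ≤ S := tsum_nonneg fun k => mul_nonneg (sobolevWeight_nonneg _ k) (sq_nonneg _)
  by_cases hk : k = 0
  · rw [hk, hz, norm_zero, mul_zero, zero_pow two_ne_zero]
    positivity
  · have h1 : sobolevWeight (m : ℝ) k * ‖fourierVec v k‖ ^ 2 ≤ S :=
      hs.le_tsum k fun l _ => mul_nonneg (sobolevWeight_nonneg _ l) (sq_nonneg _)
    rw [sobolevWeight, if_neg hk, Real.rpow_natCast] at h1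
    calc _ = (modeWeight k ^ 2) ^ m * ‖fourierVec v k‖ ^ 2 := by ring
      _ ≤ (4 * freqSq k) ^ m * ‖fourierVec v k‖ ^ 2 :=
        mul_le_mul_of_nonneg_right (pow_le_pow_left₀ (sq_nonneg _) (modeWeight_sq_le hk) m)
          (sq_nonneg _)
      _ = 4 ^ m * (freqSq k ^ m * ‖fourierVec v k‖ ^ 2) := by rw [mul_pow]; ring
      _ ≤ _ := mul_le_mul_of_nonneg_left h1 (by positivity)

lemma fourierVec_vecLaplacian {v : L2Field d} (h : IsSmoothModes (fourierVec v))
    (k : Fin d → ℤ) : fourierVec (vecLaplacian v) k = (-freqSq k) • fourierVec v k :=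
  ofFourier_spec (h.laplacian.exists_field) k

lemma fourierVec_heat {v : L2Field d} (h : IsSmoothModes (fourierVec v)) {t : ℝ} (ht : 0 ≤ t)
    (k : Fin d → ℤ) :
    fourierVec (heat t v) k = Real.exp (-(t * freqSq k)) • fourierVec v k :=
  ofFourier_spec ((h.heat ht).exists_field) k

lemma rapid_deriv {c : Modes d} (h : RapidMaj fun k => ‖c k‖) (s : Fin d) :
    RapidMaj fun k => ‖(Complex.I * (k s : ℂ)) • c k‖ := by
  refine rapid_of_le (h.weight_mul 1) fun k => ?_
  rw [norm_smul, norm_mul, Complex.norm_I, one_mul, pow_one]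
  refine mul_le_mul_of_nonneg_right ?_ (norm_nonneg _)
  rw [Complex.norm_intCast, ← Int.norm_eq_abs]
  refine (norm_le_pi_norm k s).trans ?_
  unfold modeWeight
  linarith

lemma fourierVec_partialDeriv {w : L2Field d} (h : IsSmoothModes (fourierVec w)) (s : Fin d)
    (k : Fin d → ℤ) :
    fourierVec (partialDeriv s w) k = (Complex.I * (k s : ℂ)) • fourierVec w k := by
  refine ofFourier_spec (NSReynolds.exists_field (rapid_deriv h.rapid s).summable fun k => ?_) k
  rw [h.conj]
  ext r
  simp

/-- Each product `v_s ∂_s w_r` is a Fourier series times an integrable function, so its coefficients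
are a convolution; summing over `s` produces `(k - l) · v_l`. -/
lemma fourierVec_convection {v w : L2Field d} (hv : IsSmoothModes (fourierVec v))
    (hw : IsSmoothModes (fourierVec w)) (k : Fin d → ℤ) :
    fourierVec (convection v w) k =
      ∑' l, (Complex.I * freqDot k (fourierVec v l)) • fourierVec w (k - l) := by
  have hsum : ∀ s, Summable fun k => ‖fourierVec (partialDeriv s w) k‖ := fun s => by
    simp only [fourierVec_partialDeriv hw]
    exact (rapid_deriv hw.rapid s).summable
  have hint : ∀ r s, Integrable (fun x => torusSeries (fun k => fourierVec v k s) x *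
      ((partialDeriv s w x r : ℝ) : ℂ)) volume := fun r s => by
    refine (integrable_component (partialDeriv s w) r).bdd_mul
      (c := ∑' l, ‖fourierVec v l s‖)
      (continuous_torusSeries (summable_component hv.summable s)).aestronglyMeasurable ?_
    exact Eventually.of_forall (norm_torusSeries_le (summable_component hv.summable s))
  ext r
  rw [fourierVec_apply]
  have h1 : (fun x => ((convection v w x r : ℝ) : ℂ)) =ᵐ[volume] fun x =>
      ∑ s, torusSeries (fun k => fourierVec v k s) x * ((partialDeriv s w x r : ℝ) : ℂ) := by
    filter_upwards [ae_all_iff.mpr fun s => ofReal_component_ae v hv.summable s] with x hx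
    simp only [convection, Complex.ofReal_sum, Complex.ofReal_mul]
    exact Finset.sum_congr rfl fun s _ => by rw [← hx s]
  rw [torusCoeff_congr h1, torusCoeff_sum _ fun s _ => hint r s]
  have h2 : ∀ s, torusCoeff (fun x => torusSeries (fun k => fourierVec v k s) x *
      ((partialDeriv s w x r : ℝ) : ℂ)) k = ∑' l, fourierVec v l s *
        (Complex.I * ((k - l) s : ℂ) * fourierVec w (k - l) r) := by
    intro s
    rw [torusCoeff_series_mul (summable_component hv.summable s) (integrable_component _ r)]
    refine tsum_congr fun l => ?_
    rw [← fourierVec_apply, fourierVec_partialDeriv hw, PiLp.smul_apply, smul_eq_mul]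
  have h3 : ∀ s, Summable fun l => fourierVec v l s *
        (Complex.I * ((k - l) s : ℂ) * fourierVec w (k - l) r) := by
    intro s
    refine Summable.of_norm_bounded (summable_modeConv_term (fun _ => norm_nonneg _)
      (fun _ => norm_nonneg _) hv.summable (hsum s) k) fun l => ?_
    rw [norm_mul]
    refine mul_le_mul (PiLp.norm_apply_le _ s) ?_ (norm_nonneg _) (norm_nonneg _)
    rw [fourierVec_partialDeriv hw]
    refine le_trans (le_of_eq ?_) (PiLp.norm_apply_le _ r)
    rw [PiLp.smul_apply, smul_eq_mul]
  simp only [h2]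
  rw [← Summable.tsum_finsetSum fun s _ => h3 s]
  have h4 : (∑' l, (Complex.I * freqDot k (fourierVec v l)) • fourierVec w (k - l)) r =
      ∑' l, ((Complex.I * freqDot k (fourierVec v l)) • fourierVec w (k - l)) r :=
    (EuclideanSpace.proj (𝕜 := ℂ) r).map_tsum (summable_convTerm hv.summable hw.summable k)
  rw [h4]
  refine tsum_congr fun l => ?_
  -- Incompressibility `l · v_l = 0` moves the derivative from `w` to the product.
  have h5 : freqDot k (fourierVec v l) = freqDot (k - l) (fourierVec v l) := by
    rw [freqDot_sub_left, hv.div, sub_zero]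
  rw [h5, PiLp.smul_apply, smul_eq_mul, freqDot, Finset.mul_sum, Finset.sum_mul]
  refine Finset.sum_congr rfl fun s _ => ?_
  simp only [Pi.sub_apply, Int.cast_sub]
  ring

lemma fourierVec_nsBilin {v w : L2Field d} (hv : IsSmoothModes (fourierVec v))
    (hw : IsSmoothModes (fourierVec w)) (k : Fin d → ℤ) :
    fourierVec (nsBilin v w) k = convMode (fourierVec v) (fourierVec w) k := by
  have h : ∀ k, -lerayMode k (fourierVec (convection v w) k) =
      convMode (fourierVec v) (fourierVec w) k := fun k => by
    rw [fourierVec_convection hv hw, convMode]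
  obtain ⟨z, hz⟩ := (hv.conv hw).exists_field
  -- `z` has the coefficients of `𝒫(v, w)`, so `-z` witnesses that the Leray projection is not the
  -- default value of `ofFourier`.
  rw [nsBilin, fourierVec_neg, leray, ofFourier_spec ⟨-z, fun k => ?_⟩, h]
  rw [fourierVec_neg, hz, ← h, neg_neg]

end

/-! ### Half-open time intervals, Duhamel integrals and scalar linear equations. -/

section

variable {F : Type*} [NormedAddCommGroup F] [NormedSpace ℝ F]

lemma zero_mem_timeInterval {T : EReal} (hT : 0 < T) : (0 : ℝ) ∈ timeInterval T :=
  ⟨le_rfl, by simpa using hT⟩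

lemma mem_timeInterval_of_le {T : EReal} {s t : ℝ} (ht : t ∈ timeInterval T) (hs : 0 ≤ s)
    (hst : s ≤ t) : s ∈ timeInterval T :=
  ⟨hs, (EReal.coe_le_coe_iff.mpr hst).trans_lt ht.2⟩

lemma Icc_subset_timeInterval {T : EReal} {t : ℝ} (ht : t ∈ timeInterval T) :
    Icc 0 t ⊆ timeInterval T := fun _ hs => mem_timeInterval_of_le ht hs.1 hs.2

lemma timeInterval_top : timeInterval ⊤ = Ici 0 := by
  ext t
  simp [timeInterval, EReal.coe_lt_top]

lemma timeInterval_mono {T T' : EReal} (h : T ≤ T') : timeInterval T ⊆ timeInterval T' :=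
  fun _ ht => ⟨ht.1, ht.2.trans_le h⟩

lemma convex_timeInterval (T : EReal) : Convex ℝ (timeInterval T) := by
  refine Set.OrdConnected.convex ⟨fun x hx y hy z hz => ?_⟩
  exact mem_timeInterval_of_le hy (hx.1.trans hz.1) hz.2

lemma exists_gt_mem_timeInterval {T : EReal} {t : ℝ} (ht : t ∈ timeInterval T) :
    ∃ t' ∈ timeInterval T, t < t' := by
  obtain ⟨x, hx1, hx2⟩ := EReal.lt_iff_exists_real_btwn.mp ht.2
  have h := EReal.coe_lt_coe_iff.mp hx1
  exact ⟨x, ⟨ht.1.trans h.le, hx2⟩, h⟩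

/-- Near a point `t < T` the upper end is invisible. Hence derivatives within `[0, T)` do not depend
on `T`, which allows restriction and gluing of solutions. -/
lemma nhdsWithin_timeInterval {T : EReal} {t : ℝ} (ht : t ∈ timeInterval T) :
    𝓝[timeInterval T] t = 𝓝[Ici 0] t := by
  obtain ⟨t', ht', hlt⟩ := exists_gt_mem_timeInterval ht
  refine nhdsWithin_eq_nhdsWithin' (Iio_mem_nhds hlt) (subset_antisymm ?_ ?_)
  · exact fun s hs => ⟨hs.1.1, hs.2⟩
  · exact fun s hs => ⟨mem_timeInterval_of_le ht' hs.1 hs.2.le, hs.2⟩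

lemma nhdsWithin_Icc_timeInterval {T : EReal} {t t' : ℝ} (ht : t ∈ timeInterval T) (h : t < t') :
    𝓝[Icc 0 t'] t = 𝓝[timeInterval T] t := by
  rw [nhdsWithin_timeInterval ht]
  refine nhdsWithin_eq_nhdsWithin' (Iio_mem_nhds h) (subset_antisymm ?_ ?_)
  · exact fun s hs => ⟨hs.1.1, hs.2⟩
  · exact fun s hs => ⟨⟨hs.1, hs.2.le⟩, hs.2⟩

lemma hasDerivWithinAt_timeInterval_iff {T : EReal} {t : ℝ} (ht : t ∈ timeInterval T)
    {f : ℝ → F} {f' : F} :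
    HasDerivWithinAt f f' (timeInterval T) t ↔ HasDerivWithinAt f f' (Ici 0) t := by
  rw [HasDerivWithinAt, HasDerivWithinAt, nhdsWithin_timeInterval ht]

lemma hasDerivAt_of_timeInterval {T : EReal} {t : ℝ} (ht : t ∈ timeInterval T) (h0 : 0 < t)
    {f : ℝ → F} {f' : F} (h : HasDerivWithinAt f f' (timeInterval T) t) : HasDerivAt f f' t := by
  rw [hasDerivWithinAt_timeInterval_iff ht] at h
  exact h.hasDerivAt (Ici_mem_nhds h0)

lemma uniqueDiffOn_timeInterval (T : EReal) : UniqueDiffOn ℝ (timeInterval T) := by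
  intro t ht
  exact (uniqueDiffOn_Ici (0 : ℝ) t ht.1).mono_nhds (nhdsWithin_timeInterval ht).ge

/-- The fundamental theorem of calculus on a time interval. -/
lemma hasDerivWithinAt_integral_timeInterval [CompleteSpace F] {T : EReal} {g : ℝ → F}
    (hg : ContinuousOn g (timeInterval T)) {t : ℝ} (ht : t ∈ timeInterval T) :
    HasDerivWithinAt (fun t => ∫ s in (0 : ℝ)..t, g s) (g t) (timeInterval T) t := by
  obtain ⟨t', ht', hlt⟩ := exists_gt_mem_timeInterval ht
  -- Composing with the retraction onto `[0, t']` makes the integrand continuous on all of `ℝ`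
  -- without changing it on `[0, t']`.
  let p : ℝ → ℝ := fun s => max 0 (min s t')
  have hp : Continuous p := by fun_prop
  have hpm : ∀ s, p s ∈ timeInterval T := fun s =>
    mem_timeInterval_of_le ht' (le_max_left _ _) (max_le ht'.1 (min_le_right _ _))
  have hpe : ∀ s ∈ Icc 0 t', p s = s := fun s hs => by simp [p, hs.1, hs.2]
  have hc : Continuous fun s => g (p s) := hg.comp_continuous hp hpm
  have h := (hc.integral_hasStrictDerivAt 0 t).hasDerivAt.hasDerivWithinAt (s := Icc 0 t')
  rw [hpe t ⟨ht.1, hlt.le⟩, HasDerivWithinAt, nhdsWithin_Icc_timeInterval ht hlt,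
    ← HasDerivWithinAt] at h
  rw [HasDerivWithinAt, ← nhdsWithin_Icc_timeInterval ht hlt] at h ⊢
  refine HasDerivWithinAt.congr (s := Icc 0 t') h (fun s hs => ?_) ?_
  · refine intervalIntegral.integral_congr fun x hx => ?_
    rw [uIcc_of_le hs.1] at hx
    simp only [hpe x ⟨hx.1, hx.2.trans hs.2⟩]
  · refine intervalIntegral.integral_congr fun x hx => ?_
    rw [uIcc_of_le ht.1] at hx
    simp only [hpe x ⟨hx.1, hx.2.trans hlt.le⟩]

/-- The Duhamel integral of a mode. -/
def duhamel (lam : ℝ) (g : ℝ → F) (t : ℝ) : F :=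
  ∫ s in (0 : ℝ)..t, Real.exp (-((t - s) * lam)) • g s

/-- With the dependence on `t` pulled out of the integrand, the product rule and the fundamental
theorem of calculus apply. -/
lemma duhamel_eq (lam : ℝ) (g : ℝ → F) (t : ℝ) :
    duhamel lam g t = Real.exp (-(t * lam)) • ∫ s in (0 : ℝ)..t, Real.exp (s * lam) • g s := by
  rw [duhamel, ← intervalIntegral.integral_smul]
  congr 1
  funext s
  rw [smul_smul, ← Real.exp_add]
  congr 2
  ring

lemma hasDerivWithinAt_duhamel [CompleteSpace F] {T : EReal} {g : ℝ → F}
    (hg : ContinuousOn g (timeInterval T)) (lam : ℝ) {t : ℝ} (ht : t ∈ timeInterval T) :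
    HasDerivWithinAt (duhamel lam g) ((-lam) • duhamel lam g t + g t) (timeInterval T) t := by
  have h1 : HasDerivWithinAt (fun t => Real.exp (-(t * lam))) (Real.exp (-(t * lam)) * -lam)
      (timeInterval T) t := by
    have := ((hasDerivAt_id t).mul_const lam).neg.exp.hasDerivWithinAt (s := timeInterval T)
    simpa using this
  have h2 := hasDerivWithinAt_integral_timeInterval (g := fun s => Real.exp (s * lam) • g s)
    (ContinuousOn.smul (by fun_prop) hg) ht
  have h3 := h1.smul h2
  refine (h3.congr_of_mem (fun s _ => duhamel_eq lam g s) ht).congr_deriv ?_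
  rw [duhamel_eq, smul_smul, smul_smul, ← Real.exp_add, neg_add_cancel, Real.exp_zero, one_smul,
    add_comm, mul_comm]

lemma norm_duhamel_le {g : ℝ → F} {lam B t : ℝ} (hlam : 0 ≤ lam) (ht : 0 ≤ t)
    (hB : ∀ s ∈ Icc 0 t, ‖g s‖ ≤ B) : ‖duhamel lam g t‖ ≤ B * t := by
  have h := intervalIntegral.norm_integral_le_of_norm_le_const (a := 0) (b := t) (C := B)
    (f := fun s => Real.exp (-((t - s) * lam)) • g s) fun s hs => by
      rw [uIoc_of_le ht] at hs
      rw [norm_smul, Real.norm_eq_abs, Real.abs_exp]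
      refine (mul_le_of_le_one_left (norm_nonneg _) ?_).trans (hB s ⟨hs.1.le, hs.2⟩)
      rw [Real.exp_le_one_iff, neg_nonpos]
      exact mul_nonneg (sub_nonneg.mpr hs.2) hlam
  rw [duhamel]
  simpa [abs_of_nonneg ht] using h

/-- Parabolic smoothing: the kernel `λ e^{-(t-s)λ}` has mass `1 - e^{-tλ} ≤ 1` on `[0, t]`, so a
full factor `λ` is gained uniformly in `t`. -/
lemma mul_norm_duhamel_le {g : ℝ → F} {lam B t : ℝ} (hlam : 0 ≤ lam) (ht : 0 ≤ t)
    (hB : ∀ s ∈ Icc 0 t, ‖g s‖ ≤ B) : lam * ‖duhamel lam g t‖ ≤ B := by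
  have hB0 : 0 ≤ B := (norm_nonneg _).trans (hB 0 ⟨le_rfl, ht⟩)
  rcases hlam.eq_or_lt with h0 | h0
  · rw [← h0, zero_mul]
    exact hB0
  have hint : ∫ s in (0 : ℝ)..t, lam * Real.exp (-((t - s) * lam)) = 1 - Real.exp (-(t * lam)) := by
    have := intervalIntegral.integral_eq_sub_of_hasDerivAt (a := 0) (b := t)
      (f := fun s => Real.exp (-((t - s) * lam)))
      (f' := fun s => lam * Real.exp (-((t - s) * lam))) (fun s _ => by
        have h := (((hasDerivAt_id s).const_sub t).mul_const lam).neg.exp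
        refine h.congr_deriv ?_
        simp only [id, Pi.neg_apply]
        ring) ((by fun_prop : Continuous fun s =>
          lam * Real.exp (-((t - s) * lam))).intervalIntegrable _ _)
    simpa using this
  have h1 : ‖duhamel lam g t‖ ≤ ∫ s in (0 : ℝ)..t, B * Real.exp (-((t - s) * lam)) := by
    refine intervalIntegral.norm_integral_le_of_norm_le ht ?_
      ((by fun_prop : Continuous fun s => B * Real.exp (-((t - s) * lam))).intervalIntegrable _ _)
    refine Eventually.of_forall fun s hs => ?_
    rw [norm_smul, Real.norm_eq_abs, Real.abs_exp, mul_comm]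
    exact mul_le_mul_of_nonneg_right (hB s ⟨hs.1.le, hs.2⟩) (Real.exp_pos _).le
  calc lam * ‖duhamel lam g t‖ ≤ lam * ∫ s in (0 : ℝ)..t, B * Real.exp (-((t - s) * lam)) :=
        mul_le_mul_of_nonneg_left h1 hlam
    _ = B * ∫ s in (0 : ℝ)..t, lam * Real.exp (-((t - s) * lam)) := by
        rw [← intervalIntegral.integral_const_mul, ← intervalIntegral.integral_const_mul]
        congr 1
        funext s
        ring
    _ ≤ B := by
        rw [hint]
        exact mul_le_of_le_one_right hB0 (by linarith [Real.exp_pos (-(t * lam))])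

/-- A continuous function which starts nonpositive and grows at most linearly where it is positive
stays nonpositive. -/
lemma nonpos_of_deriv_le_mul {q q' : ℝ → ℝ} {L b : ℝ} (hb : 0 ≤ b) (hq : ContinuousOn q (Icc 0 b))
    (h0 : q 0 ≤ 0) (hd : ∀ t ∈ Ioo 0 b, 0 < q t → HasDerivAt q (q' t) t ∧ q' t ≤ L * q t) :
    q b ≤ 0 := by
  by_contra! hpos
  set S := {t ∈ Icc 0 b | q t ≤ 0} with hS
  have hScl : IsClosed S := hq.preimage_isClosed_of_isClosed isClosed_Icc isClosed_Iic
  have hSne : S.Nonempty := ⟨0, ⟨le_rfl, hb⟩, h0⟩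
  have hSb : BddAbove S := ⟨b, fun t ht => ht.1.2⟩
  -- `a` is the last time at which `q ≤ 0`. On `(a, b)` the function is positive, so `e^{-Lt} q`
  -- decreases there, which contradicts `q a ≤ 0 < q b`.
  set a := sSup S with ha
  have haS : a ∈ S := hScl.csSup_mem hSne hSb
  have hab : a ≤ b := haS.1.2
  have hgt : ∀ t ∈ Ioo a b, 0 < q t := fun t ht => by
    by_contra! hle
    exact (le_csSup hSb ⟨⟨haS.1.1.trans ht.1.le, ht.2.le⟩, hle⟩).not_gt ht.1
  have hanti : AntitoneOn (fun t => Real.exp (-(L * t)) * q t) (Icc a b) := by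
    have hder : ∀ t ∈ Ioo a b, HasDerivAt (fun t => Real.exp (-(L * t)) * q t)
        (Real.exp (-(L * t)) * -L * q t + Real.exp (-(L * t)) * q' t) t := fun t ht => by
      have h1 := ((hasDerivAt_id t).const_mul L).neg.exp
      have h2 := (hd t ⟨haS.1.1.trans_lt ht.1, ht.2⟩ (hgt t ht)).1
      refine (h1.mul h2).congr_deriv ?_
      simp
    refine antitoneOn_of_deriv_nonpos (convex_Icc a b) ?_ ?_ ?_
    · exact ContinuousOn.mul (by fun_prop) (hq.mono (Icc_subset_Icc_left haS.1.1))
    · rw [interior_Icc]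
      exact fun t ht => (hder t ht).differentiableAt.differentiableWithinAt
    · rw [interior_Icc]
      intro t ht
      rw [(hder t ht).deriv]
      have h2 := (hd t ⟨haS.1.1.trans_lt ht.1, ht.2⟩ (hgt t ht)).2
      have h3 := Real.exp_pos (-(L * t))
      nlinarith
  have h := hanti ⟨le_rfl, hab⟩ ⟨hab, le_rfl⟩ hab
  have h1 := mul_pos (Real.exp_pos (-(L * b))) hpos
  have h2 := mul_nonpos_of_nonneg_of_nonpos (Real.exp_pos (-(L * a))).le haS.2
  simp only at h
  linarith

section LinearODE

variable {T : EReal} {A a ε : ℝ → ℝ}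

lemma hasDerivWithinAt_linear_solution
    (hA : ∀ t ∈ timeInterval T, HasDerivWithinAt A (a t) (timeInterval T) t)
    (hε : ContinuousOn ε (timeInterval T)) {t : ℝ} (ht : t ∈ timeInterval T) :
    HasDerivWithinAt (fun t => Real.exp (A t) * ∫ s in (0 : ℝ)..t, Real.exp (-A s) * ε s)
      (a t * (Real.exp (A t) * ∫ s in (0 : ℝ)..t, Real.exp (-A s) * ε s) + ε t)
      (timeInterval T) t := by
  have hAc : ContinuousOn A (timeInterval T) := fun s hs => (hA s hs).continuousWithinAt
  have h1 := (hA t ht).exp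
  have h2 := hasDerivWithinAt_integral_timeInterval (g := fun s => Real.exp (-A s) * ε s)
    ((hAc.neg.rexp).mul hε) ht
  refine (h1.mul h2).congr_deriv ?_
  have h3 : Real.exp (A t) * Real.exp (-A t) = 1 := by
    rw [← Real.exp_add, add_neg_cancel, Real.exp_zero]
  linear_combination ε t * h3

/-- The integrating factor `e^{-A}` times the difference of the two solutions has zero derivative
and vanishes at `0`. -/
lemma linear_solution_unique (hT : 0 < T)
    (hA : ∀ t ∈ timeInterval T, HasDerivWithinAt A (a t) (timeInterval T) t)
    (hε : ContinuousOn ε (timeInterval T)) {σ : ℝ → ℝ} (h0 : σ 0 = 0)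
    (hσ : ∀ t ∈ timeInterval T, HasDerivWithinAt σ (a t * σ t + ε t) (timeInterval T) t)
    {t : ℝ} (ht : t ∈ timeInterval T) :
    σ t = Real.exp (A t) * ∫ s in (0 : ℝ)..t, Real.exp (-A s) * ε s := by
  have hder : ∀ s ∈ timeInterval T, HasDerivWithinAt (fun t => Real.exp (-A t) *
      (σ t - Real.exp (A t) * ∫ s in (0 : ℝ)..t, Real.exp (-A s) * ε s)) 0 (timeInterval T) s := by
    intro s hs
    have h1 := (hA s hs).neg.exp
    have h2 := (hσ s hs).sub (hasDerivWithinAt_linear_solution hA hε hs)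
    refine (h1.mul h2).congr_deriv ?_
    simp only [Pi.neg_apply, Pi.sub_apply]
    ring
  have hconst := (convex_timeInterval T).norm_image_sub_le_of_norm_hasDerivWithin_le (C := 0)
    hder (fun _ _ => by simp) (zero_mem_timeInterval hT) ht
  simp only [h0, intervalIntegral.integral_same, mul_zero, sub_zero, zero_mul] at hconst
  have h := norm_le_zero_iff.mp hconst
  have h3 := (mul_eq_zero.mp h).resolve_left (Real.exp_pos _).ne'
  linarith

end LinearODE

lemma continuousOn_of_solvesControl {R G K : ℝ} {D D' ε ρ : ℝ → ℝ} {T : EReal}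
    (h : SolvesControl R G K D D' ε T ρ) : ContinuousOn ρ (timeInterval T) :=
  fun t ht => (h.2 t ht).continuousWithinAt

section LinearControl

variable {R G K G' : ℝ} {D D' ρ ε : ℝ → ℝ} {T : EReal}

lemma hasDerivWithinAt_controlExponent (hD : ContinuousOn D (timeInterval T))
    (hD' : ContinuousOn D' (timeInterval T)) (hρ : ContinuousOn ρ (timeInterval T)) :
    ∀ t ∈ timeInterval T, HasDerivWithinAt (fun t => -t + R * controlPrimitive G K G' D D' ρ t)
      (-1 + R * (G * D t + K * D' t + G' * ρ t)) (timeInterval T) t := by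
  intro t ht
  have h := hasDerivWithinAt_integral_timeInterval
    (g := fun s => G * D s + K * D' s + G' * ρ s) (T := T) (by fun_prop) ht
  exact (hasDerivWithinAt_id t _).neg.add (h.const_mul R)

lemma linearControl_eq (t : ℝ) : linearControl R G K G' D D' ρ ε t =
    Real.exp (-t + R * controlPrimitive G K G' D D' ρ t) *
      ∫ s in (0 : ℝ)..t, Real.exp (-(-s + R * controlPrimitive G K G' D D' ρ s)) * ε s := by
  unfold linearControl
  congr 2
  funext s
  congr 2
  ring

lemma solvesLinearControl_linearControl (hD : ContinuousOn D (timeInterval T))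
    (hD' : ContinuousOn D' (timeInterval T)) (hρ : ContinuousOn ρ (timeInterval T))
    (hε : ContinuousOn ε (timeInterval T)) :
    SolvesLinearControl R G K G' D D' ρ ε T (linearControl R G K G' D D' ρ ε) := by
  refine ⟨by simp [linearControl], fun t ht => ?_⟩
  have h := hasDerivWithinAt_linear_solution
    (hasDerivWithinAt_controlExponent (R := R) (G := G) (K := K) (G' := G') hD hD' hρ) hε ht
  refine (h.congr_of_mem (fun s _ => linearControl_eq s) ht).congr_deriv ?_
  rw [linearControl_eq]
  ring

lemma SolvesLinearControl.eq_linearControl (hT : 0 < T) (hD : ContinuousOn D (timeInterval T))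
    (hD' : ContinuousOn D' (timeInterval T)) (hρ : ContinuousOn ρ (timeInterval T))
    (hε : ContinuousOn ε (timeInterval T)) {σ : ℝ → ℝ}
    (hσ : SolvesLinearControl R G K G' D D' ρ ε T σ) :
    EqOn σ (linearControl R G K G' D D' ρ ε) (timeInterval T) := by
  intro t ht
  rw [linearControl_eq]
  refine linear_solution_unique hT (hasDerivWithinAt_controlExponent hD hD' hρ) hε hσ.1
    (fun s hs => (hσ.2 s hs).congr_deriv (by ring)) ht

lemma linearControl_nonneg {t : ℝ} (ht : 0 ≤ t) (hε : ∀ s, 0 ≤ s → 0 ≤ ε s) :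
    0 ≤ linearControl R G K G' D D' ρ ε t :=
  mul_nonneg (Real.exp_pos _).le (intervalIntegral.integral_nonneg ht fun s hs =>
    mul_nonneg (Real.exp_pos _).le (hε s hs.1))

/-- The solution of the control problem is nonnegative. -/
lemma SolvesControl.nonneg (hT : 0 < T) (hD : ContinuousOn D (timeInterval T))
    (hD' : ContinuousOn D' (timeInterval T)) (hε : ContinuousOn ε (timeInterval T))
    (hε0 : ∀ s, 0 ≤ s → 0 ≤ ε s) (h : SolvesControl R G K D D' ε T ρ) {t : ℝ}
    (ht : t ∈ timeInterval T) : 0 ≤ ρ t := by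
  -- Freezing one factor of `ρ²` in the coefficient makes the Riccati equation linear in `ρ`; the
  -- explicit formula is then visibly nonnegative, whatever the sign of the coefficient.
  have hlin : SolvesLinearControl R G K G D D' ρ ε T ρ :=
    ⟨h.1, fun t ht => (h.2 t ht).congr_deriv (by ring)⟩
  rw [hlin.eq_linearControl hT hD hD' (continuousOn_of_solvesControl h) hε ht]
  exact linearControl_nonneg ht.1 hε0

end LinearControl

end

/-! ### Curves of modes with locally uniform majorants and termwise differentiation. -/

section

variable {d : ℕ} {T : EReal}

/-- The mean value inequality turns a bound on derivatives into a dominating bound for difference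
quotients. -/
lemma norm_slope_le {F : Type*} [NormedAddCommGroup F] [NormedSpace ℝ F] {f f' : ℝ → F}
    {S : Set ℝ} (hS : Convex ℝ S) {B : ℝ} (hd : ∀ t ∈ S, HasDerivWithinAt f (f' t) S t)
    (hB : ∀ t ∈ S, ‖f' t‖ ≤ B) {s t : ℝ} (ht : t ∈ S) (hs : s ∈ S) : ‖slope f t s‖ ≤ B := by
  have hB0 : 0 ≤ B := (norm_nonneg _).trans (hB t ht)
  have h := hS.norm_image_sub_le_of_norm_hasDerivWithin_le hd hB ht hs
  rw [slope_def_module, norm_smul, norm_inv]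
  rcases (norm_nonneg (s - t)).eq_or_lt with h0 | h0
  · rw [← h0, inv_zero, zero_mul]
    exact hB0
  · rwa [inv_mul_le_iff₀ h0, mul_comm]

/-- Termwise differentiation of a series within a convex set. -/
lemma hasDerivWithinAt_tsum {ι F : Type*} [NormedAddCommGroup F] [NormedSpace ℝ F]
    [CompleteSpace F] {f f' : ι → ℝ → F} {S : Set ℝ} (hS : Convex ℝ S) {u : ι → ℝ}
    (hu : Summable u) (hd : ∀ i, ∀ t ∈ S, HasDerivWithinAt (f i) (f' i t) S t)
    (hb : ∀ i, ∀ t ∈ S, ‖f' i t‖ ≤ u i) (hf : ∀ t ∈ S, Summable fun i => f i t) {t : ℝ}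
    (ht : t ∈ S) : HasDerivWithinAt (fun s => ∑' i, f i s) (∑' i, f' i t) S t := by
  rw [hasDerivWithinAt_iff_tendsto_slope]
  have h : Tendsto (fun s => ∑' i, slope (f i) t s) (𝓝[S \ {t}] t) (𝓝 (∑' i, f' i t)) := by
    refine tendsto_tsum_of_dominated_convergence hu
      (fun i => hasDerivWithinAt_iff_tendsto_slope.mp (hd i t ht)) ?_
    filter_upwards [self_mem_nhdsWithin] with s hs i
    exact norm_slope_le hS (hd i) (hb i) ht hs.1
  refine h.congr' ?_
  filter_upwards [self_mem_nhdsWithin] with s hs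
  simp only [slope_def_module]
  rw [Summable.tsum_const_smul _ ((hf s hs.1).sub (hf t ht)), (hf s hs.1).tsum_sub (hf t ht)]

/-- Rapid decay of Fourier coefficients, uniformly for times in a set. -/
def UnifRapid (S : Set ℝ) (c : ℝ → Modes d) : Prop :=
  ∃ M : (Fin d → ℤ) → ℝ, RapidMaj M ∧ ∀ t ∈ S, ∀ k, ‖c t k‖ ≤ M k

lemma UnifRapid.union {S S' : Set ℝ} {c : ℝ → Modes d} (h : UnifRapid S c)
    (h' : UnifRapid S' c) : UnifRapid (S ∪ S') c := by
  obtain ⟨M, hM, hc⟩ := h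
  obtain ⟨M', hM', hc'⟩ := h'
  refine ⟨_, hM.add hM', fun t ht k => ?_⟩
  rcases ht with ht | ht
  · exact (hc t ht k).trans (le_add_of_nonneg_right (hM'.1 k))
  · exact (hc' t ht k).trans (le_add_of_nonneg_left (hM.1 k))

lemma UnifRapid.congr {S : Set ℝ} {c e : ℝ → Modes d} (h : UnifRapid S c)
    (hce : ∀ t ∈ S, e t = c t) : UnifRapid S e := by
  obtain ⟨M, hM, hc⟩ := h
  exact ⟨M, hM, fun t ht k => by rw [hce t ht]; exact hc t ht k⟩

lemma unifRapid_of_forall_bound {S : Set ℝ} {c : ℝ → Modes d}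
    (h : ∀ m : ℕ, ∃ C, ∀ t ∈ S, ∀ k, modeWeight k ^ m * ‖c t k‖ ≤ C) : UnifRapid S c := by
  have hbdd : ∀ k, BddAbove ((fun t => ‖c t k‖) '' S) := fun k => by
    obtain ⟨C, hC⟩ := h 0
    refine ⟨C, ?_⟩
    rintro _ ⟨t, ht, rfl⟩
    simpa using hC t ht k
  refine ⟨fun k => sSup ((fun t => ‖c t k‖) '' S), rapidMaj_of_forall_bound (fun k => ?_)
    fun m => ?_, fun t ht k => le_csSup (hbdd k) ⟨t, ht, rfl⟩⟩
  · refine Real.sSup_nonneg ?_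
    rintro _ ⟨t, ht, rfl⟩
    exact norm_nonneg _
  · obtain ⟨C, hC⟩ := h m
    refine ⟨max C 0, fun k => ?_⟩
    have hp := pow_pos (modeWeight_pos k) m
    rw [← le_div_iff₀' hp]
    refine Real.sSup_le ?_ (div_nonneg (le_max_right _ _) hp.le)
    rintro _ ⟨t, ht, rfl⟩
    rw [le_div_iff₀' hp]
    exact (hC t ht k).trans (le_max_left _ _)

/-- Curves of smooth fields, with locally uniform bounds. -/
structure IsBoundedCurve (T : EReal) (c : ℝ → Modes d) : Prop where
  rapid : ∀ t ∈ timeInterval T, UnifRapid (Icc 0 t) c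
  mem : ∀ t ∈ timeInterval T, IsSmoothModes (c t)

/-- Every Fourier coefficient of `c` has the derivative given by `c'`. -/
def ModeDeriv (T : EReal) (c c' : ℝ → Modes d) : Prop :=
  ∀ t ∈ timeInterval T, ∀ k, HasDerivWithinAt (fun s => c s k) (c' t k) (timeInterval T) t

lemma IsBoundedCurve.congr {c e : ℝ → Modes d} (h : IsBoundedCurve T c)
    (hce : ∀ t ∈ timeInterval T, e t = c t) : IsBoundedCurve T e :=
  ⟨fun t ht => (h.rapid t ht).congr fun s hs => hce s (Icc_subset_timeInterval ht hs),
    fun t ht => by rw [hce t ht]; exact h.mem t ht⟩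

lemma ModeDeriv.congr {c e c' e' : ℝ → Modes d} (h : ModeDeriv T c c')
    (hce : ∀ t ∈ timeInterval T, e t = c t) (hce' : ∀ t ∈ timeInterval T, e' t = c' t) :
    ModeDeriv T e e' := fun t ht k => by
  rw [hce' t ht]
  exact (h t ht k).congr_of_mem (fun s hs => by rw [hce s hs]) ht

lemma ModeDeriv.continuousOn {c c' : ℝ → Modes d} (h : ModeDeriv T c c') (k : Fin d → ℤ) :
    ContinuousOn (fun s => c s k) (timeInterval T) :=
  fun t ht => (h t ht k).continuousWithinAt

lemma IsBoundedCurve.add {c e : ℝ → Modes d} (hc : IsBoundedCurve T c)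
    (he : IsBoundedCurve T e) : IsBoundedCurve T fun t k => c t k + e t k := by
  refine ⟨fun t ht => ?_, fun t ht => (hc.mem t ht).add (he.mem t ht)⟩
  obtain ⟨M, hM, h⟩ := hc.rapid t ht
  obtain ⟨N, hN, h'⟩ := he.rapid t ht
  exact ⟨_, hM.add hN, fun s hs k => (norm_add_le _ _).trans (add_le_add (h s hs k) (h' s hs k))⟩

lemma IsBoundedCurve.multiplier {c : ℝ → Modes d} (hc : IsBoundedCurve T c)
    {μ : (Fin d → ℤ) → ℝ} (heven : ∀ k, μ (-k) = μ k) {C : ℝ} (hC : 0 ≤ C) {j : ℕ}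
    (hμ : ∀ k, |μ k| ≤ C * modeWeight k ^ j) : IsBoundedCurve T fun t k => μ k • c t k := by
  refine ⟨fun t ht => ?_, fun t ht => (hc.mem t ht).multiplier heven hC hμ⟩
  obtain ⟨M, hM, h⟩ := hc.rapid t ht
  refine ⟨_, (hM.weight_mul j).const_mul hC, fun s hs k => ?_⟩
  rw [norm_smul, Real.norm_eq_abs, ← mul_assoc]
  exact mul_le_mul (hμ k) (h s hs k) (norm_nonneg _)
    (mul_nonneg hC (pow_nonneg (modeWeight_pos k).le j))

lemma IsBoundedCurve.smul {c : ℝ → Modes d} (hc : IsBoundedCurve T c) (r : ℝ) :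
    IsBoundedCurve T fun t k => r • c t k :=
  hc.multiplier (μ := fun _ => r) (fun _ => rfl) (C := |r|) (abs_nonneg r) (j := 0) (by simp)

lemma IsBoundedCurve.sub {c e : ℝ → Modes d} (hc : IsBoundedCurve T c)
    (he : IsBoundedCurve T e) : IsBoundedCurve T fun t k => c t k - e t k := by
  simpa [sub_eq_add_neg] using hc.add (he.smul (-1))

lemma abs_neg_freqSq_le (k : Fin d → ℤ) : |(-freqSq k)| ≤ (d + 1) * modeWeight k ^ 2 := by
  rw [abs_neg, abs_of_nonneg (freqSq_nonneg k)]
  exact freqSq_le' k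

lemma IsBoundedCurve.laplacian {c : ℝ → Modes d} (hc : IsBoundedCurve T c) :
    IsBoundedCurve T fun t k => (-freqSq k) • c t k :=
  hc.multiplier (fun k => by rw [freqSq_neg]) (C := d + 1) (by positivity) abs_neg_freqSq_le

lemma IsBoundedCurve.conv {c e : ℝ → Modes d} (hc : IsBoundedCurve T c)
    (he : IsBoundedCurve T e) : IsBoundedCurve T fun t => convMode (c t) (e t) := by
  refine ⟨fun t ht => ?_, fun t ht => (hc.mem t ht).conv (he.mem t ht)⟩
  obtain ⟨M, hM, h⟩ := hc.rapid t ht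
  obtain ⟨N, hN, h'⟩ := he.rapid t ht
  exact ⟨_, hM.convBound hN, fun s hs k =>
    norm_convMode_le hM.summable hN.summable (h s hs) (h' s hs) k⟩

/-- The product rule for `convMode`. -/
lemma ModeDeriv.conv {c c' e e' : ℝ → Modes d} (hc : IsBoundedCurve T c)
    (hc' : IsBoundedCurve T c') (he : IsBoundedCurve T e) (he' : IsBoundedCurve T e')
    (hcc : ModeDeriv T c c') (hee : ModeDeriv T e e') :
    ModeDeriv T (fun t => convMode (c t) (e t))
      fun t k => convMode (c' t) (e t) k + convMode (c t) (e' t) k := by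
  intro t ht k
  -- On the compact interval `[0, t']` with `t' > t` a single majorant is available, while
  -- differentiability at `t` is the same as within `[0, T)`.
  obtain ⟨t', ht', hlt⟩ := exists_gt_mem_timeInterval ht
  have hsub := Icc_subset_timeInterval ht'
  obtain ⟨M, hM, hMc⟩ := hc.rapid t' ht'
  obtain ⟨M', hM', hMc'⟩ := hc'.rapid t' ht'
  obtain ⟨N, hN, hNe⟩ := he.rapid t' ht'
  obtain ⟨N', hN', hNe'⟩ := he'.rapid t' ht'
  have hterm : ∀ l, ∀ s ∈ Icc 0 t', HasDerivWithinAt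
      (fun s => (Complex.I * freqDot k (c s l)) • e s (k - l))
      ((Complex.I * freqDot k (c' s l)) • e s (k - l) +
        (Complex.I * freqDot k (c s l)) • e' s (k - l)) (Icc 0 t') s := by
    intro l s hs
    have h1 := (hcc s (hsub hs) l).mono hsub
    have h2 := (hee s (hsub hs) (k - l)).mono hsub
    have h3 : HasDerivWithinAt (fun s => Complex.I * freqDot k (c s l))
        (Complex.I * freqDot k (c' s l)) (Icc 0 t') s :=
      (((freqDotCLM k).restrictScalars ℝ).hasFDerivAt.comp_hasDerivWithinAt s h1).const_mul _
    refine (h3.smul h2).congr_deriv ?_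
    rw [add_comm]
  have hbound : ∀ {a b : Modes d} {A B : (Fin d → ℤ) → ℝ}, (∀ k, ‖a k‖ ≤ A k) →
      (∀ k, ‖b k‖ ≤ B k) → ∀ l, ‖(Complex.I * freqDot k (a l)) • b (k - l)‖ ≤
        freqNorm k * (A l * B (k - l)) := fun ha hb l =>
    (norm_convTerm_le _ _ k l).trans (mul_le_mul_of_nonneg_left (mul_le_mul (ha l) (hb _)
      (norm_nonneg _) ((norm_nonneg _).trans (ha l))) (freqNorm_nonneg k))
  have hs1 := (summable_modeConv_term hM'.1 hN.1 hM'.summable hN.summable k).mul_left (freqNorm k)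
  have hs2 := (summable_modeConv_term hM.1 hN'.1 hM.summable hN'.summable k).mul_left (freqNorm k)
  have hder := hasDerivWithinAt_tsum (convex_Icc 0 t') (hs1.add hs2) hterm
    (fun l s hs => (norm_add_le _ _).trans (add_le_add (hbound (hMc' s hs) (hNe s hs) l)
      (hbound (hMc s hs) (hNe' s hs) l)))
    (fun s hs => summable_convTerm (hc.mem s (hsub hs)).summable (he.mem s (hsub hs)).summable k)
    ⟨ht.1, hlt.le⟩
  rw [HasDerivWithinAt, nhdsWithin_Icc_timeInterval ht hlt, ← HasDerivWithinAt] at hder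
  rw [(summable_convTerm (hc'.mem t ht).summable (he.mem t ht).summable k).tsum_add
    (summable_convTerm (hc.mem t ht).summable (he'.mem t ht).summable k)] at hder
  have h := (((lerayCLM k).restrictScalars ℝ).hasFDerivAt.comp_hasDerivWithinAt t hder).neg
  refine (h.congr_of_mem (fun s _ => ?_) ht).congr_deriv ?_
  · simp [convMode]
  · simp only [ContinuousLinearMap.coe_restrictScalars', map_add, lerayCLM_apply]
    rw [neg_add]
    rfl

/-- Curves with `j` derivatives, all of them curves of smooth fields with locally uniform bounds. -/
def IsDiffCurve (T : EReal) : ℕ → (ℝ → Modes d) → Prop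
  | 0, c => IsBoundedCurve T c
  | j + 1, c => IsBoundedCurve T c ∧ ∃ c', IsDiffCurve T j c' ∧ ModeDeriv T c c'

lemma IsDiffCurve.bounded {j : ℕ} {c : ℝ → Modes d} (h : IsDiffCurve T j c) :
    IsBoundedCurve T c := by
  cases j with
  | zero => exact h
  | succ j => exact h.1

lemma IsDiffCurve.of_succ {j : ℕ} {c : ℝ → Modes d} (h : IsDiffCurve T (j + 1) c) :
    IsDiffCurve T j c := by
  induction j generalizing c with
  | zero => exact h.1
  | succ j ih =>
    obtain ⟨h1, c', h2, h3⟩ := h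
    exact ⟨h1, c', ih h2, h3⟩

lemma IsDiffCurve.add {j : ℕ} {c e : ℝ → Modes d} (hc : IsDiffCurve T j c)
    (he : IsDiffCurve T j e) : IsDiffCurve T j fun t k => c t k + e t k := by
  induction j generalizing c e with
  | zero => exact IsBoundedCurve.add hc he
  | succ j ih =>
    obtain ⟨h1, c', h2, h3⟩ := hc
    obtain ⟨h1', e', h2', h3'⟩ := he
    exact ⟨h1.add h1', _, ih h2 h2', fun t ht k => (h3 t ht k).add (h3' t ht k)⟩

lemma IsDiffCurve.multiplier {j : ℕ} {c : ℝ → Modes d} (hc : IsDiffCurve T j c)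
    {μ : (Fin d → ℤ) → ℝ} (heven : ∀ k, μ (-k) = μ k) {C : ℝ} (hC : 0 ≤ C) {i : ℕ}
    (hμ : ∀ k, |μ k| ≤ C * modeWeight k ^ i) : IsDiffCurve T j fun t k => μ k • c t k := by
  induction j generalizing c with
  | zero => exact IsBoundedCurve.multiplier hc heven hC hμ
  | succ j ih =>
    obtain ⟨h1, c', h2, h3⟩ := hc
    exact ⟨h1.multiplier heven hC hμ, _, ih h2, fun t ht k => (h3 t ht k).const_smul (μ k)⟩

/-- Leibniz rule and induction: each term of the derivative pairs one differentiated factor with one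
undifferentiated factor, the latter used with one derivative fewer than it has. -/
lemma IsDiffCurve.conv {j : ℕ} {c e : ℝ → Modes d} (hc : IsDiffCurve T j c)
    (he : IsDiffCurve T j e) : IsDiffCurve T j fun t => convMode (c t) (e t) := by
  induction j generalizing c e with
  | zero => exact IsBoundedCurve.conv hc he
  | succ j ih =>
    have hc0 := hc.of_succ
    have he0 := he.of_succ
    obtain ⟨h1, c', h2, h3⟩ := hc
    obtain ⟨h1', e', h2', h3'⟩ := he
    exact ⟨h1.conv h1', _, (ih h2 he0).add (ih hc0 h2'),
      ModeDeriv.conv h1 h2.bounded h1' h2'.bounded h3 h3'⟩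

/-- The modewise derivatives of a curve. -/
def curveDeriv (T : EReal) (j : ℕ) (c : ℝ → Modes d) (t : ℝ) (k : Fin d → ℤ) :
    EuclideanSpace ℂ (Fin d) :=
  iteratedDerivWithin j (fun s => c s k) (timeInterval T) t

lemma curveDeriv_zero (c : ℝ → Modes d) : curveDeriv T 0 c = c := by
  funext t k
  rw [curveDeriv, iteratedDerivWithin_zero]

lemma curveDeriv_succ {c c' : ℝ → Modes d} (h : ModeDeriv T c c') (j : ℕ) {t : ℝ}
    (ht : t ∈ timeInterval T) : curveDeriv T (j + 1) c t = curveDeriv T j c' t := by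
  funext k
  rw [curveDeriv, curveDeriv, iteratedDerivWithin_succ']
  refine iteratedDerivWithin_congr (fun s hs => ?_) ht
  exact (h s hs k).derivWithin (uniqueDiffOn_timeInterval T s hs)

/-- The derivatives hidden in `IsDiffCurve` are existential and may vary with `j`. The iterated
modewise derivatives are canonical, so the data for all `j` fit into the single sequence required by
`IsSmoothCurve`. -/
lemma IsDiffCurve.curveDeriv {j : ℕ} {c : ℝ → Modes d} (hc : IsDiffCurve T j c) :
    (∀ i ≤ j, IsBoundedCurve T (curveDeriv T i c)) ∧
      ∀ i < j, ModeDeriv T (NSReynolds.curveDeriv T i c) (NSReynolds.curveDeriv T (i + 1) c) := by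
  induction j generalizing c with
  | zero =>
    refine ⟨fun i hi => ?_, fun i hi => absurd hi (Nat.not_lt_zero i)⟩
    rw [Nat.le_zero.mp hi, curveDeriv_zero]
    exact hc
  | succ j ih =>
    obtain ⟨h1, c', h2, h3⟩ := hc
    refine ⟨fun i hi => ?_, fun i hi => ?_⟩
    · cases i with
      | zero => rwa [curveDeriv_zero]
      | succ i =>
        exact ((ih h2).1 i (Nat.le_of_succ_le_succ hi)).congr fun t ht => curveDeriv_succ h3 i ht
    · cases i with
      | zero =>
        refine h3.congr (fun t _ => by rw [curveDeriv_zero]) fun t ht => ?_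
        rw [curveDeriv_succ h3 0 ht, curveDeriv_zero]
      | succ i =>
        exact ((ih h2).2 i (Nat.lt_of_succ_lt_succ hi)).congr
          (fun t ht => curveDeriv_succ h3 i ht) fun t ht => curveDeriv_succ h3 (i + 1) ht

/-- Modewise derivatives with locally uniform bounds are limits of difference quotients in any
summable nonnegative functional of the coefficients. -/
lemma tendsto_tsum_slope_sub {c c' : ℝ → Modes d} (hc' : IsBoundedCurve T c')
    (hcc : ModeDeriv T c c') {t : ℝ} (ht : t ∈ timeInterval T) (w : (Fin d → ℤ) → ℝ)
    (hw : ∀ k, 0 ≤ w k) (p : ℕ) (hp : p ≠ 0)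
    (hs : ∀ M : (Fin d → ℤ) → ℝ, RapidMaj M → Summable fun k => w k * M k ^ p) :
    Tendsto (fun s => ∑' k, w k * ‖(s - t)⁻¹ • (c s k - c t k) - c' t k‖ ^ p)
      (𝓝[timeInterval T \ {t}] t) (𝓝 0) := by
  obtain ⟨t', ht', hlt⟩ := exists_gt_mem_timeInterval ht
  have hsub := Icc_subset_timeInterval ht'
  obtain ⟨M', hM', hMc'⟩ := hc'.rapid t' ht'
  have h0 : (0 : ℝ) = ∑' k : Fin d → ℤ, w k * ‖(0 : EuclideanSpace ℂ (Fin d))‖ ^ p := by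
    simp [hp]
  rw [h0]
  -- Difference quotient and derivative are each bounded by `M'`, hence the dominating family `2
  -- M'`.
  refine tendsto_tsum_of_dominated_convergence
    (hs _ (hM'.const_mul (C := 2) zero_le_two)) (fun k => ?_) ?_
  · refine (((?_ : Tendsto _ _ _).norm).pow p).const_mul _
    have h := hasDerivWithinAt_iff_tendsto_slope.mp (hcc t ht k)
    simpa [slope_def_module] using h.sub_const (c' t k)
  · have hmem : ∀ᶠ s in 𝓝[timeInterval T \ {t}] t, s ∈ Icc 0 t' := by
      filter_upwards [self_mem_nhdsWithin, mem_nhdsWithin_of_mem_nhds (Iio_mem_nhds hlt)]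
        with s hs1 hs2
      exact ⟨hs1.1.1, le_of_lt hs2⟩
    filter_upwards [hmem] with s hs k
    rw [norm_mul, norm_pow, norm_norm, Real.norm_of_nonneg (hw k)]
    refine mul_le_mul_of_nonneg_left (pow_le_pow_left₀ (norm_nonneg _) ?_ p) (hw k)
    have h1 := norm_slope_le (convex_Icc 0 t')
      (fun r hr => (hcc r (hsub hr) k).mono hsub) (fun r hr => hMc' r hr k) ⟨ht.1, hlt.le⟩ hs
    rw [slope_def_module] at h1
    refine (norm_sub_le _ _).trans ?_
    rw [two_mul]
    exact add_le_add h1 (hMc' t ⟨ht.1, hlt.le⟩ k)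

/-- Modewise derivatives with locally uniform bounds are derivatives in `L²`. -/
lemma hasDerivWithinAt_field {u : ℝ → L2Field d} {c' : ℝ → Modes d} {v : L2Field d}
    (hc : IsBoundedCurve T fun t => fourierVec (u t)) (hc' : IsBoundedCurve T c')
    (hcc : ModeDeriv T (fun t => fourierVec (u t)) c') {t : ℝ} (ht : t ∈ timeInterval T)
    (hv : ∀ k, fourierVec v k = c' t k) : HasDerivWithinAt u v (timeInterval T) t := by
  rw [hasDerivWithinAt_iff_tendsto_slope, tendsto_iff_norm_sub_tendsto_zero]
  obtain ⟨C, hC, hle⟩ := norm_le_tsum_fourierVec (d := d)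
  -- Weight `1` and power `1` give convergence of the coefficients in `ℓ¹`, which controls the `L²`
  -- norm.
  have hlim := (tendsto_tsum_slope_sub hc' hcc ht (fun _ => 1) (fun _ => zero_le_one) 1 one_ne_zero
    fun M hM => by simpa using hM.summable).const_mul C
  rw [mul_zero] at hlim
  refine squeeze_zero' (Eventually.of_forall fun _ => norm_nonneg _) ?_ hlim
  filter_upwards [self_mem_nhdsWithin] with s hs
  have hk : ∀ k, fourierVec (slope u t s - v : L2Field d) k =
      (s - t)⁻¹ • (fourierVec (u s) k - fourierVec (u t) k) - c' t k := fun k => by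
    rw [slope_def_module, fourierVec_sub, fourierVec_smul, fourierVec_sub, hv]
  have hsm := (((hc.mem s hs.1).sub (hc.mem t ht)).smul (s - t)⁻¹).sub (hc'.mem t ht)
  refine (hle _ ?_).trans (le_of_eq ?_)
  · simp only [hk]
    exact hsm.summable
  · simp only [hk, one_mul, pow_one]

lemma re_inner_self (a : EuclideanSpace ℂ (Fin d)) : (inner ℂ a a).re = ‖a‖ ^ 2 := by
  rw [inner_self_eq_norm_sq_to_K]
  norm_cast

lemma sobolevInner_self (n : ℝ) (v : L2Field d) : sobolevInner n v v =
    (2 * Real.pi) ^ d * ∑' k, sobolevWeight n k * ‖fourierVec v k‖ ^ 2 := by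
  simp only [sobolevInner, re_inner_self]

/-- Modewise derivatives with locally uniform bounds are derivatives in all Sobolev norms. -/
lemma tendsto_sobolevNorm_slope_sub {U : ℝ → L2Field d} {c c' : ℝ → Modes d} {v : L2Field d}
    (hU : ∀ t ∈ timeInterval T, ∀ k, fourierVec (U t) k = c t k) (hc' : IsBoundedCurve T c')
    (hcc : ModeDeriv T c c') {t : ℝ} (ht : t ∈ timeInterval T)
    (hv : ∀ k, fourierVec v k = c' t k) (n : ℝ) :
    Tendsto (fun s => sobolevNorm n ((s - t)⁻¹ • (U s - U t) - v))
      (𝓝[timeInterval T \ {t}] t) (𝓝 0) := by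
  have hlim := ((tendsto_tsum_slope_sub hc' hcc ht (sobolevWeight n) (sobolevWeight_nonneg n) 2
    two_ne_zero fun M hM => (hM.summable_weight_mul hM n).congr fun k => by ring).const_mul
    ((2 * Real.pi) ^ d)).sqrt
  rw [mul_zero, Real.sqrt_zero] at hlim
  refine hlim.congr' ?_
  filter_upwards [self_mem_nhdsWithin] with s hs
  rw [sobolevNorm, sobolevInner_self]
  congr 2
  refine tsum_congr fun k => ?_
  rw [fourierVec_sub, fourierVec_smul, fourierVec_sub, hv, hU s hs.1, hU t ht]

end

/-! ### Equivalence of the Navier–Stokes problem with its system of modes. -/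

section

variable {d : ℕ} {T : EReal}

/-- The right-hand side of the Navier-Stokes equations in terms of Fourier coefficients. -/
def nsRhs (R : ℝ) (c : ℝ → Modes d) (t : ℝ) (k : Fin d → ℤ) : EuclideanSpace ℂ (Fin d) :=
  (-freqSq k) • c t k + R • convMode (c t) (c t) k

/-- Solutions of the Navier-Stokes equations in terms of Fourier coefficients. -/
structure IsModeSolution (R : ℝ) (c₀ : Modes d) (T : EReal) (c : ℝ → Modes d) : Prop where
  pos : 0 < T
  bounded : IsBoundedCurve T c
  init : c 0 = c₀
  ode : ModeDeriv T c (nsRhs R c)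

/-- Bootstrap in time: the right-hand side is built from `c` by multipliers and `convMode`, so it
has as many derivatives as `c`, and the equation then gives `c` one more. -/
lemma IsModeSolution.isDiffCurve {R : ℝ} {c₀ : Modes d} {c : ℝ → Modes d}
    (h : IsModeSolution R c₀ T c) (j : ℕ) : IsDiffCurve T j c := by
  induction j with
  | zero => exact h.bounded
  | succ j ih =>
    exact ⟨h.bounded, _, (ih.multiplier (fun k => by rw [freqSq_neg]) (C := d + 1) (by positivity)
      abs_neg_freqSq_le).add ((ih.conv ih).multiplier (μ := fun _ => R) (fun _ => rfl)
        (abs_nonneg R) (i := 0) (by simp)), h.ode⟩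

lemma fourierVec_nsRhs {R : ℝ} {v : L2Field d} (h : IsSmoothModes (fourierVec v))
    (k : Fin d → ℤ) : fourierVec (vecLaplacian v + R • nsBilin v v) k =
      (-freqSq k) • fourierVec v k + R • convMode (fourierVec v) (fourierVec v) k := by
  rw [fourierVec_add, fourierVec_smul, fourierVec_vecLaplacian h, fourierVec_nsBilin h h]

lemma IsModeSolution.isNSSolution {R : ℝ} {u₀ : L2Field d} {c : ℝ → Modes d}
    (h : IsModeSolution R (fourierVec u₀) T c) {u : ℝ → L2Field d}
    (hu : ∀ t ∈ timeInterval T, fourierVec (u t) = c t) : IsNSSolution R u₀ T u := by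
  have hD : ∀ j, IsBoundedCurve T (curveDeriv T j c) := fun j =>
    ((h.isDiffCurve j).curveDeriv).1 j le_rfl
  have hM : ∀ j, ModeDeriv T (curveDeriv T j c) (curveDeriv T (j + 1) c) := fun j =>
    ((h.isDiffCurve (j + 1)).curveDeriv).2 j (Nat.lt_succ_self j)
  have hU : ∀ j, ∀ t ∈ timeInterval T, ∀ k,
      fourierVec (ofFourier (curveDeriv T j c t)) k = curveDeriv T j c t k := fun j t ht k =>
    ((hD j).mem t ht).fourierVec_ofFourier k
  refine ⟨h.pos, ⟨fun j t => ofFourier (curveDeriv T j c t), fun t ht => ext_fourierVec fun k => ?_,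
    fun j t ht => ⟨?_, fun m => ?_⟩⟩, ext_fourierVec fun k => ?_, fun t ht => ?_⟩
  · rw [hU 0 t ht, curveDeriv_zero, hu t ht]
  · rw [mem_sobolevInf_iff]
    have : fourierVec (ofFourier (curveDeriv T j c t)) = curveDeriv T j c t :=
      funext fun k => hU j t ht k
    rw [this]
    exact (hD j).mem t ht
  · exact tendsto_sobolevNorm_slope_sub (hU j) (hD (j + 1)) (hM j) ht (hU (j + 1) t ht) m
  · rw [hu 0 (zero_mem_timeInterval h.pos), h.init]
  · have hbd : IsBoundedCurve T (nsRhs R c) :=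
      h.bounded.laplacian.add ((h.bounded.conv h.bounded).smul R)
    refine hasDerivWithinAt_field (h.bounded.congr hu) hbd (h.ode.congr hu fun _ _ => rfl) ht
      fun k => ?_
    have hs : IsSmoothModes (fourierVec (u t)) := by
      rw [hu t ht]
      exact h.bounded.mem t ht
    rw [fourierVec_nsRhs hs, hu t ht]
    rfl

lemma sobolevInner_self_nonneg (n : ℝ) (v : L2Field d) : 0 ≤ sobolevInner n v v := by
  rw [sobolevInner_self]
  exact mul_nonneg (pow_nonneg Real.two_pi_pos.le d)
    (tsum_nonneg fun k => mul_nonneg (sobolevWeight_nonneg n k) (sq_nonneg _))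

lemma sobolevNorm_nonneg (n : ℝ) (v : L2Field d) : 0 ≤ sobolevNorm n v := Real.sqrt_nonneg _

lemma sobolevNorm_sq (n : ℝ) (v : L2Field d) : sobolevNorm n v ^ 2 = sobolevInner n v v :=
  Real.sq_sqrt (sobolevInner_self_nonneg n v)

lemma one_le_two_pi_pow : 1 ≤ (2 * Real.pi) ^ d :=
  one_le_pow₀ (by linarith [Real.pi_gt_three])

lemma tsum_weight_le_sobolevNorm_sq (n : ℝ) (v : L2Field d) :
    ∑' k, sobolevWeight n k * ‖fourierVec v k‖ ^ 2 ≤ sobolevNorm n v ^ 2 := by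
  rw [sobolevNorm_sq, sobolevInner_self]
  exact le_mul_of_one_le_left
    (tsum_nonneg fun k => mul_nonneg (sobolevWeight_nonneg n k) (sq_nonneg _)) one_le_two_pi_pow

lemma IsSmoothModes.summable_weight_sq {c : Modes d} (h : IsSmoothModes c) (n : ℝ) :
    Summable fun k => sobolevWeight n k * ‖c k‖ ^ 2 :=
  (h.rapid.summable_weight_mul h.rapid n).congr fun k => by ring

/-- One summand is bounded by the whole norm; the factor `2^m` is the price of `1 + |k| ≤ 2|k|`, and
`(2π)^d ≥ 1` is dropped. -/
lemma weight_mul_norm_le_sobolevNorm {v : L2Field d} (h : IsSmoothModes (fourierVec v)) (m : ℕ)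
    (k : Fin d → ℤ) : modeWeight k ^ m * ‖fourierVec v k‖ ≤ 2 ^ m * sobolevNorm (m : ℝ) v := by
  by_cases hk : k = 0
  · rw [hk, h.zero, norm_zero, mul_zero]
    exact mul_nonneg (by positivity) (sobolevNorm_nonneg _ _)
  · refine le_of_sq_le_sq ?_ (mul_nonneg (by positivity) (sobolevNorm_nonneg _ _))
    have h1 := ((h.summable_weight_sq m).le_tsum k fun l _ =>
      mul_nonneg (sobolevWeight_nonneg _ l) (sq_nonneg _)).trans (tsum_weight_le_sobolevNorm_sq m v)
    rw [sobolevWeight, if_neg hk, Real.rpow_natCast] at h1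
    calc _ = (modeWeight k ^ 2) ^ m * ‖fourierVec v k‖ ^ 2 := by ring
      _ ≤ (4 * freqSq k) ^ m * ‖fourierVec v k‖ ^ 2 :=
        mul_le_mul_of_nonneg_right (pow_le_pow_left₀ (sq_nonneg _) (modeWeight_sq_le hk) m)
          (sq_nonneg _)
      _ = 4 ^ m * (freqSq k ^ m * ‖fourierVec v k‖ ^ 2) := by rw [mul_pow]; ring
      _ ≤ 4 ^ m * sobolevNorm m v ^ 2 := mul_le_mul_of_nonneg_left h1 (by positivity)
      _ = _ := by
        rw [mul_pow, ← pow_mul, mul_comm m 2, pow_mul]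
        norm_num

/-- Convergence of difference quotients in `ℍᵐ` bounds the modes near each time, and compactness of
`[0, t]` makes the bound uniform. Doing this for every `m` yields one rapidly decaying majorant. -/
lemma IsSmoothCurve.isBoundedCurve {u : ℝ → L2Field d} (h : IsSmoothCurve T u) :
    IsBoundedCurve T fun t => fourierVec (u t) := by
  obtain ⟨U, hU0, hU⟩ := h
  have hsm : ∀ j, ∀ t ∈ timeInterval T, IsSmoothModes (fourierVec (U j t)) := fun j t ht =>
    mem_sobolevInf_iff.mp (hU j t ht).1
  refine IsBoundedCurve.congr (c := fun t => fourierVec (U 0 t)) ⟨fun t ht => ?_, hsm 0⟩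
    fun t ht => by rw [hU0 t ht]
  refine unifRapid_of_forall_bound fun m => ?_
  have hsub := Icc_subset_timeInterval ht
  refine isCompact_Icc.induction_on (p := fun S => ∃ C, ∀ s ∈ S, ∀ k,
    modeWeight k ^ m * ‖fourierVec (U 0 s) k‖ ≤ C) ⟨0, fun s hs => absurd hs (notMem_empty s)⟩
    (fun S S' hSS' ⟨C, hC⟩ => ⟨C, fun s hs => hC s (hSS' hs)⟩)
    (fun S S' ⟨C, hC⟩ ⟨C', hC'⟩ => ⟨max C C', fun s hs k => ?_⟩) fun x hx => ?_
  · rcases hs with hs | hs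
    · exact (hC s hs k).trans (le_max_left _ _)
    · exact (hC' s hs k).trans (le_max_right _ _)
  · have hxT := hsub hx
    have hev := ((hU 0 x hxT).2 m).eventually (gt_mem_nhds zero_lt_one)
    have hev' : ∀ᶠ s in 𝓝[timeInterval T] x, s ≠ x →
        sobolevNorm (m : ℝ) ((s - x)⁻¹ • (U 0 s - U 0 x) - U (0 + 1) x) < 1 := by
      rw [eventually_nhdsWithin_iff] at hev ⊢
      filter_upwards [hev] with s hs hsT hsx
      exact hs ⟨hsT, hsx⟩
    obtain ⟨A, hA⟩ := (hsm 0 x hxT).rapid.exists_bound m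
    obtain ⟨B, hB⟩ := (hsm 1 x hxT).rapid.exists_bound m
    have hB0 : 0 ≤ B := le_trans (mul_nonneg (pow_nonneg (modeWeight_pos 0).le m) (norm_nonneg _))
      (hB 0)
    have ht0 : 0 ≤ t := ht.1
    -- Near `x` one has `u(s) = u(x) + (s - x)(z + u'(x))` with `‖z‖_m < 1`. Here `A` and `B` bound
    -- the weighted modes of `u(x)` and `u'(x)`, `2^m` those of `z`, and `|s - x| ≤ t`.
    refine ⟨_, inter_mem (nhdsWithin_mono x hsub hev') self_mem_nhdsWithin, A + t * (2 ^ m + B),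
      fun s hs k => ?_⟩
    have hp := pow_pos (modeWeight_pos k) m
    by_cases hsx : s = x
    · rw [hsx]
      exact (hA k).trans (le_add_of_nonneg_right (by positivity))
    · have hlt := hs.1 hsx
      set z : L2Field d := (s - x)⁻¹ • (U 0 s - U 0 x) - U (0 + 1) x with hz
      have hzk : ∀ k, fourierVec z k = (s - x)⁻¹ • (fourierVec (U 0 s) k - fourierVec (U 0 x) k) -
          fourierVec (U 1 x) k := fun k => by
        rw [hz, fourierVec_sub, fourierVec_smul, fourierVec_sub]
      have hzs : IsSmoothModes (fourierVec z) := by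
        rw [funext hzk]
        exact (((hsm 0 s (hsub hs.2)).sub (hsm 0 x hxT)).smul _).sub (hsm 1 x hxT)
      have hzb := weight_mul_norm_le_sobolevNorm hzs m k
      have hzb' : modeWeight k ^ m * ‖fourierVec z k‖ ≤ 2 ^ m :=
        hzb.trans (mul_le_of_le_one_right (by positivity) hlt.le)
      have heq : fourierVec (U 0 s) k = fourierVec (U 0 x) k +
          (s - x) • (fourierVec z k + fourierVec (U 1 x) k) := by
        rw [hzk, sub_add_cancel, smul_smul, mul_inv_cancel₀ (sub_ne_zero.mpr hsx), one_smul,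
          add_sub_cancel]
      have habs : |s - x| ≤ t := abs_le.mpr ⟨by linarith [hs.2.1, hx.2], by linarith [hs.2.2, hx.1]⟩
      have hn : ‖fourierVec (U 0 s) k‖ ≤ ‖fourierVec (U 0 x) k‖ +
          |s - x| * (‖fourierVec z k‖ + ‖fourierVec (U 1 x) k‖) := by
        rw [heq]
        refine (norm_add_le _ _).trans (add_le_add le_rfl ?_)
        rw [norm_smul, Real.norm_eq_abs]
        exact mul_le_mul_of_nonneg_left (norm_add_le _ _) (abs_nonneg _)
      calc _ ≤ modeWeight k ^ m * (‖fourierVec (U 0 x) k‖ +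
            |s - x| * (‖fourierVec z k‖ + ‖fourierVec (U 1 x) k‖)) :=
            mul_le_mul_of_nonneg_left hn hp.le
        _ = modeWeight k ^ m * ‖fourierVec (U 0 x) k‖ + |s - x| *
            (modeWeight k ^ m * ‖fourierVec z k‖ + modeWeight k ^ m * ‖fourierVec (U 1 x) k‖) := by
            ring
        _ ≤ A + t * (2 ^ m + B) :=
          add_le_add (hA k) (mul_le_mul habs (add_le_add hzb' (hB k))
            (by positivity) ht0)

lemma IsNSSolution.isModeSolution {R : ℝ} {u₀ : L2Field d} {u : ℝ → L2Field d}
    (h : IsNSSolution R u₀ T u) :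
    IsModeSolution R (fourierVec u₀) T fun t => fourierVec (u t) where
  pos := h.pos
  bounded := h.smooth.isBoundedCurve
  init := by simp only [h.init]
  ode t ht k := by
    have h1 := (fourierCLM k).hasFDerivAt.comp_hasDerivWithinAt t (h.eqn t ht)
    refine h1.congr_deriv ?_
    rw [fourierCLM_apply, fourierVec_nsRhs (h.smooth.isBoundedCurve.mem t ht)]
    rfl

end

/-! ### Local existence by a fixed point in the Wiener algebra. -/

section

variable {d : ℕ}

/-- Families of bounded continuous modes whose sup norms are summable. -/
abbrev WienerCurve (d : ℕ) : Type :=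
  lp (fun _ : Fin d → ℤ => BoundedContinuousFunction ℝ (EuclideanSpace ℂ (Fin d))) 1

/-- The value at time `t`. -/
def WienerCurve.eval (a : WienerCurve d) (t : ℝ) : Modes d := fun k => a k t

lemma WienerCurve.summable (a : WienerCurve d) : Summable fun k => ‖a k‖ := by
  simpa using (lp.memℓp a).summable (by norm_num)

lemma WienerCurve.norm_eq (a : WienerCurve d) : ‖a‖ = ∑' k, ‖a k‖ := by
  simpa using lp.norm_eq_tsum_rpow (p := 1) (by norm_num) a

lemma WienerCurve.norm_eval_le (a : WienerCurve d) (t : ℝ) (k : Fin d → ℤ) :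
    ‖a.eval t k‖ ≤ ‖a k‖ := (a k).norm_coe_le_norm t

lemma WienerCurve.summable_eval (a : WienerCurve d) (t : ℝ) : Summable fun k => ‖a.eval t k‖ :=
  a.summable.of_nonneg_of_le (fun _ => norm_nonneg _) (a.norm_eval_le t)

lemma WienerCurve.continuous_conv (a b : WienerCurve d) (k : Fin d → ℤ) :
    Continuous fun t => convMode (a.eval t) (b.eval t) k := by
  unfold convMode
  simp only [← lerayCLM_apply]
  refine ((lerayCLM k).continuous.comp (continuous_tsum (fun l => ?_)
    ((summable_modeConv_term (fun _ => norm_nonneg _) (fun _ => norm_nonneg _) a.summable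
      b.summable k).mul_left (freqNorm k)) fun l t => ?_)).neg
  · exact ((continuous_const.mul ((freqDotCLM k).continuous.comp (a l).continuous)).smul
      (b (k - l)).continuous)
  · refine (norm_convTerm_le _ _ k l).trans (mul_le_mul_of_nonneg_left ?_ (freqNorm_nonneg k))
    exact mul_le_mul (a.norm_eval_le t l) (b.norm_eval_le t _) (norm_nonneg _) (norm_nonneg _)

/-- The majorant of the convolution of two curves. -/
def WienerCurve.conv (a b : WienerCurve d) : (Fin d → ℤ) → ℝ :=
  modeConv (fun k => ‖a k‖) fun k => ‖b k‖

lemma WienerCurve.conv_nonneg (a b : WienerCurve d) (k : Fin d → ℤ) : 0 ≤ a.conv b k :=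
  modeConv_nonneg (fun _ => norm_nonneg _) (fun _ => norm_nonneg _) k

lemma WienerCurve.summable_conv (a b : WienerCurve d) : Summable (a.conv b) :=
  summable_modeConv (fun _ => norm_nonneg _) (fun _ => norm_nonneg _) a.summable b.summable

lemma WienerCurve.tsum_conv (a b : WienerCurve d) : ∑' k, a.conv b k = ‖a‖ * ‖b‖ := by
  rw [a.norm_eq, b.norm_eq]
  exact tsum_modeConv (fun _ => norm_nonneg _) (fun _ => norm_nonneg _) a.summable b.summable

lemma WienerCurve.norm_convMode_le (a b : WienerCurve d) (t : ℝ) (k : Fin d → ℤ) :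
    ‖convMode (a.eval t) (b.eval t) k‖ ≤ 2 * freqNorm k * a.conv b k :=
  NSReynolds.norm_convMode_le a.summable b.summable (a.norm_eval_le t) (b.norm_eval_le t) k

/-- The Duhamel integral of the nonlinearity. -/
def convDuhamel (a b : WienerCurve d) (k : Fin d → ℤ) (t : ℝ) : EuclideanSpace ℂ (Fin d) :=
  duhamel (freqSq k) (fun s => convMode (a.eval s) (b.eval s) k) t

lemma continuousOn_convDuhamel (a b : WienerCurve d) (k : Fin d → ℤ) :
    ContinuousOn (convDuhamel a b k) (Ici 0) := by
  rw [← timeInterval_top]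
  exact fun t ht => (hasDerivWithinAt_duhamel (a.continuous_conv b k).continuousOn
    (freqSq k) ht).continuousWithinAt

lemma convDuhamel_zero (a b : WienerCurve d) (t : ℝ) : convDuhamel a b 0 t = 0 := by
  simp [convDuhamel, duhamel, convMode_zero_freq]

lemma freqNorm_pos {k : Fin d → ℤ} (hk : k ≠ 0) : 0 < freqNorm k :=
  Real.sqrt_pos.mpr (zero_lt_one.trans_le (one_le_freqSq hk))

/-- Smoothing gains `|k|²` and the nonlinearity costs `|k|`, which leaves a net gain of one power,
without smallness in time. -/
lemma freqNorm_mul_norm_convDuhamel_le (a b : WienerCurve d) (k : Fin d → ℤ) {t : ℝ}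
    (ht : 0 ≤ t) : freqNorm k * ‖convDuhamel a b k t‖ ≤ 2 * a.conv b k := by
  by_cases hk : k = 0
  · rw [hk, convDuhamel_zero, norm_zero, mul_zero]
    exact mul_nonneg zero_le_two (a.conv_nonneg b 0)
  · have h := mul_norm_duhamel_le (freqSq_nonneg k) ht fun s _ => a.norm_convMode_le b s k
    refine le_of_mul_le_mul_left ?_ (freqNorm_pos hk)
    calc _ = freqSq k * ‖convDuhamel a b k t‖ := by rw [← freqNorm_sq]; ring
      _ ≤ _ := h
      _ = _ := by ring

/-- Geometric mean of two bounds: the smoothing bound of order `|k|⁻¹` and the trivial bound of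
order `|k| t`. The frequency cancels and the factor `√t ≤ τ` remains, which is why times are
measured as `τ²`. -/
lemma norm_convDuhamel_le (a b : WienerCurve d) (k : Fin d → ℤ) {t τ : ℝ} (ht : 0 ≤ t)
    (htτ : t ≤ τ ^ 2) (hτ : 0 ≤ τ) : ‖convDuhamel a b k t‖ ≤ 2 * τ * a.conv b k := by
  have hconv := a.conv_nonneg b k
  by_cases hk : k = 0
  · rw [hk, convDuhamel_zero, norm_zero]
    rw [hk] at hconv
    positivity
  · have h1 := freqNorm_mul_norm_convDuhamel_le a b k ht
    have h2 : ‖convDuhamel a b k t‖ ≤ 2 * freqNorm k * a.conv b k * t :=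
      norm_duhamel_le (freqSq_nonneg k) ht fun s _ => a.norm_convMode_le b s k
    have hp := freqNorm_pos hk
    refine le_of_sq_le_sq ?_ (by positivity)
    refine le_of_mul_le_mul_left ?_ hp
    calc _ = freqNorm k * ‖convDuhamel a b k t‖ * ‖convDuhamel a b k t‖ := by ring
      _ ≤ 2 * a.conv b k * (2 * freqNorm k * a.conv b k * t) :=
        mul_le_mul h1 h2 (norm_nonneg _) (by positivity)
      _ = 4 * freqNorm k * a.conv b k ^ 2 * t := by ring
      _ ≤ 4 * freqNorm k * a.conv b k ^ 2 * τ ^ 2 :=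
        mul_le_mul_of_nonneg_left htτ (by positivity)
      _ = _ := by ring

/-- Truncation of the time to `[0, τ]`. -/
def clampTime (τ t : ℝ) : ℝ := max 0 (min τ t)

lemma clampTime_nonneg (τ t : ℝ) : 0 ≤ clampTime τ t := le_max_left _ _

lemma clampTime_le {τ : ℝ} (hτ : 0 ≤ τ) (t : ℝ) : clampTime τ t ≤ τ :=
  max_le hτ (min_le_left _ _)

lemma clampTime_eq {τ t : ℝ} (h0 : 0 ≤ t) (h : t ≤ τ) : clampTime τ t = t := by
  rw [clampTime, min_eq_right h, max_eq_right h0]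

lemma continuous_clampTime (τ : ℝ) : Continuous (clampTime τ) := by
  unfold clampTime
  fun_prop

section FixedPoint

variable (R τ : ℝ) (c₀ : Modes d)

/-- The modes of the right-hand side of the integral equation. -/
def picardMode (a : WienerCurve d) (k : Fin d → ℤ) (t : ℝ) : EuclideanSpace ℂ (Fin d) :=
  Real.exp (-(clampTime (τ ^ 2) t * freqSq k)) • c₀ k +
    R • convDuhamel a a k (clampTime (τ ^ 2) t)

variable {R τ c₀}

lemma continuous_picardMode (a : WienerCurve d) (k : Fin d → ℤ) :
    Continuous (picardMode R τ c₀ a k) := by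
  have h1 : Continuous fun t => Real.exp (-(clampTime (τ ^ 2) t * freqSq k)) :=
    ((continuous_clampTime _).mul continuous_const).neg.rexp
  have h2 : Continuous fun t => convDuhamel a a k (clampTime (τ ^ 2) t) :=
    (continuousOn_convDuhamel a a k).comp_continuous (continuous_clampTime _)
      fun t => clampTime_nonneg _ t
  exact (h1.smul continuous_const).add (h2.const_smul R)

lemma norm_heat_smul_le (c : EuclideanSpace ℂ (Fin d)) (k : Fin d → ℤ) {t : ℝ} (ht : 0 ≤ t) :
    ‖Real.exp (-(t * freqSq k)) • c‖ ≤ ‖c‖ := by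
  rw [norm_smul, Real.norm_eq_abs, Real.abs_exp]
  refine mul_le_of_le_one_left (norm_nonneg _) ?_
  rw [Real.exp_le_one_iff, neg_nonpos]
  exact mul_nonneg ht (freqSq_nonneg k)

lemma norm_picardMode_le (hR : 0 ≤ R) (hτ : 0 ≤ τ) (a : WienerCurve d) (k : Fin d → ℤ) (t : ℝ) :
    ‖picardMode R τ c₀ a k t‖ ≤ ‖c₀ k‖ + R * (2 * τ * a.conv a k) := by
  refine (norm_add_le _ _).trans (add_le_add
    (norm_heat_smul_le _ k (clampTime_nonneg _ t)) ?_)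
  rw [norm_smul, Real.norm_of_nonneg hR]
  exact mul_le_mul_of_nonneg_left (norm_convDuhamel_le a a k (clampTime_nonneg _ t)
    (clampTime_le (sq_nonneg τ) t) hτ) hR

lemma summable_picardBound (hc : Summable fun k => ‖c₀ k‖) (a : WienerCurve d) :
    Summable fun k => ‖c₀ k‖ + R * (2 * τ * a.conv a k) :=
  hc.add (((a.summable_conv a).mul_left _).mul_left _)

/-- The Picard map. -/
def picardMap (hR : 0 ≤ R) (hτ : 0 ≤ τ) (hc : Summable fun k => ‖c₀ k‖) (a : WienerCurve d) :
    WienerCurve d :=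
  ⟨fun k => BoundedContinuousFunction.ofNormedAddCommGroup (picardMode R τ c₀ a k)
      (continuous_picardMode a k) _ (norm_picardMode_le hR hτ a k),
    memℓp_gen (by
      simp only [ENNReal.toReal_one, Real.rpow_one]
      exact (summable_picardBound hc a).of_nonneg_of_le (fun _ => norm_nonneg _) fun k =>
        BoundedContinuousFunction.norm_ofNormedAddCommGroup_le _
          ((norm_nonneg _).trans (norm_picardMode_le (c₀ := c₀) hR hτ a k 0)) _)⟩

lemma picardMap_eval (hR : 0 ≤ R) (hτ : 0 ≤ τ) (hc : Summable fun k => ‖c₀ k‖)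
    (a : WienerCurve d) (t : ℝ) (k : Fin d → ℤ) :
    (picardMap hR hτ hc a).eval t k = picardMode R τ c₀ a k t := rfl

lemma norm_picardMap_apply_le (hR : 0 ≤ R) (hτ : 0 ≤ τ) (hc : Summable fun k => ‖c₀ k‖)
    (a : WienerCurve d) (k : Fin d → ℤ) :
    ‖picardMap hR hτ hc a k‖ ≤ ‖c₀ k‖ + R * (2 * τ * a.conv a k) :=
  (BoundedContinuousFunction.norm_le
    ((norm_nonneg _).trans (norm_picardMode_le (c₀ := c₀) hR hτ a k 0))).mpr
    (norm_picardMode_le hR hτ a k)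

lemma norm_picardMap_le (hR : 0 ≤ R) (hτ : 0 ≤ τ) (hc : Summable fun k => ‖c₀ k‖)
    (a : WienerCurve d) :
    ‖picardMap hR hτ hc a‖ ≤ ∑' k, ‖c₀ k‖ + 2 * R * τ * ‖a‖ ^ 2 := by
  rw [WienerCurve.norm_eq]
  refine ((WienerCurve.summable _).tsum_le_tsum (norm_picardMap_apply_le hR hτ hc a)
    (summable_picardBound hc a)).trans (le_of_eq ?_)
  rw [hc.tsum_add (((a.summable_conv a).mul_left _).mul_left _), tsum_mul_left, tsum_mul_left,
    a.tsum_conv]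
  ring

lemma eval_sub (a b : WienerCurve d) (t : ℝ) :
    (a - b).eval t = fun k => a.eval t k - b.eval t k := rfl

/-- Splits the difference of the quadratic terms into two bilinear ones containing `a - b`, as the
contraction estimate requires. -/
lemma convMode_self_sub (a b : WienerCurve d) (t : ℝ) (k : Fin d → ℤ) :
    convMode (a.eval t) (a.eval t) k - convMode (b.eval t) (b.eval t) k =
      convMode ((a - b).eval t) (a.eval t) k + convMode (b.eval t) ((a - b).eval t) k := by
  have h1 := convMode_add_left ((a - b).summable_eval t) (b.summable_eval t) (a.summable_eval t) k
  have h2 := convMode_add_right (b.summable_eval t) ((a - b).summable_eval t) (b.summable_eval t) k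
  simp only [eval_sub, sub_add_cancel] at h1 h2 ⊢
  rw [h1, h2]
  abel

lemma intervalIntegrable_duhamel {F : Type*} [NormedAddCommGroup F] [NormedSpace ℝ F] {g : ℝ → F}
    {t : ℝ} (hg : ContinuousOn g (uIcc 0 t)) (lam : ℝ) :
    IntervalIntegrable (fun s => Real.exp (-((t - s) * lam)) • g s) volume 0 t :=
  (ContinuousOn.smul (by fun_prop) hg).intervalIntegrable

lemma convDuhamel_self_sub (a b : WienerCurve d) (k : Fin d → ℤ) (t : ℝ) :
    convDuhamel a a k t - convDuhamel b b k t =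
      convDuhamel (a - b) a k t + convDuhamel b (a - b) k t := by
  unfold convDuhamel duhamel
  rw [← intervalIntegral.integral_sub, ← intervalIntegral.integral_add]
  · simp only [← smul_sub, ← smul_add, convMode_self_sub]
  all_goals exact intervalIntegrable_duhamel (WienerCurve.continuous_conv _ _ k).continuousOn _

lemma norm_picardMap_sub_le (hR : 0 ≤ R) (hτ : 0 ≤ τ) (hc : Summable fun k => ‖c₀ k‖)
    (a b : WienerCurve d) : ‖picardMap hR hτ hc a - picardMap hR hτ hc b‖ ≤
      2 * R * τ * (‖a‖ + ‖b‖) * ‖a - b‖ := by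
  have hs1 := (a - b).summable_conv a
  have hs2 := b.summable_conv (a - b)
  have hle : ∀ k, ‖(picardMap hR hτ hc a - picardMap hR hτ hc b) k‖ ≤
      2 * R * τ * ((a - b).conv a k + b.conv (a - b) k) := by
    intro k
    have h0 : 0 ≤ (a - b).conv a k + b.conv (a - b) k :=
      add_nonneg ((a - b).conv_nonneg a k) (b.conv_nonneg (a - b) k)
    refine (BoundedContinuousFunction.norm_le (by positivity)).mpr fun t => ?_
    change ‖picardMode R τ c₀ a k t - picardMode R τ c₀ b k t‖ ≤ _
    rw [picardMode, picardMode, add_sub_add_left_eq_sub, ← smul_sub, convDuhamel_self_sub,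
      norm_smul, Real.norm_of_nonneg hR]
    have hn := fun x y : WienerCurve d => norm_convDuhamel_le x y k
      (clampTime_nonneg (τ ^ 2) t) (clampTime_le (sq_nonneg τ) t) hτ
    calc _ ≤ R * (2 * τ * (a - b).conv a k + 2 * τ * b.conv (a - b) k) :=
          mul_le_mul_of_nonneg_left ((norm_add_le _ _).trans (add_le_add (hn _ _) (hn _ _))) hR
      _ = _ := by ring
  rw [WienerCurve.norm_eq]
  refine ((WienerCurve.summable _).tsum_le_tsum hle ((hs1.add hs2).mul_left _)).trans (le_of_eq ?_)
  rw [tsum_mul_left, hs1.tsum_add hs2, WienerCurve.tsum_conv, WienerCurve.tsum_conv]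
  ring

/-- Real divergence free zero mean curves in a ball. -/
def wienerBall (d : ℕ) (B : ℝ) : Set (WienerCurve d) :=
  {a | ‖a‖ ≤ B ∧ ∀ t k, a.eval t (-k) = conjVec (a.eval t k) ∧ freqDot k (a.eval t k) = 0 ∧
    a.eval t 0 = 0}

lemma continuous_eval (t : ℝ) (k : Fin d → ℤ) : Continuous fun a : WienerCurve d => a.eval t k := by
  refine LipschitzWith.continuous (K := 1) (LipschitzWith.of_dist_le_mul fun a b => ?_)
  rw [NNReal.coe_one, one_mul, dist_eq_norm, dist_eq_norm]
  refine ((a - b).norm_eval_le t k).trans ?_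
  rw [WienerCurve.norm_eq]
  exact (a - b).summable.le_tsum k fun _ _ => norm_nonneg _

/-- Reality, incompressibility and zero mean are closed conditions on the modes. Running the
contraction inside this complete set lets the fixed point inherit them. -/
lemma isClosed_wienerBall (B : ℝ) : IsClosed (wienerBall d B) := by
  have : wienerBall d B = {a | ‖a‖ ≤ B} ∩ ⋂ (t : ℝ) (k : Fin d → ℤ),
      ({a | a.eval t (-k) = conjCLM (a.eval t k)} ∩ ({a | freqDotCLM k (a.eval t k) = 0} ∩
        {a | a.eval t 0 = 0})) := by
    ext a
    simp [wienerBall]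
  rw [this]
  refine (isClosed_le continuous_norm continuous_const).inter (isClosed_iInter fun t =>
    isClosed_iInter fun k => ?_)
  exact (isClosed_eq (continuous_eval t _) (conjCLM.continuous.comp (continuous_eval t k))).inter
    ((isClosed_eq ((freqDotCLM k).continuous.comp (continuous_eval t k)) continuous_const).inter
      (isClosed_eq (continuous_eval t 0) continuous_const))

lemma zero_mem_wienerBall {B : ℝ} (hB : 0 ≤ B) : (0 : WienerCurve d) ∈ wienerBall d B := by
  refine ⟨by simpa using hB, fun t k => ?_⟩
  have h0 : ∀ k, (0 : WienerCurve d).eval t k = 0 := fun _ => rfl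
  simp only [h0, ← conjCLM_apply, map_zero, freqDot_zero, and_self]

lemma duhamel_map {F G : Type*} [NormedAddCommGroup F] [NormedSpace ℝ F] [CompleteSpace F]
    [NormedAddCommGroup G] [NormedSpace ℝ G] [CompleteSpace G] (L : F →L[ℝ] G) {g : ℝ → F}
    {t : ℝ} (hg : ContinuousOn g (uIcc 0 t)) (lam : ℝ) :
    L (duhamel lam g t) = duhamel lam (fun s => L (g s)) t := by
  unfold duhamel
  rw [← L.intervalIntegral_comp_comm (intervalIntegrable_duhamel hg lam)]
  simp only [map_smul]

lemma mapsTo_picardMap (hR : 0 ≤ R) (hτ : 0 ≤ τ) (hc : IsSmoothModes c₀) {B : ℝ}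
    (hB : ∑' k, ‖c₀ k‖ + 2 * R * τ * B ^ 2 ≤ B) :
    MapsTo (picardMap hR hτ hc.summable) (wienerBall d B) (wienerBall d B) := by
  intro a ha
  refine ⟨(norm_picardMap_le hR hτ hc.summable a).trans (le_trans (add_le_add le_rfl ?_) hB),
    fun t k => ⟨?_, ?_, ?_⟩⟩
  · exact mul_le_mul_of_nonneg_left (pow_le_pow_left₀ (norm_nonneg _) ha.1 2) (by positivity)
  · rw [picardMap_eval, picardMap_eval, picardMode, picardMode, hc.conj, freqSq_neg,
      ← conjCLM_apply, ← conjCLM_apply, map_add, map_smul, map_smul]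
    congr 2
    rw [convDuhamel, convDuhamel, duhamel_map conjCLM (a.continuous_conv a k).continuousOn, freqSq_neg]
    congr 1
    funext s
    rw [conjCLM_apply]
    exact convMode_conj (a.summable_eval s) (a.summable_eval s) (fun k => (ha.2 s k).1)
      (fun k => (ha.2 s k).1) k
  · rw [picardMap_eval, picardMode, freqDot_add, freqDot_real_smul, freqDot_real_smul, hc.div,
      smul_zero, zero_add]
    have h := duhamel_map ((freqDotCLM k).restrictScalars ℝ)
      (t := clampTime (τ ^ 2) t) (a.continuous_conv a k).continuousOn (freqSq k)
    simp only [ContinuousLinearMap.coe_restrictScalars', freqDotCLM_apply, freqDot_convMode] at h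
    rw [convDuhamel, h]
    simp [duhamel]
  · rw [picardMap_eval, picardMode, hc.zero, convDuhamel_zero, smul_zero, smul_zero, add_zero]

/-- Fixed points of the Picard map. -/
lemma exists_picard_fixedPoint (hR : 0 ≤ R) (hτ : 0 ≤ τ) (hc : IsSmoothModes c₀) {B : ℝ}
    (hB0 : 0 ≤ B) (hB : ∑' k, ‖c₀ k‖ + 2 * R * τ * B ^ 2 ≤ B) (hB' : 4 * R * τ * B ≤ 1 / 2) :
    ∃ a ∈ wienerBall d B, picardMap hR hτ hc.summable a = a := by
  have hmaps := mapsTo_picardMap hR hτ hc hB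
  -- On the ball the Lipschitz constant `2Rτ(‖a‖ + ‖b‖)` is at most `4RτB`.
  have hcontr : ContractingWith (1 / 2 : NNReal)
      (hmaps.restrict (picardMap hR hτ hc.summable) _ _) := by
    refine ⟨by rw [← NNReal.coe_lt_coe]; norm_num, LipschitzWith.of_dist_le_mul fun a b => ?_⟩
    rw [Subtype.dist_eq, Subtype.dist_eq, dist_eq_norm, dist_eq_norm]
    refine (norm_picardMap_sub_le hR hτ hc.summable a.1 b.1).trans
      (mul_le_mul_of_nonneg_right ?_ (norm_nonneg _))
    calc _ ≤ 2 * R * τ * (B + B) :=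
          mul_le_mul_of_nonneg_left (add_le_add a.2.1 b.2.1) (by positivity)
      _ = 4 * R * τ * B := by ring
      _ ≤ _ := by simpa using hB'
  obtain ⟨a, ha, hfix, -⟩ := hcontr.exists_fixedPoint' (isClosed_wienerBall B).isComplete hmaps
    (zero_mem_wienerBall hB0) (edist_ne_top _ _)
  exact ⟨a, ha, hfix⟩

/-- Fixed points of the Picard map decay rapidly. -/
lemma rapidMaj_of_picard (hR : 0 ≤ R) (hτ : 0 ≤ τ) (hc : IsSmoothModes c₀) {a : WienerCurve d}
    (ha : picardMap hR hτ hc.summable a = a) : RapidMaj fun k => ‖a k‖ := by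
  -- The fixed point equation gains one power of the weight: `1 + |k|_∞ ≤ 2|k|` for `k ≠ 0`,
  -- combined with the net gain of the Duhamel term, gives the constant `4`.
  have hstep : ∀ k, modeWeight k * ‖a k‖ ≤ modeWeight k * ‖c₀ k‖ + 4 * R * a.conv a k := by
    intro k
    have hconv := a.conv_nonneg a k
    have hw := modeWeight_pos k
    rw [← le_div_iff₀' hw]
    refine (BoundedContinuousFunction.norm_le (by positivity)).mpr fun t => ?_
    rw [le_div_iff₀' hw]
    have h1 : a k t = picardMode R τ c₀ a k t := by
      conv_lhs => rw [← ha]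
      rfl
    rw [h1]
    have h2 : modeWeight k * ‖convDuhamel a a k (clampTime (τ ^ 2) t)‖ ≤ 4 * a.conv a k := by
      by_cases hk : k = 0
      · rw [hk, convDuhamel_zero, norm_zero, mul_zero]
        rw [hk] at hconv
        positivity
      · have h3 := freqNorm_mul_norm_convDuhamel_le a a k (clampTime_nonneg (τ ^ 2) t)
        have h4 : modeWeight k ≤ 2 * freqNorm k := by
          refine le_of_sq_le_sq ?_ (mul_nonneg zero_le_two (freqNorm_nonneg k))
          rw [mul_pow, freqNorm_sq]
          refine (modeWeight_sq_le hk).trans (le_of_eq (by norm_num))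
        calc _ ≤ 2 * freqNorm k * ‖convDuhamel a a k (clampTime (τ ^ 2) t)‖ :=
              mul_le_mul_of_nonneg_right h4 (norm_nonneg _)
          _ = 2 * (freqNorm k * ‖convDuhamel a a k (clampTime (τ ^ 2) t)‖) := by ring
          _ ≤ 2 * (2 * a.conv a k) := mul_le_mul_of_nonneg_left h3 zero_le_two
          _ = _ := by ring
    calc _ ≤ modeWeight k * (‖c₀ k‖ + R * ‖convDuhamel a a k (clampTime (τ ^ 2) t)‖) := by
          refine mul_le_mul_of_nonneg_left ((norm_add_le _ _).trans (add_le_add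
            (norm_heat_smul_le _ k (clampTime_nonneg _ t)) ?_)) hw.le
          rw [norm_smul, Real.norm_of_nonneg hR]
      _ = modeWeight k * ‖c₀ k‖ + R * (modeWeight k *
            ‖convDuhamel a a k (clampTime (τ ^ 2) t)‖) := by ring
      _ ≤ modeWeight k * ‖c₀ k‖ + R * (4 * a.conv a k) :=
          add_le_add le_rfl (mul_le_mul_of_nonneg_left h2 hR)
      _ = _ := by ring
  refine ⟨fun _ => norm_nonneg _, fun m => ?_⟩
  induction m with
  | zero => simpa using a.summable
  | succ m ih =>
    have hw : ∀ k : Fin d → ℤ, 0 ≤ modeWeight k ^ m := fun k => pow_nonneg (modeWeight_pos k).le m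
    -- Convolution preserves summability with weight `m`, and `hstep` lifts it to weight `m + 1`.
    have hs := summable_weight_modeConv (fun k => norm_nonneg (a k)) (fun k => norm_nonneg (a k))
      m ih ih
    refine ((hc.rapid.2 (m + 1)).add (hs.mul_left (4 * R))).of_nonneg_of_le
      (fun k => mul_nonneg (pow_nonneg (modeWeight_pos k).le _) (norm_nonneg _)) fun k => ?_
    calc _ = modeWeight k ^ m * (modeWeight k * ‖a k‖) := by ring
      _ ≤ modeWeight k ^ m * (modeWeight k * ‖c₀ k‖ + 4 * R * a.conv a k) :=
        mul_le_mul_of_nonneg_left (hstep k) (hw k)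
      _ = modeWeight k ^ (m + 1) * ‖c₀ k‖ + 4 * R * (modeWeight k ^ m * a.conv a k) := by ring

end FixedPoint

lemma hasDerivWithinAt_heat {S : Set ℝ} (c : EuclideanSpace ℂ (Fin d)) (lam t : ℝ) :
    HasDerivWithinAt (fun t => Real.exp (-(t * lam)) • c)
      ((-lam) • Real.exp (-(t * lam)) • c) S t := by
  have h := (((hasDerivAt_id t).mul_const lam).neg.exp.smul_const c).hasDerivWithinAt (s := S)
  refine h.congr_deriv ?_
  rw [smul_smul]
  congr 1
  simp [mul_comm]

/-- Local existence, on a time interval which only depends on the sum of the Fourier coefficients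
of the initial datum. -/
lemma exists_local_solution {R : ℝ} (hR : 0 < R) {A : ℝ} (hA : 0 ≤ A) :
    ∃ τ : ℝ, 0 < τ ∧ ∀ c₀ : Modes d, IsSmoothModes c₀ → ∑' k, ‖c₀ k‖ ≤ A →
      ∃ c, IsModeSolution R c₀ (τ : EReal) c := by
  -- The `+ 1` keeps `B` positive when `A = 0`. With `8RτB = 1` the contraction factor is `1/2`, and
  -- `A + 2RτB² = A + B/4 ≤ B`.
  obtain ⟨B, hB⟩ : ∃ B, B = 2 * (A + 1) := ⟨_, rfl⟩
  have hB0 : 0 < B := by linarith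
  obtain ⟨τ, hτ⟩ : ∃ τ, τ = 1 / (8 * R * B) := ⟨_, rfl⟩
  have hτ0 : 0 < τ := by rw [hτ]; positivity
  have hτB : 8 * R * τ * B = 1 := by
    rw [hτ]
    field_simp
  -- The lifespan is `τ²`, since `τ` stands for the square root of time in the Duhamel bound.
  refine ⟨τ ^ 2, by positivity, fun c₀ hc hcA => ?_⟩
  obtain ⟨a, haB, ha⟩ := exists_picard_fixedPoint hR.le hτ0.le hc hB0.le
    (by nlinarith) (by linarith)
  have hrapid := rapidMaj_of_picard hR.le hτ0.le hc ha
  have heq : ∀ t, 0 ≤ t → t ≤ τ ^ 2 → ∀ k, a.eval t k =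
      Real.exp (-(t * freqSq k)) • c₀ k + R • convDuhamel a a k t := by
    intro t h0 h1 k
    conv_lhs => rw [← ha]
    rw [picardMap_eval, picardMode, clampTime_eq h0 h1]
  have hle : ∀ t ∈ timeInterval ((τ ^ 2 : ℝ) : EReal), t ≤ τ ^ 2 := fun t ht =>
    (EReal.coe_lt_coe_iff.mp ht.2).le
  refine ⟨a.eval, by exact_mod_cast (by positivity : 0 < τ ^ 2), ⟨fun t _ =>
    ⟨_, hrapid, fun s _ k => a.norm_eval_le s k⟩, fun t _ => ⟨rapid_of_le hrapid
      (a.norm_eval_le t), fun k => (haB.2 t k).1, fun k => (haB.2 t k).2.1, (haB.2 t 0).2.2⟩⟩,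
    ?_, fun t ht k => ?_⟩
  · funext k
    rw [heq 0 le_rfl (sq_nonneg τ)]
    simp [convDuhamel, duhamel]
  · have h1 := hasDerivWithinAt_heat (S := timeInterval ((τ ^ 2 : ℝ) : EReal)) (c₀ k) (freqSq k) t
    have h2 := (hasDerivWithinAt_duhamel (a.continuous_conv a k).continuousOn
      (freqSq k) ht).const_smul R
    refine ((h1.add h2).congr_of_mem (fun s hs => heq s hs.1 (hle s hs) k) ht).congr_deriv ?_
    rw [nsRhs, heq t ht.1 (hle t ht), convDuhamel]
    simp only [smul_add, smul_comm R (-freqSq k)]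
    abel

end

/-! ### Regularity and residual of the Reynolds expansion. -/

section

variable {d : ℕ} {T : EReal}

/-- Curves of fields with modewise continuous, uniformly rapidly decaying coefficients are
continuous in `L²`. -/
lemma continuousOn_field {u : ℝ → L2Field d} {S : Set ℝ}
    (hu : UnifRapid S fun s => fourierVec (u s))
    (hc : ∀ k, ContinuousOn (fun s => fourierVec (u s) k) S) : ContinuousOn u S := by
  obtain ⟨M, hM, hMu⟩ := hu
  obtain ⟨C, hC, hle⟩ := norm_le_tsum_fourierVec (d := d)
  have hsum : ∀ s ∈ S, Summable fun k => ‖fourierVec (u s) k‖ := fun s hs =>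
    (rapid_of_le hM (hMu s hs)).summable
  intro t ht
  rw [ContinuousWithinAt, tendsto_iff_norm_sub_tendsto_zero]
  have h0 : (0 : ℝ) = C * ∑' _ : Fin d → ℤ, ‖(0 : EuclideanSpace ℂ (Fin d))‖ := by simp
  have hlim : Tendsto (fun s => C * ∑' k, ‖fourierVec (u s) k - fourierVec (u t) k‖)
      (𝓝[S] t) (𝓝 0) := by
    rw [h0]
    refine (tendsto_tsum_of_dominated_convergence (hM.const_mul (C := 2) zero_le_two).summable
      (fun k => ?_) ?_).const_mul C
    · have h := ((hc k) t ht).tendsto.sub_const (fourierVec (u t) k)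
      rw [sub_self] at h
      exact h.norm
    · filter_upwards [self_mem_nhdsWithin] with s hs k
      rw [norm_norm]
      exact (norm_sub_le _ _).trans ((add_le_add (hMu s hs k) (hMu t ht k)).trans_eq
        (two_mul _).symm)
  refine squeeze_zero' (Eventually.of_forall fun _ => norm_nonneg _) ?_ hlim
  filter_upwards [self_mem_nhdsWithin] with s hs
  refine (hle _ ?_).trans (le_of_eq ?_)
  · simp only [fourierVec_sub]
    exact ((hsum s hs).add (hsum t ht)).of_nonneg_of_le (fun _ => norm_nonneg _)
      fun _ => norm_sub_le _ _
  · simp only [fourierVec_sub]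

lemma isSmoothModes_zero : IsSmoothModes fun _ : Fin d → ℤ => (0 : EuclideanSpace ℂ (Fin d)) where
  rapid := by simpa using rapidMaj_zero
  conj k := by rw [← conjCLM_apply, map_zero]
  div k := freqDot_zero k
  zero := rfl

lemma isDiffCurve_zero (j : ℕ) : IsDiffCurve T j fun _ (_ : Fin d → ℤ) => 0 := by
  have h0 : IsBoundedCurve T fun _ (_ : Fin d → ℤ) => (0 : EuclideanSpace ℂ (Fin d)) :=
    ⟨fun _ _ => ⟨_, rapidMaj_zero, fun _ _ _ => by simp⟩, fun _ _ => isSmoothModes_zero⟩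
  induction j with
  | zero => exact h0
  | succ j ih => exact ⟨h0, _, ih, fun t _ _ => hasDerivWithinAt_const t _ _⟩

lemma IsDiffCurve.sum {ι : Type*} {j : ℕ} (s : Finset ι) {c : ι → ℝ → Modes d}
    (h : ∀ i ∈ s, IsDiffCurve T j (c i)) : IsDiffCurve T j fun t k => ∑ i ∈ s, c i t k := by
  classical
  induction s using Finset.induction_on with
  | empty => simpa using isDiffCurve_zero j
  | insert i s hi ih =>
    simp only [Finset.sum_insert hi]
    exact (h i (Finset.mem_insert_self i s)).add
      (ih fun l hl => h l (Finset.mem_insert_of_mem hl))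

lemma IsDiffCurve.smul {j : ℕ} {c : ℝ → Modes d} (hc : IsDiffCurve T j c) (r : ℝ) :
    IsDiffCurve T j fun t k => r • c t k :=
  hc.multiplier (μ := fun _ => r) (fun _ => rfl) (abs_nonneg r) (i := 0) (by simp)

lemma IsBoundedCurve.congr_diff {c e : ℝ → Modes d} {j : ℕ} (h : IsDiffCurve T j c)
    (hce : ∀ t ∈ timeInterval T, e t = c t) : IsDiffCurve T j e := by
  cases j with
  | zero => exact IsBoundedCurve.congr h hce
  | succ j =>
    obtain ⟨h1, c', h2, h3⟩ := h
    exact ⟨h1.congr hce, c', h2, h3.congr hce fun _ _ => rfl⟩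

lemma IsDiffCurve.continuousOn {j : ℕ} {c : ℝ → Modes d} (h : IsDiffCurve T (j + 1) c)
    (k : Fin d → ℤ) : ContinuousOn (fun s => c s k) (timeInterval T) := by
  obtain ⟨-, c', -, h'⟩ := h
  exact h'.continuousOn k

/-- Duhamel integrals of differentiable curves are differentiable. -/
lemma IsDiffCurve.duhamel {b : ℝ → Modes d} (hb : IsDiffCurve T 1 b) :
    IsDiffCurve T 1 fun t k => NSReynolds.duhamel (freqSq k) (fun s => b s k) t := by
  have hbd := hb.bounded
  have hcont := hb.continuousOn
  have hbound : IsBoundedCurve T fun t k =>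
      NSReynolds.duhamel (freqSq k) (fun s => b s k) t := by
    have hr : ∀ t ∈ timeInterval T, UnifRapid (Icc 0 t) fun t k =>
        NSReynolds.duhamel (freqSq k) (fun s => b s k) t := by
      intro t ht
      obtain ⟨M, hM, hMb⟩ := hbd.rapid t ht
      refine ⟨_, hM.const_mul ht.1, fun s hs k => ?_⟩
      refine (norm_duhamel_le (freqSq_nonneg k) hs.1 fun r hr =>
        hMb r ⟨hr.1, hr.2.trans hs.2⟩ k).trans ?_
      rw [mul_comm]
      exact mul_le_mul_of_nonneg_right hs.2 (hM.1 k)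
    refine ⟨hr, fun t ht => ?_⟩
    have hmem : ∀ s ∈ uIcc 0 t, s ∈ timeInterval T := fun s hs => by
      rw [uIcc_of_le ht.1] at hs
      exact Icc_subset_timeInterval ht hs
    obtain ⟨M, hM, hMb⟩ := hr t ht
    have hct : ∀ k, ContinuousOn (fun s => b s k) (uIcc 0 t) := fun k => (hcont k).mono hmem
    refine ⟨rapid_of_le hM (hMb t ⟨ht.1, le_rfl⟩), fun k => ?_, fun k => ?_, ?_⟩
    · rw [← conjCLM_apply, duhamel_map conjCLM (hct k), freqSq_neg]
      refine intervalIntegral.integral_congr fun s hs => ?_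
      simp only [conjCLM_apply]
      rw [(hbd.mem s (hmem s hs)).conj]
    · have h := duhamel_map ((freqDotCLM k).restrictScalars ℝ) (hct k) (freqSq k)
      simp only [ContinuousLinearMap.coe_restrictScalars', freqDotCLM_apply] at h
      rw [h]
      refine (intervalIntegral.integral_congr (g := fun _ => 0) fun s hs => ?_).trans
        intervalIntegral.integral_zero
      simp only [(hbd.mem s (hmem s hs)).div, smul_zero]
    · refine (intervalIntegral.integral_congr (g := fun _ => 0) fun s hs => ?_).trans
        intervalIntegral.integral_zero
      simp only [(hbd.mem s (hmem s hs)).zero, smul_zero]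
  exact ⟨hbound, _, hbound.laplacian.add hbd, fun t ht k =>
    hasDerivWithinAt_duhamel (hcont k) (freqSq k) ht⟩

lemma IsSmoothModes.isDiffCurve_heat {c : Modes d} (hc : IsSmoothModes c) :
    IsDiffCurve T 1 fun t k => Real.exp (-(t * freqSq k)) • c k := by
  have hb : IsBoundedCurve T fun t k => Real.exp (-(t * freqSq k)) • c k :=
    ⟨fun t ht => ⟨_, hc.rapid, fun s hs k => norm_heat_smul_le _ k hs.1⟩,
      fun t ht => hc.heat ht.1⟩
  exact ⟨hb, _, hb.laplacian, fun t _ k => hasDerivWithinAt_heat (c k) (freqSq k) t⟩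

/-- A Fourier coefficient is a continuous linear map and commutes with the Bochner integral once the
integrand is integrable. This holds because the integrand is continuous in `L²` on `[0, t]`, where
the heat flow runs forward and does not enlarge the modes. -/
lemma fourierVec_integral_heat {v w : ℝ → L2Field d}
    (hv : IsDiffCurve ⊤ 1 fun t => fourierVec (v t))
    (hw : IsDiffCurve ⊤ 1 fun t => fourierVec (w t)) {t : ℝ} (ht : 0 ≤ t) (k : Fin d → ℤ) :
    fourierVec (∫ s in (0 : ℝ)..t, heat (t - s) (nsBilin (v s) (w s)) : L2Field d) k =
      duhamel (freqSq k) (fun s => convMode (fourierVec (v s)) (fourierVec (w s)) k) t := by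
  have hmem : ∀ s, 0 ≤ s → s ∈ timeInterval ⊤ := fun s hs => by rwa [timeInterval_top]
  have hb := hv.conv hw
  have hP : ∀ s, 0 ≤ s → fourierVec (nsBilin (v s) (w s)) =
      convMode (fourierVec (v s)) (fourierVec (w s)) := fun s hs => funext fun k =>
    fourierVec_nsBilin (hv.bounded.mem s (hmem s hs)) (hw.bounded.mem s (hmem s hs)) k
  have hH : ∀ s ∈ Icc 0 t, fourierVec (heat (t - s) (nsBilin (v s) (w s))) =
      fun k => Real.exp (-((t - s) * freqSq k)) •
        convMode (fourierVec (v s)) (fourierVec (w s)) k := fun s hs => funext fun k => by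
    rw [fourierVec_heat _ (sub_nonneg.mpr hs.2), hP s hs.1]
    rw [hP s hs.1]
    exact hb.bounded.mem s (hmem s hs.1)
  have hcont : ContinuousOn (fun s => heat (t - s) (nsBilin (v s) (w s))) (Icc 0 t) := by
    refine continuousOn_field ?_ fun k => ?_
    · obtain ⟨M, hM, hMb⟩ := hb.bounded.rapid t (hmem t ht)
      refine ⟨M, hM, fun s hs k => ?_⟩
      simp only [hH s hs]
      exact (norm_heat_smul_le _ k (sub_nonneg.mpr hs.2)).trans (hMb s hs k)
    · refine ContinuousOn.congr (f := fun s => Real.exp (-((t - s) * freqSq k)) •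
        convMode (fourierVec (v s)) (fourierVec (w s)) k) ?_ fun s hs => by rw [hH s hs]
      exact ContinuousOn.smul (f := fun s => Real.exp (-((t - s) * freqSq k))) (by fun_prop)
        ((hb.continuousOn k).mono (Icc_subset_timeInterval (hmem t ht)))
  rw [← uIcc_of_le ht] at hcont
  rw [← fourierCLM_apply, ← (fourierCLM k).intervalIntegral_comp_comm hcont.intervalIntegrable]
  refine intervalIntegral.integral_congr fun s hs => ?_
  rw [uIcc_of_le ht] at hs
  simp only [fourierCLM_apply, hH s hs]

/-- Strong induction: `u_{j+1}` is a sum of Duhamel integrals of products of earlier coefficients,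
and both operations preserve one derivative. -/
lemma isDiffCurve_reynoldsCoeff {u₀ : L2Field d} (hu : u₀ ∈ sobolevInf d) (j : ℕ) :
    IsDiffCurve ⊤ 1 fun t => fourierVec (reynoldsCoeff u₀ j t) := by
  have hs := mem_sobolevInf_iff.mp hu
  induction j using Nat.strong_induction_on with
  | _ j ih =>
    cases j with
    | zero =>
      refine IsBoundedCurve.congr_diff hs.isDiffCurve_heat fun t ht => funext fun k => ?_
      rw [reynoldsCoeff]
      exact fourierVec_heat hs ht.1 k
    | succ j =>
      have h1 : ∀ l : Fin (j + 1), IsDiffCurve ⊤ 1 fun t => fourierVec (reynoldsCoeff u₀ l t) :=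
        fun l => ih l l.2
      have h2 : ∀ l : Fin (j + 1), IsDiffCurve ⊤ 1 fun t =>
          fourierVec (reynoldsCoeff u₀ (j - l) t) := fun l => ih (j - l) (by omega)
      refine IsBoundedCurve.congr_diff (IsDiffCurve.sum (Finset.univ : Finset (Fin (j + 1)))
        fun l _ => ((h1 l).conv (h2 l)).duhamel) fun t ht => funext fun k => ?_
      rw [reynoldsCoeff, ← fourierCLM_apply, map_sum]
      refine Finset.sum_congr rfl fun l _ => ?_
      rw [fourierCLM_apply, fourierVec_integral_heat (h1 l) (h2 l) ht.1]

lemma isDiffCurve_reynoldsExpansion {u₀ : L2Field d} (hu : u₀ ∈ sobolevInf d) (R : ℝ) (N : ℕ) :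
    IsDiffCurve ⊤ 1 fun t => fourierVec (reynoldsExpansion R u₀ N t) := by
  refine IsBoundedCurve.congr_diff (IsDiffCurve.sum (Finset.range (N + 1)) fun j _ =>
    (isDiffCurve_reynoldsCoeff hu j).smul (R ^ j)) fun t ht => funext fun k => ?_
  rw [reynoldsExpansion, ← fourierCLM_apply, map_sum]
  simp only [map_smul, fourierCLM_apply]

lemma reynoldsExpansion_zero {u₀ : L2Field d} (hu : u₀ ∈ sobolevInf d) (R : ℝ) (N : ℕ) :
    reynoldsExpansion R u₀ N 0 = u₀ := by
  have h0 : reynoldsCoeff u₀ 0 0 = u₀ := ext_fourierVec fun k => by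
    rw [reynoldsCoeff, fourierVec_heat (mem_sobolevInf_iff.mp hu) le_rfl]
    simp
  have h1 : ∀ j, reynoldsCoeff u₀ (j + 1) 0 = 0 := fun j => by
    rw [reynoldsCoeff]
    simp
  rw [reynoldsExpansion, Finset.sum_range_succ']
  simp [h0, h1]

/-- The residual of a differentiable curve in terms of Fourier coefficients. -/
lemma fourierVec_nsResidual {v : ℝ → L2Field d} {c' : ℝ → Modes d}
    (hv : IsBoundedCurve ⊤ fun t => fourierVec (v t)) (hc' : IsBoundedCurve ⊤ c')
    (hd : ModeDeriv ⊤ (fun t => fourierVec (v t)) c') (R : ℝ) {t : ℝ} (ht : 0 ≤ t)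
    (k : Fin d → ℤ) : fourierVec (nsResidual R v t) k =
      c' t k - nsRhs R (fun t => fourierVec (v t)) t k := by
  have htT : t ∈ timeInterval ⊤ := by rwa [timeInterval_top]
  have hder := hasDerivWithinAt_field hv hc' hd htT
    fun k => (hc'.mem t htT).fourierVec_ofFourier k
  rw [timeInterval_top] at hder
  have hvt := hv.mem t htT
  rw [nsResidual, hder.derivWithin (uniqueDiffOn_Ici 0 t ht), fourierVec_sub, fourierVec_sub,
    fourierVec_smul, (hc'.mem t htT).fourierVec_ofFourier, fourierVec_vecLaplacian hvt,
    fourierVec_nsBilin hvt hvt, nsRhs, sub_sub]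

end

/-! ### Sobolev energy estimates and comparison with the control equations. -/

section

variable {d : ℕ} {T : EReal}

lemma abs_re_inner_le (a b : EuclideanSpace ℂ (Fin d)) : |(inner ℂ a b).re| ≤ ‖a‖ * ‖b‖ :=
  (Complex.abs_re_le_norm _).trans (norm_inner_le_norm a b)

lemma re_inner_eq_real_inner (a b : EuclideanSpace ℂ (Fin d)) :
    (inner ℂ a b).re = inner ℝ a b := by
  rw [PiLp.inner_apply, PiLp.inner_apply, Complex.re_sum]
  refine Finset.sum_congr rfl fun i _ => ?_
  rw [Complex.inner, RCLike.inner_apply, mul_comm]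

/-- The Sobolev inner product in terms of Fourier coefficients. -/
def modeInner (n : ℝ) (a b : Modes d) : ℝ :=
  (2 * Real.pi) ^ d * ∑' k, sobolevWeight n k * (inner ℂ (a k) (b k)).re

lemma sobolevInner_eq (n : ℝ) (v w : L2Field d) :
    sobolevInner n v w = modeInner n (fourierVec v) (fourierVec w) := rfl

lemma summable_modeInner {a b : Modes d} (ha : IsSmoothModes a) (hb : IsSmoothModes b) (n : ℝ) :
    Summable fun k => sobolevWeight n k * (inner ℂ (a k) (b k)).re := by
  refine Summable.of_norm_bounded (ha.rapid.summable_weight_mul hb.rapid n) fun k => ?_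
  rw [norm_mul, Real.norm_of_nonneg (sobolevWeight_nonneg n k)]
  exact mul_le_mul_of_nonneg_left (abs_re_inner_le _ _) (sobolevWeight_nonneg n k)

lemma modeInner_add_left {a a' b : Modes d} (ha : IsSmoothModes a) (ha' : IsSmoothModes a')
    (hb : IsSmoothModes b) (n : ℝ) :
    modeInner n (fun k => a k + a' k) b = modeInner n a b + modeInner n a' b := by
  unfold modeInner
  rw [← mul_add, ← (summable_modeInner ha hb n).tsum_add (summable_modeInner ha' hb n)]
  simp only [inner_add_left, Complex.add_re, mul_add]

lemma modeInner_smul_left (r : ℝ) (a b : Modes d) (n : ℝ) :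
    modeInner n (fun k => r • a k) b = r * modeInner n a b := by
  unfold modeInner
  rw [mul_left_comm, ← tsum_mul_left (a := r)]
  congr 2
  funext k
  rw [re_inner_eq_real_inner, re_inner_eq_real_inner, real_inner_smul_left]
  ring

lemma tsum_mul_le_sqrt_mul_sqrt {ι : Type*} {f g : ι → ℝ} (hf : ∀ i, 0 ≤ f i) (hg : ∀ i, 0 ≤ g i)
    (hfs : Summable fun i => f i ^ 2) (hgs : Summable fun i => g i ^ 2) :
    ∑' i, f i * g i ≤ Real.sqrt (∑' i, f i ^ 2) * Real.sqrt (∑' i, g i ^ 2) := by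
  have h := Real.inner_le_Lp_mul_Lq_tsum_of_nonneg (p := 2) (q := 2) (f := f) (g := g)
    Real.HolderConjugate.two_two hf hg (by simpa using hfs) (by simpa using hgs)
  simpa [Real.sqrt_eq_rpow] using h

lemma abs_modeInner_le {a b : Modes d} (ha : IsSmoothModes a) (hb : IsSmoothModes b) (n : ℝ) :
    |modeInner n a b| ≤ Real.sqrt (modeInner n a a) * Real.sqrt (modeInner n b b) := by
  have hpi : (0 : ℝ) ≤ (2 * Real.pi) ^ d := pow_nonneg Real.two_pi_pos.le d
  have hw := sobolevWeight_nonneg (d := d) n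
  have hsq : ∀ c : Modes d, ∀ k, (Real.sqrt (sobolevWeight n k) * ‖c k‖) ^ 2 =
      sobolevWeight n k * ‖c k‖ ^ 2 := fun c k => by rw [mul_pow, Real.sq_sqrt (hw k)]
  have h := tsum_mul_le_sqrt_mul_sqrt (f := fun k => Real.sqrt (sobolevWeight n k) * ‖a k‖)
    (g := fun k => Real.sqrt (sobolevWeight n k) * ‖b k‖) (fun _ => by positivity)
    (fun _ => by positivity) (by simpa only [hsq] using ha.summable_weight_sq n)
    (by simpa only [hsq] using hb.summable_weight_sq n)
  simp only [hsq] at h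
  have hmul : ∀ k, Real.sqrt (sobolevWeight n k) * ‖a k‖ * (Real.sqrt (sobolevWeight n k) * ‖b k‖) =
      sobolevWeight n k * (‖a k‖ * ‖b k‖) := fun k => by
    rw [mul_mul_mul_comm, Real.mul_self_sqrt (hw k)]
  simp only [hmul] at h
  have h1 : |∑' k, sobolevWeight n k * (inner ℂ (a k) (b k)).re| ≤
      ∑' k, sobolevWeight n k * (‖a k‖ * ‖b k‖) := by
    rw [← Real.norm_eq_abs]
    refine tsum_of_norm_bounded (ha.rapid.summable_weight_mul hb.rapid n).hasSum fun k => ?_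
    rw [norm_mul, Real.norm_of_nonneg (hw k)]
    exact mul_le_mul_of_nonneg_left (abs_re_inner_le _ _) (hw k)
  unfold modeInner
  simp only [re_inner_self]
  rw [abs_mul, abs_of_nonneg hpi, Real.sqrt_mul hpi, Real.sqrt_mul hpi, mul_mul_mul_comm,
    Real.mul_self_sqrt hpi]
  exact mul_le_mul_of_nonneg_left (h1.trans h) hpi

lemma abs_sobolevInner_le {v w : L2Field d} (hv : IsSmoothModes (fourierVec v))
    (hw : IsSmoothModes (fourierVec w)) (n : ℝ) :
    |sobolevInner n v w| ≤ sobolevNorm n v * sobolevNorm n w :=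
  abs_modeInner_le hv hw n

lemma sobolevWeight_add_one (n : ℝ) (k : Fin d → ℤ) :
    sobolevWeight (n + 1) k = freqSq k * sobolevWeight n k := by
  unfold sobolevWeight
  split_ifs with hk
  · rw [mul_zero]
  · rw [Real.rpow_add (zero_lt_one.trans_le (one_le_freqSq hk)), Real.rpow_one, mul_comm]

lemma sobolevWeight_le_freqSq_mul (n : ℝ) (k : Fin d → ℤ) :
    sobolevWeight n k ≤ freqSq k * sobolevWeight n k := by
  by_cases hk : k = 0
  · simp [hk, sobolevWeight]
  · exact le_mul_of_one_le_left (sobolevWeight_nonneg n k) (one_le_freqSq hk)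

/-- Poincaré inequality with constant one, as `|k| ≥ 1` off the zero mode. It produces the damping
term of the control equations. -/
lemma sobolevInner_self_le_add_one {v : L2Field d} (hv : IsSmoothModes (fourierVec v)) (n : ℝ) :
    sobolevInner n v v ≤ sobolevInner (n + 1) v v := by
  rw [sobolevInner_self, sobolevInner_self]
  refine mul_le_mul_of_nonneg_left ((hv.summable_weight_sq n).tsum_le_tsum (fun k => ?_)
    (hv.summable_weight_sq (n + 1))) (pow_nonneg Real.two_pi_pos.le d)
  rw [sobolevWeight_add_one]
  exact mul_le_mul_of_nonneg_right (sobolevWeight_le_freqSq_mul n k) (sq_nonneg _)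

lemma sobolevNorm_le_add_one {v : L2Field d} (hv : IsSmoothModes (fourierVec v)) (n : ℝ) :
    sobolevNorm n v ≤ sobolevNorm (n + 1) v :=
  Real.sqrt_le_sqrt (sobolevInner_self_le_add_one hv n)

lemma modeInner_laplacian (n : ℝ) (v : L2Field d) :
    modeInner n (fun k => (-freqSq k) • fourierVec v k) (fourierVec v) =
      -sobolevInner (n + 1) v v := by
  rw [sobolevInner_self, modeInner, ← mul_neg, ← tsum_neg]
  congr 2
  funext k
  rw [re_inner_eq_real_inner, real_inner_smul_left, ← re_inner_eq_real_inner, re_inner_self,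
    sobolevWeight_add_one]
  ring

lemma eq_zero_of_sobolevNorm_eq_zero {n : ℝ} {v : L2Field d} (hv : IsSmoothModes (fourierVec v))
    (h : sobolevNorm n v ≤ 0) : v = 0 := by
  have h0 : sobolevNorm n v = 0 := le_antisymm h (sobolevNorm_nonneg n v)
  have h1 := tsum_weight_le_sobolevNorm_sq n v
  rw [h0, zero_pow two_ne_zero] at h1
  refine ext_fourierVec fun k => ?_
  rw [fourierVec_zero]
  by_cases hk : k = 0
  · rw [hk, hv.zero]
  · have h2 := ((hv.summable_weight_sq n).le_tsum k fun l _ =>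
      mul_nonneg (sobolevWeight_nonneg n l) (sq_nonneg _)).trans h1
    rw [sobolevWeight, if_neg hk] at h2
    have h3 := Real.rpow_pos_of_pos (zero_lt_one.trans_le (one_le_freqSq hk)) n
    have h4 : ‖fourierVec v k‖ ^ 2 ≤ 0 := by
      by_contra! hc
      exact absurd (mul_pos h3 hc) (not_lt.mpr h2)
    exact norm_eq_zero.mp (pow_eq_zero_iff two_ne_zero |>.mp (le_antisymm h4 (sq_nonneg _)))

/-- The square of a Sobolev norm is differentiable along curves. -/
lemma hasDerivWithinAt_sobolevNorm_sq {w : ℝ → L2Field d} {c' : ℝ → Modes d}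
    (hw : IsBoundedCurve T fun t => fourierVec (w t)) (hc' : IsBoundedCurve T c')
    (hd : ModeDeriv T (fun t => fourierVec (w t)) c') (n : ℝ) {t : ℝ} (ht : t ∈ timeInterval T) :
    HasDerivWithinAt (fun s => sobolevNorm n (w s) ^ 2)
      (2 * modeInner n (c' t) (fourierVec (w t))) (timeInterval T) t := by
  obtain ⟨t', ht', hlt⟩ := exists_gt_mem_timeInterval ht
  have hsub := Icc_subset_timeInterval ht'
  obtain ⟨M, hM, hMw⟩ := hw.rapid t' ht'
  obtain ⟨M', hM', hMc⟩ := hc'.rapid t' ht'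
  have hterm : ∀ k, ∀ s ∈ Icc 0 t', HasDerivWithinAt
      (fun s => sobolevWeight n k * ‖fourierVec (w s) k‖ ^ 2)
      (sobolevWeight n k * (2 * (inner ℂ (c' s k) (fourierVec (w s) k)).re)) (Icc 0 t') s := by
    intro k s hs
    have h := (((hd s (hsub hs) k).mono hsub).norm_sq).const_mul (sobolevWeight n k)
    refine h.congr_deriv ?_
    rw [re_inner_eq_real_inner, real_inner_comm]
  have hder := hasDerivWithinAt_tsum (convex_Icc 0 t')
    ((hM'.summable_weight_mul hM n).mul_left 2) hterm (fun k s hs => by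
      rw [norm_mul, Real.norm_of_nonneg (sobolevWeight_nonneg n k), norm_mul, Real.norm_ofNat,
        mul_left_comm]
      refine mul_le_mul_of_nonneg_left (mul_le_mul_of_nonneg_left
        ((abs_re_inner_le _ _).trans ?_) (sobolevWeight_nonneg n k)) zero_le_two
      exact mul_le_mul (hMc s hs k) (hMw s hs k) (norm_nonneg _) (hM'.1 k))
    (fun s hs => (hw.mem s (hsub hs)).summable_weight_sq n) ⟨ht.1, hlt.le⟩
  rw [HasDerivWithinAt, nhdsWithin_Icc_timeInterval ht hlt, ← HasDerivWithinAt] at hder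
  have h := hder.const_mul ((2 * Real.pi) ^ d)
  refine (h.congr_of_mem (fun s _ => ?_) ht).congr_deriv ?_
  · rw [sobolevNorm_sq, sobolevInner_self]
  · rw [modeInner, mul_left_comm, ← tsum_mul_left (a := (2 : ℝ))]
    congr 2
    funext k
    ring

lemma continuousOn_sobolevNorm {w : ℝ → L2Field d} {j : ℕ}
    (hw : IsDiffCurve T (j + 1) fun t => fourierVec (w t)) (n : ℝ) :
    ContinuousOn (fun s => sobolevNorm n (w s)) (timeInterval T) := by
  obtain ⟨h1, c', h2, h3⟩ := hw
  have h : ContinuousOn (fun s => sobolevNorm n (w s) ^ 2) (timeInterval T) := fun t ht =>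
    (hasDerivWithinAt_sobolevNorm_sq h1 h2.bounded h3 n ht).continuousWithinAt
  refine h.sqrt.congr fun s _ => ?_
  simp only [Real.sqrt_sq (sobolevNorm_nonneg n (w s))]

/-- Expansion around the approximate solution `b`. In the first and last terms the error is the
transported field, as the Kato inequality requires; in the middle one the derivative falls on `b`,
which accounts for the norm of order `n + 1` of `b`. -/
lemma convMode_self_sub_modes {a b : Modes d} (ha : Summable fun k => ‖a k‖)
    (hb : Summable fun k => ‖b k‖) (k : Fin d → ℤ) :
    convMode a a k - convMode b b k = convMode b (fun k => a k - b k) k +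
      convMode (fun k => a k - b k) b k +
      convMode (fun k => a k - b k) (fun k => a k - b k) k := by
  have hs : Summable fun k => ‖a k - b k‖ :=
    (ha.add hb).of_nonneg_of_le (fun _ => norm_nonneg _) fun _ => norm_sub_le _ _
  have h1 := convMode_add_left hs hb ha k
  have h2 := convMode_add_right hs hs hb k
  have h3 := convMode_add_right hb hs hb k
  simp only [sub_add_cancel] at h1 h2 h3
  rw [h1, h2, h3]
  abel

/-- An approximate solution `v` with residual `r`. -/
structure IsApproxSolution (R : ℝ) (T : EReal) (v r : ℝ → L2Field d) : Prop where
  diff : ∃ c', IsBoundedCurve T (fun t => fourierVec (v t)) ∧ IsBoundedCurve T c' ∧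
    ModeDeriv T (fun t => fourierVec (v t)) c' ∧ ∀ t ∈ timeInterval T, ∀ k,
      fourierVec (r t) k = c' t k - nsRhs R (fun t => fourierVec (v t)) t k

lemma IsBoundedCurve.of_le {T' : EReal} {c : ℝ → Modes d} (h : IsBoundedCurve T' c)
    (hT : T ≤ T') : IsBoundedCurve T c :=
  ⟨fun t ht => h.rapid t (timeInterval_mono hT ht), fun t ht => h.mem t (timeInterval_mono hT ht)⟩

lemma ModeDeriv.of_le {T' : EReal} {c c' : ℝ → Modes d} (h : ModeDeriv T' c c') (hT : T ≤ T') :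
    ModeDeriv T c c' := fun t ht k =>
  (h t (timeInterval_mono hT ht) k).mono (timeInterval_mono hT)

lemma IsModeSolution.of_le {R : ℝ} {c₀ : Modes d} {T' : EReal} {c : ℝ → Modes d}
    (h : IsModeSolution R c₀ T' c) (hpos : 0 < T) (hT : T ≤ T') : IsModeSolution R c₀ T c :=
  ⟨hpos, h.bounded.of_le hT, h.init, h.ode.of_le hT⟩

lemma IsApproxSolution.of_le {R : ℝ} {T' : EReal} {v r : ℝ → L2Field d}
    (h : IsApproxSolution R T' v r) (hT : T ≤ T') : IsApproxSolution R T v r := by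
  obtain ⟨c', h1, h2, h3, h4⟩ := h.diff
  exact ⟨c', h1.of_le hT, h2.of_le hT, h3.of_le hT, fun t ht => h4 t (timeInterval_mono hT ht)⟩

lemma isApproxSolution_reynoldsExpansion {u₀ : L2Field d} (hu : u₀ ∈ sobolevInf d) (R : ℝ)
    (N : ℕ) : IsApproxSolution R ⊤ (reynoldsExpansion R u₀ N)
      (nsResidual R (reynoldsExpansion R u₀ N)) := by
  obtain ⟨h1, c', h2, h3⟩ := isDiffCurve_reynoldsExpansion hu R N
  exact ⟨c', h1, h2, h3, fun t ht k => fourierVec_nsResidual h1 h2 h3 R ht.1 k⟩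

lemma IsModeSolution.isApproxSolution {R : ℝ} {c₀ : Modes d} {v : ℝ → L2Field d}
    (h : IsModeSolution R c₀ T fun t => fourierVec (v t)) :
    IsApproxSolution R T v fun _ => 0 :=
  ⟨_, h.bounded, h.bounded.laplacian.add ((h.bounded.conv h.bounded).smul R), h.ode,
    fun t _ k => by rw [fourierVec_zero]; exact (sub_self _).symm⟩

section Energy

variable {R : ℝ} {u v r : ℝ → L2Field d}

/-- The constants are arbitrary reals, but testing the inequality on one field of positive norm
fixes the sign. The sign is needed to replace norms by their estimators, and only at times when such
a field, the error itself, is at hand. -/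
lemma IsKatoConst.nonneg {n G : ℝ} (hG : IsKatoConst d n G) {w : L2Field d}
    (hw : IsSmoothModes (fourierVec w)) (h : 0 < sobolevNorm n w) : 0 ≤ G := by
  have h1 := (abs_nonneg _).trans (hG w (hw.mem_sobolevSpace n) w (hw.mem_sobolevSpace (n + 1)))
  rw [mul_assoc] at h1
  exact nonneg_of_mul_nonneg_left h1 (by positivity)

lemma IsBasicConst.nonneg {n K : ℝ} (hK : IsBasicConst d n K) {w : L2Field d}
    (hw : IsSmoothModes (fourierVec w)) (h : 0 < sobolevNorm n w) : 0 ≤ K := by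
  have h1 := (sobolevNorm_nonneg _ _).trans
    (hK w (hw.mem_sobolevSpace n) w (hw.mem_sobolevSpace (n + 1)))
  have h2 := h.trans_le (sobolevNorm_le_add_one hw n)
  rw [mul_assoc] at h1
  exact nonneg_of_mul_nonneg_left h1 (by positivity)

lemma IsTameKatoConst.nonneg {p n G : ℝ} (hG : IsTameKatoConst d p n G) {w : L2Field d}
    (hw : IsSmoothModes (fourierVec w)) (h : 0 < sobolevNorm p w) (h' : 0 < sobolevNorm n w) :
    0 ≤ G := by
  have h1 := (abs_nonneg _).trans (hG w (hw.mem_sobolevSpace p) w (hw.mem_sobolevSpace (p + 1)))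
  have h2 : 0 ≤ G * (sobolevNorm p w * sobolevNorm n w * sobolevNorm p w) := by linarith
  exact nonneg_of_mul_nonneg_left h2 (by positivity)

/-- The differential inequality for the Sobolev norm of the error. -/
lemma exists_deriv_sobolevNorm_sub_le (hR : 0 ≤ R) {c₀ : Modes d}
    (hu : IsModeSolution R c₀ T fun t => fourierVec (u t)) (hv : IsApproxSolution R T v r)
    {m K G H : ℝ} (hK : IsBasicConst d m K) (hG : IsKatoConst d m G) {t : ℝ}
    (ht : t ∈ timeInterval T) (ht0 : 0 < t) (hpos : 0 < sobolevNorm m (u t - v t))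
    (hH : sobolevInner m (nsBilin (u t - v t) (u t - v t)) (u t - v t) ≤
      H * sobolevNorm m (u t - v t) ^ 2) :
    ∃ f', HasDerivAt (fun s => sobolevNorm m (u s - v s)) f' t ∧
      f' ≤ -sobolevNorm m (u t - v t) + R * (G * sobolevNorm m (v t) +
        K * sobolevNorm (m + 1) (v t) + H) * sobolevNorm m (u t - v t) + sobolevNorm m (r t) := by
  obtain ⟨c', hvb, hc', hd, hr⟩ := hv.diff
  have hub := hu.bounded
  have hsub : ∀ s, fourierVec (u s - v s : L2Field d) =
      fun k => fourierVec (u s) k - fourierVec (v s) k := fun s => funext fun k =>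
    fourierVec_sub _ _ k
  have hwb : IsBoundedCurve T fun s => fourierVec (u s - v s : L2Field d) :=
    (hub.sub hvb).congr fun s _ => hsub s
  have hrhs : IsBoundedCurve T (nsRhs R fun t => fourierVec (u t)) :=
    hub.laplacian.add ((hub.conv hub).smul R)
  have hwd : ModeDeriv T (fun s => fourierVec (u s - v s : L2Field d))
      fun s k => nsRhs R (fun t => fourierVec (u t)) s k - c' s k := fun s hs k => by
    simp only [fourierVec_sub]
    exact (hu.ode s hs k).sub (hd s hs k)
  have hder := hasDerivAt_of_timeInterval ht ht0
    (hasDerivWithinAt_sobolevNorm_sq hwb (hrhs.sub hc') hwd m ht)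
  set w : L2Field d := u t - v t with hwdef
  have hvs := hvb.mem t ht
  have hws : IsSmoothModes (fourierVec w) := hwb.mem t ht
  have hvr : IsBoundedCurve T (nsRhs R fun t => fourierVec (v t)) :=
    hvb.laplacian.add ((hvb.conv hvb).smul R)
  have hrs : IsSmoothModes (fourierVec (r t)) := by
    rw [funext (hr t ht)]
    exact (hc'.mem t ht).sub (hvr.mem t ht)
  have hP : ∀ {a b : L2Field d}, IsSmoothModes (fourierVec a) → IsSmoothModes (fourierVec b) →
      IsSmoothModes (fourierVec (nsBilin a b)) := fun ha hb => by
    rw [funext (fourierVec_nsBilin ha hb)]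
    exact ha.conv hb
  have hsplit : (fun k => nsRhs R (fun t => fourierVec (u t)) t k - c' t k) = fun k =>
      (-freqSq k) • fourierVec w k + (R • (fourierVec (nsBilin (v t) w) k +
        (fourierVec (nsBilin w (v t)) k + fourierVec (nsBilin w w) k)) +
          (-1 : ℝ) • fourierVec (r t) k) := by
    funext k
    have h1 := convMode_self_sub_modes (hub.mem t ht).summable hvs.summable k
    rw [← hsub t] at h1
    rw [fourierVec_nsBilin hvs hws, fourierVec_nsBilin hws hvs, fourierVec_nsBilin hws hws,
      hr t ht, ← add_assoc (convMode _ _ _), ← h1, nsRhs, nsRhs, hwdef, fourierVec_sub, smul_sub,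
      smul_sub, neg_one_smul]
    abel
  have hinner : modeInner m (fun k => nsRhs R (fun t => fourierVec (u t)) t k - c' t k)
      (fourierVec w) = -sobolevInner (m + 1) w w + (R * (sobolevInner m (nsBilin (v t) w) w +
        (sobolevInner m (nsBilin w (v t)) w + sobolevInner m (nsBilin w w) w)) -
          sobolevInner m (r t) w) := by
    have hP1 := hP hvs hws
    have hP2 := hP hws hvs
    have hP3 := hP hws hws
    rw [hsplit, modeInner_add_left hws.laplacian
      (((hP1.add (hP2.add hP3)).smul R).add (hrs.smul (-1))) hws,
      modeInner_add_left ((hP1.add (hP2.add hP3)).smul R) (hrs.smul (-1)) hws,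
      modeInner_smul_left, modeInner_smul_left, modeInner_add_left hP1 (hP2.add hP3) hws,
      modeInner_add_left hP2 hP3 hws, modeInner_laplacian]
    simp only [← sobolevInner_eq]
    ring
  set f := sobolevNorm m w with hf
  have hb1 : sobolevInner m (nsBilin (v t) w) w ≤ G * sobolevNorm m (v t) * f ^ 2 :=
    (le_abs_self _).trans (hG (v t) (hvs.mem_sobolevSpace m) w (hws.mem_sobolevSpace (m + 1)))
  have hb2 : sobolevInner m (nsBilin w (v t)) w ≤ K * f * sobolevNorm (m + 1) (v t) * f :=
    (le_abs_self _).trans ((abs_sobolevInner_le (hP hws hvs) hws m).trans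
      (mul_le_mul_of_nonneg_right (hK w (hws.mem_sobolevSpace m) (v t)
        (hvs.mem_sobolevSpace (m + 1))) hpos.le))
  have hb3 : -sobolevInner m (r t) w ≤ sobolevNorm m (r t) * f :=
    (neg_le_abs _).trans (abs_sobolevInner_le hrs hws m)
  have hb4 : f ^ 2 ≤ sobolevInner (m + 1) w w := by
    rw [hf, sobolevNorm_sq]
    exact sobolevInner_self_le_add_one hws m
  -- The norm itself is differentiable only where it is positive; dividing the energy inequality by
  -- it gives the first-order inequality.
  have hd2 := hder.sqrt (pow_pos hpos 2).ne'
  rw [Real.sqrt_sq hpos.le] at hd2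
  simp only [Real.sqrt_sq (sobolevNorm_nonneg m _)] at hd2
  refine ⟨_, hd2, ?_⟩
  rw [mul_div_mul_left _ _ two_ne_zero, div_le_iff₀ hpos, hinner]
  have hsum : R * (sobolevInner m (nsBilin (v t) w) w +
      (sobolevInner m (nsBilin w (v t)) w + sobolevInner m (nsBilin w w) w)) ≤
      R * (G * sobolevNorm m (v t) * f ^ 2 +
        (K * f * sobolevNorm (m + 1) (v t) * f + H * f ^ 2)) :=
    mul_le_mul_of_nonneg_left (add_le_add hb1 (add_le_add hb2 hH)) hR
  calc _ ≤ -f ^ 2 + (R * (G * sobolevNorm m (v t) * f ^ 2 +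
        (K * f * sobolevNorm (m + 1) (v t) * f + H * f ^ 2)) + sobolevNorm m (r t) * f) := by
        linarith
    _ = _ := by ring

/-- The differential inequality is demanded only where `f` exceeds `ρ`, and there the continuous
coefficient `a` may be replaced by a bound on the compact interval `[0, b]`. -/
lemma le_of_deriv_sub_le {f ρ a : ℝ → ℝ} (hf : ContinuousOn f (timeInterval T))
    (hρ : ContinuousOn ρ (timeInterval T)) (ha : ContinuousOn a (timeInterval T)) (h0 : f 0 ≤ ρ 0)
    (hd : ∀ t ∈ timeInterval T, 0 < t → ρ t < f t → ∃ f' ρ', HasDerivAt f f' t ∧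
      HasDerivAt ρ ρ' t ∧ f' - ρ' ≤ a t * (f t - ρ t)) :
    ∀ t ∈ timeInterval T, f t ≤ ρ t := by
  intro b hb
  have hsub := Icc_subset_timeInterval hb
  obtain ⟨L, hL⟩ := (isCompact_Icc (a := (0 : ℝ)) (b := b)).exists_bound_of_continuousOn
    (ha.mono hsub)
  have h := nonpos_of_deriv_le_mul (q := fun t => f t - ρ t)
    (q' := fun t => deriv (fun t => f t - ρ t) t) (L := L) hb.1 ((hf.sub hρ).mono hsub)
    (sub_nonpos.mpr h0) fun t ht hpos => by
      have htI := hsub ⟨ht.1.le, ht.2.le⟩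
      obtain ⟨f', ρ', h1, h2, h3⟩ := hd t htI ht.1 (sub_pos.mp hpos)
      have h4 : HasDerivAt (fun t => f t - ρ t) (f' - ρ') t := h1.sub h2
      rw [h4.deriv]
      refine ⟨h4, h3.trans (mul_le_mul_of_nonneg_right ?_ hpos.le)⟩
      exact (le_abs_self _).trans (hL t ⟨ht.1.le, ht.2.le⟩)
  exact sub_nonpos.mp h

lemma IsApproxSolution.isDiffCurve (hv : IsApproxSolution R T v r) :
    IsDiffCurve T 1 fun t => fourierVec (v t) := by
  obtain ⟨c', h1, h2, h3, -⟩ := hv.diff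
  exact ⟨h1, c', h2, h3⟩

lemma continuousOn_sobolevNorm_sub {c₀ : Modes d}
    (hu : IsModeSolution R c₀ T fun t => fourierVec (u t)) (hv : IsApproxSolution R T v r)
    (m : ℝ) : ContinuousOn (fun t => sobolevNorm m (u t - v t)) (timeInterval T) := by
  refine continuousOn_sobolevNorm (j := 0) (w := fun t => u t - v t) ?_ m
  refine IsBoundedCurve.congr_diff ((hu.isDiffCurve 1).add (hv.isDiffCurve.smul (-1)))
    fun t _ => funext fun k => ?_
  rw [fourierVec_sub, neg_one_smul, sub_eq_add_neg]

lemma isSmoothModes_sub {c₀ : Modes d} (hu : IsModeSolution R c₀ T fun t => fourierVec (u t))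
    (hv : IsApproxSolution R T v r) {t : ℝ} (ht : t ∈ timeInterval T) :
    IsSmoothModes (fourierVec (u t - v t : L2Field d)) := by
  rw [funext (fourierVec_sub (u t) (v t))]
  exact (hu.bounded.mem t ht).sub (hv.isDiffCurve.bounded.mem t ht)

lemma sobolevNorm_zero (m : ℝ) : sobolevNorm m (0 : L2Field d) = 0 := by
  simp only [sobolevNorm, sobolevInner_self, fourierVec_zero, norm_zero]
  simp

/-- The error of an approximate solution is controlled by the solution of the control problem. -/
lemma sobolevNorm_sub_le_control (hR : 0 ≤ R) {c₀ : Modes d}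
    (hu : IsModeSolution R c₀ T fun t => fourierVec (u t)) (hv : IsApproxSolution R T v r)
    (h0 : u 0 = v 0) {n K G : ℝ} (hK : IsBasicConst d n K) (hG : IsKatoConst d n G)
    {D D' ε ρ : ℝ → ℝ} (hD : ContinuousOn D (timeInterval T))
    (hD' : ContinuousOn D' (timeInterval T))
    (hDv : ∀ t ∈ timeInterval T, sobolevNorm n (v t) ≤ D t)
    (hDv' : ∀ t ∈ timeInterval T, sobolevNorm (n + 1) (v t) ≤ D' t)
    (hεr : ∀ t ∈ timeInterval T, sobolevNorm n (r t) ≤ ε t)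
    (hρ : SolvesControl R G K D D' ε T ρ) (hρ0 : ∀ t ∈ timeInterval T, 0 ≤ ρ t) :
    ∀ t ∈ timeInterval T, sobolevNorm n (u t - v t) ≤ ρ t := by
  have hf := continuousOn_sobolevNorm_sub hu hv n
  have hρc := continuousOn_of_solvesControl hρ
  -- The quadratic terms are handled by `f² - ρ² = (f + ρ)(f - ρ)`.
  refine le_of_deriv_sub_le (a := fun t => -1 + R * (G * D t + K * D' t) +
    R * G * (sobolevNorm n (u t - v t) + ρ t)) hf hρc (by fun_prop) ?_ fun t ht ht0 hlt => ?_
  · rw [h0, sub_self, sobolevNorm_zero, hρ.1]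
  · have hpos := (hρ0 t ht).trans_lt hlt
    have hws := isSmoothModes_sub hu hv ht
    have hG0 := hG.nonneg hws hpos
    have hK0 := hK.nonneg hws hpos
    obtain ⟨f', h1, h2⟩ := exists_deriv_sobolevNorm_sub_le hR hu hv hK hG ht ht0 hpos
      (H := G * sobolevNorm n (u t - v t)) ((le_abs_self _).trans
        (hG _ (hws.mem_sobolevSpace n) _ (hws.mem_sobolevSpace (n + 1))))
    refine ⟨f', _, h1, hasDerivAt_of_timeInterval ht ht0 (hρ.2 t ht), ?_⟩
    set f := sobolevNorm n (u t - v t)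
    have h3 : R * (G * sobolevNorm n (v t) + K * sobolevNorm (n + 1) (v t) + G * f) * f ≤
        R * (G * D t + K * D' t + G * f) * f := by
      have := hDv t ht
      have := hDv' t ht
      gcongr
    have h4 := hεr t ht
    linarith

/-- The linear control of the error in higher norms. -/
lemma sobolevNorm_sub_le_linearControl (hR : 0 ≤ R) {c₀ : Modes d}
    (hu : IsModeSolution R c₀ T fun t => fourierVec (u t)) (hv : IsApproxSolution R T v r)
    (h0 : u 0 = v 0) {p n K G G' : ℝ} (hK : IsBasicConst d p K) (hG : IsKatoConst d p G)
    (hG' : IsTameKatoConst d p n G')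
    {D D' ε ρ σ : ℝ → ℝ} (hD : ContinuousOn D (timeInterval T))
    (hD' : ContinuousOn D' (timeInterval T)) (hρc : ContinuousOn ρ (timeInterval T))
    (hDv : ∀ t ∈ timeInterval T, sobolevNorm p (v t) ≤ D t)
    (hDv' : ∀ t ∈ timeInterval T, sobolevNorm (p + 1) (v t) ≤ D' t)
    (hεr : ∀ t ∈ timeInterval T, sobolevNorm p (r t) ≤ ε t)
    (hρ : ∀ t ∈ timeInterval T, sobolevNorm n (u t - v t) ≤ ρ t)
    (hσ : SolvesLinearControl R G K G' D D' ρ ε T σ) (hσ0 : ∀ t ∈ timeInterval T, 0 ≤ σ t) :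
    ∀ t ∈ timeInterval T, sobolevNorm p (u t - v t) ≤ σ t := by
  have hf := continuousOn_sobolevNorm_sub hu hv p
  have hσc : ContinuousOn σ (timeInterval T) := fun t ht => (hσ.2 t ht).continuousWithinAt
  refine le_of_deriv_sub_le (a := fun t => -1 + R * (G * D t + K * D' t + G' * ρ t))
    hf hσc (by fun_prop) ?_ fun t ht ht0 hlt => ?_
  · rw [h0, sub_self, sobolevNorm_zero, hσ.1]
  · have hpos := (hσ0 t ht).trans_lt hlt
    have hws := isSmoothModes_sub hu hv ht
    have hG0 := hG.nonneg hws hpos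
    have hK0 := hK.nonneg hws hpos
    -- The `n`-norm vanishes only for the zero field, so positivity passes from order `p` to order
    -- `n`; this fixes the sign of the tame constant.
    have hn : 0 < sobolevNorm n (u t - v t) := by
      by_contra! hle
      rw [eq_zero_of_sobolevNorm_eq_zero hws hle, sobolevNorm_zero] at hpos
      exact lt_irrefl _ hpos
    have hG0' := hG'.nonneg hws hpos hn
    obtain ⟨f', h1, h2⟩ := exists_deriv_sobolevNorm_sub_le hR hu hv hK hG ht ht0 hpos
      (H := G' * sobolevNorm n (u t - v t)) ((le_abs_self _).trans
        ((hG' _ (hws.mem_sobolevSpace p) _ (hws.mem_sobolevSpace (p + 1))).trans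
          (le_of_eq (by ring))))
    refine ⟨f', _, h1, hasDerivAt_of_timeInterval ht ht0 (hσ.2 t ht), ?_⟩
    set f := sobolevNorm p (u t - v t)
    have h3 : R * (G * sobolevNorm p (v t) + K * sobolevNorm (p + 1) (v t) +
        G' * sobolevNorm n (u t - v t)) * f ≤ R * (G * D t + K * D' t + G' * ρ t) * f := by
      have := hDv t ht
      have := hDv' t ht
      have := hρ t ht
      gcongr
    have h4 := hεr t ht
    linarith

end Energy

end

/-! ### Uniqueness, the maximal solution and continuation. -/

section

variable {d : ℕ} {T : EReal} {R : ℝ}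

lemma IsModeSolution.congr {c₀ : Modes d} {c e : ℝ → Modes d} (h : IsModeSolution R c₀ T c)
    (hce : ∀ t ∈ timeInterval T, e t = c t) : IsModeSolution R c₀ T e where
  pos := h.pos
  bounded := h.bounded.congr hce
  init := by rw [hce 0 (zero_mem_timeInterval h.pos), h.init]
  ode := h.ode.congr hce fun t ht => by
    funext k
    simp only [nsRhs, hce t ht]

lemma IsModeSolution.ofFourier {c₀ : Modes d} {c : ℝ → Modes d} (h : IsModeSolution R c₀ T c) :
    IsModeSolution R c₀ T fun t => fourierVec (NSReynolds.ofFourier (c t)) :=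
  h.congr fun t ht => funext fun k => (h.bounded.mem t ht).fourierVec_ofFourier k

/-- Uniqueness for the Navier-Stokes Cauchy problem. -/
lemma IsModeSolution.unique (hR : 0 ≤ R) {n K G : ℝ} (hK : IsBasicConst d n K)
    (hG : IsKatoConst d n G) {c₀ : Modes d} {c e : ℝ → Modes d} (hc : IsModeSolution R c₀ T c)
    (he : IsModeSolution R c₀ T e) : ∀ t ∈ timeInterval T, c t = e t := by
  have hu := hc.ofFourier
  have hv := he.ofFourier
  have happ := hv.isApproxSolution
  have h0 : NSReynolds.ofFourier (c 0) = NSReynolds.ofFourier (e 0) := by rw [hc.init, he.init]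
  -- The second solution serves as approximate solution with zero residual and its own norms as
  -- growth estimators; then `ρ = 0` solves the control problem.
  have hle := sobolevNorm_sub_le_control hR hu happ h0 hK hG
    (continuousOn_sobolevNorm (hv.isDiffCurve 1) n)
    (continuousOn_sobolevNorm (hv.isDiffCurve 1) (n + 1))
    (fun _ _ => le_rfl) (fun _ _ => le_rfl) (ε := fun _ => 0) (ρ := fun _ => 0)
    (fun _ _ => (sobolevNorm_zero n).le)
    ⟨rfl, fun t _ => (hasDerivWithinAt_const t _ (0 : ℝ)).congr_deriv (by ring)⟩
    (fun _ _ => le_rfl)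
  intro t ht
  have hz := eq_zero_of_sobolevNorm_eq_zero (isSmoothModes_sub hu happ ht) (hle t ht)
  have heq := sub_eq_zero.mp hz
  funext k
  rw [← (hc.bounded.mem t ht).fourierVec_ofFourier, heq,
    (he.bounded.mem t ht).fourierVec_ofFourier]

lemma IsModeSolution.unique' (hR : 0 ≤ R) {n K G : ℝ} (hK : IsBasicConst d n K)
    (hG : IsKatoConst d n G) {c₀ : Modes d} {c e : ℝ → Modes d} {T' : EReal}
    (hc : IsModeSolution R c₀ T c) (he : IsModeSolution R c₀ T' e) {t : ℝ}
    (ht : t ∈ timeInterval T) (ht' : t ∈ timeInterval T') : c t = e t := by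
  have hpos : 0 < min T T' := lt_min hc.pos he.pos
  exact (hc.of_le hpos (min_le_left _ _)).unique hR hK hG (he.of_le hpos (min_le_right _ _)) t
    ⟨ht.1, lt_min ht.2 ht'.2⟩

/-- The maximal solution, as the union of all solutions. -/
lemma exists_maximal_modeSolution (hR : 0 < R) {n K G : ℝ} (hK : IsBasicConst d n K)
    (hG : IsKatoConst d n G) {c₀ : Modes d} (hc₀ : IsSmoothModes c₀) :
    ∃ T c, IsModeSolution R c₀ T c ∧ ∀ T' c', IsModeSolution R c₀ T' c' → T' ≤ T := by
  classical
  set S : Set EReal := {T | ∃ c, IsModeSolution R c₀ T c} with hS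
  have hglobal : ∃ c : ℝ → Modes d, ∀ T' c', IsModeSolution R c₀ T' c' →
      ∀ t ∈ timeInterval T', c t = c' t := by
    -- At each time the value of an arbitrarily chosen solution is taken; uniqueness makes the
    -- choice irrelevant.
    refine ⟨fun t => if h : ∃ T' c', IsModeSolution R c₀ T' c' ∧ t ∈ timeInterval T' then
      h.choose_spec.choose t else 0, fun T' c' hc' t ht => ?_⟩
    have h : ∃ T' c', IsModeSolution R c₀ T' c' ∧ t ∈ timeInterval T' := ⟨T', c', hc', ht⟩
    simp only [dif_pos h]
    exact h.choose_spec.choose_spec.1.unique' hR.le hK hG hc' h.choose_spec.choose_spec.2 ht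
  obtain ⟨c, hc⟩ := hglobal
  obtain ⟨τ, -, hτ⟩ := exists_local_solution (d := d) hR
    (A := ∑' k, ‖c₀ k‖) (tsum_nonneg fun _ => norm_nonneg _)
  obtain ⟨c₁, h₁⟩ := hτ c₀ hc₀ le_rfl
  have hle : ∀ T' c', IsModeSolution R c₀ T' c' → T' ≤ sSup S := fun T' c' h =>
    le_sSup ⟨c', h⟩
  have hloc : ∀ t ∈ timeInterval (sSup S), ∃ T' c', IsModeSolution R c₀ T' c' ∧
      t ∈ timeInterval T' := by
    intro t ht
    obtain ⟨T', ⟨c', hc'⟩, hlt⟩ := lt_sSup_iff.mp ht.2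
    exact ⟨T', c', hc', ht.1, hlt⟩
  refine ⟨sSup S, c, ⟨h₁.pos.trans_le (hle _ _ h₁), ⟨fun t ht => ?_, fun t ht => ?_⟩, ?_,
    fun t ht k => ?_⟩, hle⟩
  · obtain ⟨T', c', hc', ht'⟩ := hloc t ht
    exact (hc'.bounded.rapid t ht').congr fun s hs => hc T' c' hc' s (Icc_subset_timeInterval ht' hs)
  · obtain ⟨T', c', hc', ht'⟩ := hloc t ht
    rw [hc T' c' hc' t ht']
    exact hc'.bounded.mem t ht'
  · rw [hc _ _ h₁ 0 (zero_mem_timeInterval h₁.pos), h₁.init]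
  · obtain ⟨T', c', hc', ht'⟩ := hloc t ht
    have h := (hc'.congr (hc T' c' hc')).ode t ht' k
    rw [hasDerivWithinAt_timeInterval_iff ht'] at h
    rwa [hasDerivWithinAt_timeInterval_iff ht]

lemma mem_timeInterval_coe {t T : ℝ} : t ∈ timeInterval (T : EReal) ↔ 0 ≤ t ∧ t < T := by
  rw [timeInterval, mem_ofPred_eq, EReal.coe_lt_coe_iff]

/-- Time translation of solutions. -/
lemma IsModeSolution.shift {c₀ : Modes d} {c : ℝ → Modes d} {T t₀ : ℝ}
    (h : IsModeSolution R c₀ (T : EReal) c) (ht₀ : 0 ≤ t₀) (htT : t₀ < T) :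
    IsModeSolution R (c t₀) ((T - t₀ : ℝ) : EReal) fun s => c (t₀ + s) := by
  have hmem : ∀ s ∈ timeInterval ((T - t₀ : ℝ) : EReal), t₀ + s ∈ timeInterval (T : EReal) := by
    intro s hs
    rw [mem_timeInterval_coe] at hs ⊢
    exact ⟨by linarith, by linarith⟩
  refine ⟨by exact_mod_cast sub_pos.mpr htT, ⟨fun t ht => ?_, fun t ht => h.bounded.mem _ (hmem t ht)⟩,
    by simp, fun t ht k => ?_⟩
  · obtain ⟨M, hM, hMc⟩ := h.bounded.rapid _ (hmem t ht)
    exact ⟨M, hM, fun s hs k => hMc _ ⟨by linarith [hs.1], by linarith [hs.2]⟩ k⟩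
  · have h1 : HasDerivWithinAt (fun s => t₀ + s) 1 (timeInterval ((T - t₀ : ℝ) : EReal)) t :=
      ((hasDerivAt_id t).const_add t₀).hasDerivWithinAt
    have h2 := (h.ode _ (hmem t ht) k).scomp t h1 hmem
    rw [one_smul] at h2
    exact h2

/-- Continuation of a solution by a solution which starts at a later time. -/
lemma IsModeSolution.extend (hR : 0 ≤ R) {n K G : ℝ} (hK : IsBasicConst d n K)
    (hG : IsKatoConst d n G) {c₀ : Modes d} {c e : ℝ → Modes d} {T t₀ τ : ℝ}
    (h : IsModeSolution R c₀ (T : EReal) c) (ht₀ : 0 ≤ t₀) (htT : t₀ < T) (hτ : T < t₀ + τ)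
    (he : IsModeSolution R (c t₀) (τ : EReal) e) :
    ∃ c', IsModeSolution R c₀ ((t₀ + τ : ℝ) : EReal) c' ∧
      ∀ t ∈ timeInterval (T : EReal), c' t = c t := by
  set c' : ℝ → Modes d := fun t => if t < T then c t else e (t - t₀) with hc'
  have h1 : ∀ t ∈ timeInterval (T : EReal), c' t = c t := fun t ht => by
    rw [mem_timeInterval_coe] at ht
    simp only [hc', if_pos ht.2]
  -- The two pieces overlap on `[t₀, T)` and agree there by uniqueness. So `c'` coincides with the
  -- shifted `e` in a neighbourhood of the switching time `T`, and no matching of derivatives is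
  -- needed.
  have h2 : ∀ t, t₀ ≤ t → t < t₀ + τ → c' t = e (t - t₀) := fun t ht ht' => by
    by_cases hlt : t < T
    · simp only [hc', if_pos hlt]
      have := (h.shift ht₀ htT).unique' hR hK hG he (t := t - t₀)
        (mem_timeInterval_coe.mpr ⟨by linarith, by linarith⟩)
        (mem_timeInterval_coe.mpr ⟨by linarith, by linarith⟩)
      simpa using this
    · simp only [hc', if_neg hlt]
  have hmem₀ : t₀ ∈ timeInterval (T : EReal) := mem_timeInterval_coe.mpr ⟨ht₀, htT⟩
  have hcT := h.congr h1
  have hmem : ∀ t, t₀ ≤ t → t < t₀ + τ → t - t₀ ∈ timeInterval (τ : EReal) := fun t ht ht' =>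
    mem_timeInterval_coe.mpr ⟨by linarith, by linarith⟩
  refine ⟨c', ⟨by exact_mod_cast (by linarith : 0 < t₀ + τ), ⟨fun t ht => ?_, fun t ht => ?_⟩,
    hcT.init, fun t ht k => ?_⟩, h1⟩
  · have ht' := mem_timeInterval_coe.mp ht
    by_cases htt : t < t₀
    · exact hcT.bounded.rapid t (mem_timeInterval_coe.mpr ⟨ht'.1, htt.trans htT⟩)
    · rw [not_lt] at htt
      rw [← Icc_union_Icc_eq_Icc ht₀ htt]
      refine (hcT.bounded.rapid t₀ hmem₀).union ?_
      obtain ⟨M, hM, hMe⟩ := he.bounded.rapid _ (hmem t htt ht'.2)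
      refine ⟨M, hM, fun s hs k => ?_⟩
      rw [h2 s hs.1 (hs.2.trans_lt ht'.2)]
      exact hMe _ ⟨by linarith [hs.1], by linarith [hs.2]⟩ k
  · have ht' := mem_timeInterval_coe.mp ht
    by_cases htt : t < T
    · exact hcT.bounded.mem t (mem_timeInterval_coe.mpr ⟨ht'.1, htt⟩)
    · have htt' : t₀ ≤ t := by linarith
      rw [h2 t htt' ht'.2]
      exact he.bounded.mem _ (hmem t htt' ht'.2)
  · have ht' := mem_timeInterval_coe.mp ht
    by_cases htt : t < T
    · have hm := mem_timeInterval_coe.mpr ⟨ht'.1, htt⟩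
      have := hcT.ode t hm k
      rw [hasDerivWithinAt_timeInterval_iff hm] at this
      rwa [hasDerivWithinAt_timeInterval_iff ht]
    · have htt' : t₀ < t := by linarith
      have hm := hmem t htt'.le ht'.2
      have h3 := hasDerivAt_of_timeInterval hm (sub_pos.mpr htt') (he.ode _ hm k)
      have h4 := h3.scomp t ((hasDerivAt_id t).sub_const t₀)
      rw [one_smul] at h4
      have h5 : (fun s => c' s k) =ᶠ[𝓝 t] (fun s => e s k) ∘ fun s => id s - t₀ := by
        filter_upwards [Ioo_mem_nhds htt' ht'.2] with s hs
        rw [h2 s hs.1.le hs.2]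
        rfl
      refine ((h4.congr_of_eventuallyEq h5).hasDerivWithinAt).congr_deriv ?_
      simp only [nsRhs, h2 t htt'.le ht'.2]

/-- The sum of the Fourier coefficients is controlled by Sobolev norms of large order. -/
lemma exists_tsum_norm_le_sobolevNorm {n : ℝ} (hn : (d : ℝ) < 2 * n) :
    ∃ C : ℝ, 0 ≤ C ∧ ∀ v : L2Field d, IsSmoothModes (fourierVec v) →
      ∑' k, ‖fourierVec v k‖ ≤ C * sobolevNorm n v := by
  have hn0 : 0 ≤ n := by
    have : (0 : ℝ) ≤ d := Nat.cast_nonneg d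
    linarith
  -- Cauchy–Schwarz against `g k = |k|⁻ⁿ`, which is square summable because `2n > d`.
  set g : (Fin d → ℤ) → ℝ := fun k => if k = 0 then 0 else (Real.sqrt (freqSq k ^ n))⁻¹ with hg
  have hg0 : ∀ k, 0 ≤ g k := fun k => by
    simp only [hg]
    split_ifs
    · exact le_rfl
    · positivity
  have hgs : Summable fun k => g k ^ 2 := by
    refine (summable_norm_rpow_int hn).of_nonneg_of_le (fun _ => sq_nonneg _) fun k => ?_
    by_cases hk : k = 0
    · simp only [hg, if_pos hk]
      rw [zero_pow two_ne_zero]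
      exact Real.rpow_nonneg (norm_nonneg _) _
    · simp only [hg, if_neg hk]
      rw [inv_pow, Real.sq_sqrt (Real.rpow_nonneg (freqSq_nonneg k) n),
        Real.rpow_neg (norm_nonneg _), Real.rpow_mul (norm_nonneg _), Real.rpow_two]
      have h1 : 0 < ‖k‖ ^ 2 := by
        have := one_le_norm_of_ne_zero hk
        positivity
      exact inv_anti₀ (Real.rpow_pos_of_pos h1 n)
        (Real.rpow_le_rpow h1.le (norm_sq_le_freqSq k) hn0)
  refine ⟨Real.sqrt (∑' k, g k ^ 2), Real.sqrt_nonneg _, fun v hv => ?_⟩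
  have hw := sobolevWeight_nonneg (d := d) n
  have hsq : ∀ k, (Real.sqrt (sobolevWeight n k) * ‖fourierVec v k‖) ^ 2 =
      sobolevWeight n k * ‖fourierVec v k‖ ^ 2 := fun k => by rw [mul_pow, Real.sq_sqrt (hw k)]
  have h := tsum_mul_le_sqrt_mul_sqrt hg0
    (g := fun k => Real.sqrt (sobolevWeight n k) * ‖fourierVec v k‖) (fun _ => by positivity) hgs
    (by simpa only [hsq] using hv.summable_weight_sq n)
  simp only [hsq] at h
  have heq : ∀ k, g k * (Real.sqrt (sobolevWeight n k) * ‖fourierVec v k‖) = ‖fourierVec v k‖ := by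
    intro k
    by_cases hk : k = 0
    · rw [hk, hv.zero, norm_zero, mul_zero, mul_zero]
    · simp only [hg, if_neg hk, sobolevWeight]
      rw [← mul_assoc, inv_mul_cancel₀, one_mul]
      exact (Real.sqrt_pos.mpr (Real.rpow_pos_of_pos
        (zero_lt_one.trans_le (one_le_freqSq hk)) n)).ne'
  simp only [heq] at h
  refine h.trans (mul_le_mul_of_nonneg_left ?_ (Real.sqrt_nonneg _))
  exact Real.sqrt_le_iff.mpr ⟨sobolevNorm_nonneg _ _, tsum_weight_le_sobolevNorm_sq n v⟩

lemma SolvesControl.of_le {G K : ℝ} {D D' ε ρ : ℝ → ℝ} {T' : EReal}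
    (h : SolvesControl R G K D D' ε T' ρ) (hT : T ≤ T') : SolvesControl R G K D D' ε T ρ :=
  ⟨h.1, fun t ht => (h.2 t (timeInterval_mono hT ht)).mono (timeInterval_mono hT)⟩

/-- Existence of a maximal solution. -/
lemma exists_maximal_nsSolution (hR : 0 < R) {n K G : ℝ} (hK : IsBasicConst d n K)
    (hG : IsKatoConst d n G) {u₀ : L2Field d} (hu₀ : u₀ ∈ sobolevInf d) :
    ∃ (T : EReal) (u : ℝ → L2Field d), IsMaximalNSSolution R u₀ T u := by
  obtain ⟨T, c, hc, hmax⟩ := exists_maximal_modeSolution hR hK hG (mem_sobolevInf_iff.mp hu₀)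
  refine ⟨T, fun t => ofFourier (c t), hc.isNSSolution fun t ht => funext fun k =>
    (hc.bounded.mem t ht).fourierVec_ofFourier k, fun T' u' h' hle _ => ?_⟩
  exact le_antisymm (hmax T' _ h'.isModeSolution) hle

/-- A maximal solution which exists on a bounded time interval only has an unbounded sum of Fourier
coefficients. -/
lemma IsMaximalNSSolution.false_of_bounded (hR : 0 < R) {n K G : ℝ} (hK : IsBasicConst d n K)
    (hG : IsKatoConst d n G) {u₀ : L2Field d} {u : ℝ → L2Field d} {T : ℝ}
    (h : IsMaximalNSSolution R u₀ (T : EReal) u) {A : ℝ}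
    (hA : ∀ t ∈ timeInterval (T : EReal), ∑' k, ‖fourierVec (u t) k‖ ≤ A) : False := by
  have hm := h.1.isModeSolution
  have hT : 0 < T := by exact_mod_cast h.1.pos
  have hA0 : 0 ≤ A := le_trans (tsum_nonneg fun _ => norm_nonneg _)
    (hA 0 (zero_mem_timeInterval h.1.pos))
  obtain ⟨τ, hτ, hloc⟩ := exists_local_solution (d := d) hR hA0
  -- The restart lies within `τ/2` of `T`, and the lifespan `τ` is uniform since it depends only on
  -- the bound `A`; the new solution therefore passes `T`.
  obtain ⟨t₀, ht₀⟩ : ∃ t₀, t₀ = max 0 (T - τ / 2) := ⟨_, rfl⟩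
  have h0 : 0 ≤ t₀ := ht₀ ▸ le_max_left _ _
  have h1 : t₀ < T := ht₀ ▸ max_lt hT (by linarith)
  have h2 : T < t₀ + τ := by
    have : T - τ / 2 ≤ t₀ := ht₀ ▸ le_max_right _ _
    linarith
  have hmem := mem_timeInterval_coe.mpr ⟨h0, h1⟩
  obtain ⟨e, he⟩ := hloc _ (hm.bounded.mem t₀ hmem) (hA t₀ hmem)
  obtain ⟨c', hc', heq⟩ := hm.extend hR.le hK hG h0 h1 h2 he
  have hns := hc'.isNSSolution (u := fun t => ofFourier (c' t)) fun t ht => funext fun k =>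
    (hc'.bounded.mem t ht).fourierVec_ofFourier k
  have hTT : (T : EReal) < ((t₀ + τ : ℝ) : EReal) := by exact_mod_cast h2
  have hEq : EqOn (fun t => ofFourier (c' t)) u (timeInterval (T : EReal)) := fun t ht =>
    ext_fourierVec fun k => by
      rw [(hc'.bounded.mem t (timeInterval_mono hTT.le ht)).fourierVec_ofFourier, heq t ht]
  exact hTT.ne' (h.2 _ _ hns hTT.le hEq)

end

end NSReynolds

end

/-! ### The proposition on maximal solutions and error bounds. -/

theorem mainTheorem2 (d : ℕ) (R : ℝ) (hR : 0 < R)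
    (uStar : L2Field d) (huStar : uStar ∈ sobolevInf d) (N : ℕ)
    (n : ℝ) (hn : (d : ℝ) / 2 + 1 < n)
    (Kn Gn : ℝ) (hKn : IsBasicConst d n Kn) (hGn : IsKatoConst d n Gn)
    (Dn Dn1 εn : ℝ → ℝ)
    (hDn : IsGrowthEstimator n (reynoldsExpansion R uStar N) Dn)
    (hDn1 : IsGrowthEstimator (n + 1) (reynoldsExpansion R uStar N) Dn1)
    (hεn : IsErrorEstimator R n (reynoldsExpansion R uStar N) εn)
    (Tc : EReal) (hTc : 0 < Tc) (Rn : ℝ → ℝ)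
    (hRn : SolvesControl R Gn Kn Dn Dn1 εn Tc Rn) :
    (∃ (T : EReal) (u : ℝ → L2Field d), IsMaximalNSSolution R uStar T u) ∧
    ∀ (T : EReal) (u : ℝ → L2Field d), IsMaximalNSSolution R uStar T u →
      (Tc ≤ T ∧
        (∀ t ∈ timeInterval Tc,
          0 ≤ Rn t ∧ sobolevNorm n (u t - reynoldsExpansion R uStar N t) ≤ Rn t) ∧
        (Tc = ⊤ → T = ⊤)) ∧
      ∀ p : ℝ, n < p → ∀ Kp Gp Gpn : ℝ,
        IsBasicConst d p Kp → IsKatoConst d p Gp → IsTameKatoConst d p n Gpn →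
        ∀ Dp Dp1 εp : ℝ → ℝ,
          IsGrowthEstimator p (reynoldsExpansion R uStar N) Dp →
          IsGrowthEstimator (p + 1) (reynoldsExpansion R uStar N) Dp1 →
          IsErrorEstimator R p (reynoldsExpansion R uStar N) εp →
          SolvesLinearControl R Gp Kp Gpn Dp Dp1 Rn εp Tc
            (linearControl R Gp Kp Gpn Dp Dp1 Rn εp) ∧
          (∀ Rp : ℝ → ℝ, SolvesLinearControl R Gp Kp Gpn Dp Dp1 Rn εp Tc Rp →
            EqOn Rp (linearControl R Gp Kp Gpn Dp Dp1 Rn εp) (timeInterval Tc) ∧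
            ∀ t ∈ timeInterval Tc,
              0 ≤ Rp t ∧ sobolevNorm p (u t - reynoldsExpansion R uStar N t) ≤ Rp t) := by
  refine ⟨exists_maximal_nsSolution hR hKn hGn huStar, fun T u hu => ?_⟩
  have hsub : ∀ T' : EReal, timeInterval T' ⊆ Ici 0 := fun T' t ht => ht.1
  have hRn0 : ∀ t ∈ timeInterval Tc, 0 ≤ Rn t := fun t ht =>
    hRn.nonneg hTc (hDn.1.mono (hsub _)) (hDn1.1.mono (hsub _)) (hεn.1.mono (hsub _))
      (fun s hs => (hεn.2 s hs).1) ht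
  have hRnc := continuousOn_of_solvesControl hRn
  have happ := isApproxSolution_reynoldsExpansion huStar R N
  have hm := hu.1.isModeSolution
  have h0 : u 0 = reynoldsExpansion R uStar N 0 := by
    rw [reynoldsExpansion_zero huStar, hu.1.init]
  -- The estimate is needed twice: with `T' = T` while `T < Tc` is being refuted, then with `T' =
  -- Tc`.
  have hest : ∀ T' : EReal, 0 < T' → T' ≤ T → T' ≤ Tc → ∀ t ∈ timeInterval T',
      sobolevNorm n (u t - reynoldsExpansion R uStar N t) ≤ Rn t := fun T' hpos hT hc =>
    sobolevNorm_sub_le_control hR.le (hm.of_le hpos hT) (happ.of_le le_top) h0 hKn hGn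
      (hDn.1.mono (hsub _)) (hDn1.1.mono (hsub _)) (fun t ht => (hDn.2 t ht.1).2)
      (fun t ht => (hDn1.2 t ht.1).2) (fun t ht => (hεn.2 t ht.1).2) (hRn.of_le hc)
      fun t ht => hRn0 t (timeInterval_mono hc ht)
  have hTcT : Tc ≤ T := by
    by_contra! hlt
    obtain ⟨Tr, rfl⟩ : ∃ Tr : ℝ, T = (Tr : EReal) := by
      refine ⟨T.toReal, (EReal.coe_toReal hlt.ne_top ?_).symm⟩
      exact (bot_le.trans_lt hu.1.pos).ne'
    have hTr : Tr ∈ timeInterval Tc := ⟨by exact_mod_cast hu.1.pos.le, hlt⟩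
    -- Under the assumption `T < Tc` the closed interval `[0, T]` lies in `[0, Tc)`, so `Rn` is
    -- bounded up to and including `T`.
    obtain ⟨B, hB⟩ := (isCompact_Icc (a := (0 : ℝ)) (b := Tr)).exists_bound_of_continuousOn
      (hRnc.mono (Icc_subset_timeInterval hTr))
    obtain ⟨B', hB'⟩ := (isCompact_Icc (a := (0 : ℝ)) (b := Tr)).exists_bound_of_continuousOn
      (hDn.1.mono fun s hs => hs.1)
    obtain ⟨C, hC, hCn⟩ := exists_tsum_norm_le_sobolevNorm (d := d) (n := n) (by
      have : (0 : ℝ) ≤ d := Nat.cast_nonneg d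
      linarith)
    refine hu.false_of_bounded hR hKn hGn (A := C * B + C * B') fun t ht => ?_
    have htI : t ∈ Icc 0 Tr := ⟨ht.1, (mem_timeInterval_coe.mp ht).2.le⟩
    have hws := isSmoothModes_sub hm (happ.of_le le_top) ht
    have hvs : IsSmoothModes (fourierVec (reynoldsExpansion R uStar N t)) :=
      (happ.of_le (T := (Tr : EReal)) le_top).isDiffCurve.bounded.mem t ht
    have h1 := hCn _ hws
    have h2 := hCn _ hvs
    have h3 := ((hest _ hu.1.pos le_rfl hlt.le t ht).trans (le_abs_self _)).trans (hB t htI)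
    have h4 := ((hDn.2 t ht.1).2.trans (le_abs_self _)).trans (hB' t htI)
    have h5 : ∀ k, ‖fourierVec (u t) k‖ ≤
        ‖fourierVec (u t - reynoldsExpansion R uStar N t : L2Field d) k‖ +
          ‖fourierVec (reynoldsExpansion R uStar N t) k‖ := fun k => by
      have h6 := norm_add_le (fourierVec (u t - reynoldsExpansion R uStar N t : L2Field d) k)
        (fourierVec (reynoldsExpansion R uStar N t) k)
      rwa [fourierVec_sub, sub_add_cancel, ← fourierVec_sub] at h6
    calc _ ≤ ∑' k, (‖fourierVec (u t - reynoldsExpansion R uStar N t : L2Field d) k‖ +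
          ‖fourierVec (reynoldsExpansion R uStar N t) k‖) :=
          (hm.bounded.mem t ht).summable.tsum_le_tsum h5 (hws.summable.add hvs.summable)
      _ = _ := hws.summable.tsum_add hvs.summable
      _ ≤ _ := add_le_add (h1.trans (mul_le_mul_of_nonneg_left h3 hC))
          (h2.trans (mul_le_mul_of_nonneg_left h4 hC))
  have hestc := hest Tc hTc hTcT le_rfl
  refine ⟨⟨hTcT, fun t ht => ⟨hRn0 t ht, hestc t ht⟩, fun h => top_le_iff.mp (h ▸ hTcT)⟩,
    fun p _ Kp Gp Gpn hKp hGp hGpn Dp Dp1 εp hDp hDp1 hεp => ?_⟩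
  have hlin := solvesLinearControl_linearControl (R := R) (G := Gp) (K := Kp) (G' := Gpn)
    (hDp.1.mono (hsub Tc)) (hDp1.1.mono (hsub Tc)) hRnc (hεp.1.mono (hsub Tc))
  refine ⟨hlin, fun Rp hRp => ?_⟩
  have hEq := hRp.eq_linearControl hTc (hDp.1.mono (hsub Tc)) (hDp1.1.mono (hsub Tc)) hRnc
    (hεp.1.mono (hsub Tc))
  have hRp0 : ∀ t ∈ timeInterval Tc, 0 ≤ Rp t := fun t ht => by
    rw [hEq ht]
    exact linearControl_nonneg ht.1 fun s hs => (hεp.2 s hs).1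
  exact ⟨hEq, fun t ht => ⟨hRp0 t ht, sobolevNorm_sub_le_linearControl hR.le
    (hm.of_le hTc hTcT) (happ.of_le le_top) h0 hKp hGp hGpn (hDp.1.mono (hsub _))
    (hDp1.1.mono (hsub _)) hRnc (fun t ht => (hDp.2 t ht.1).2) (fun t ht => (hDp1.2 t ht.1).2)
    (fun t ht => (hεp.2 t ht.1).2) hestc hRp hRp0 t ht⟩⟩
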